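/- **Setting.** Let $m\ge 2$, $I=\{1,\dots,m\}$, and let $f_a(x)=A_ax+b_a$ ($a\in I$) be affine maps of $\mathbb{R}^2$, where each $A_a$ is an invertible $2\times2$ matrix of operator norm $<1$. Let $E$ be the associated self-affine set, i.e. the unique non-empty compact set with $E=\bigcup_{a}f_a(E)$. For a finite word $w=w(1)\cdots w(n)$ put $A_w=A_{w(1)}\cdots A_{w(n)}$, $f_w=f_{w(1)}\circ\cdots\circ f_{w(n)}$, $E_w=f_w(E)$; for $\mathtt{i}\in I^{\mathbb{N}}$ let $\mathtt{i}|_n$ be its first $n$ letters and $\mathtt{i}(n)$ its $n$-th letter, and let $\pi(\mathtt{i})=\sum_{n\ge1}A_{\mathtt{i}|_{n-1}}b_{\mathtt{i}(n)}\in E$. Let $\alpha_1(w)\ge\alpha_2(w)$ be the singular values of $A_w$, $\eta_k(w)$ unit eigenvectors of $A_w^TA_w$ with eigenvalues $\alpha_k(w)^2$, and $\vartheta_k(w)=A_w\eta_k(w)/\|A_w\eta_k(w)\|$ (for $\alpha_1(w)>\alpha_2(w)$ these are determined up to sign). Let $p=(p_1,\dots,p_m)$ be a probability vector with all $p_a>0$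 and $\nu_p$ the Bernoulli (product) measure on $I^{\mathbb{N}}$. The Lyapunov exponents $\lambda_1\le\lambda_2$ are the constants with $-\frac1n\log\alpha_k(\mathtt{i}|_n)\to\lambda_k$ for $\nu_p$-a.e. $\mathtt{i}$. If $\lambda_1<\lambda_2$, then for $\nu_p$-a.e. $\mathtt{i}$ the directions $\vartheta_1(\mathtt{i}|_n)$ converge, for suitable signs, to a unit vector $\overline\vartheta_1(\mathtt{i})$, unique up to sign. When $\pi$ is injective, $\nu_p$ is also regarded, via $\pi$, as a measure on $E$. A *tangent set* of $E$ at $x\in E$ is a compact set that is the Hausdorff limit of $\frac{1}{t_n}\big((E\cap B(x,t_n))-x\big)$ for some sequence $t_n\downarrow0$; $B(x,r)$ denotes a closed ball. A set $C\subset\mathbb{R}$ is *porous* if there is $0<\alpha\le1$ such that for all $x\in C$ and $0<r<\operatorname{diam}(C)$ there is $y\in\mathbb{R}$ with $B(y,\alpha r)\subset B(x,r)\setminus C$. A set $F\subset E$ satisfies the *line condition* for $N\in\mathbb{N}$ if for all $\pi(\mathtt{i})\in F$ and all large $n$, any line in direction $\vartheta_2(\mathtt{i}|_{n-N})$ that intersects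 $E_{\mathtt{i}|_n}$ also intersects $E_{\mathtt{i}|_{n-N}\mathtt{j}}$ for some finite word $\mathtt{j}$ with $\mathtt{j}(1)\ne\mathtt{i}(n-N+1)$. **Proposition 4.1.** Assume that 1. there is $\delta>0$ with $\operatorname{dist}(f_a(E),f_c(E))>\delta$ for all $a\neq c$; 2. for $\nu_p$-a.e. $\mathtt{i}\in I^{\mathbb{N}}$ there is $n_0$ such that for all $n\ge n_0$ and all finite words $\mathtt{j}$, the orthogonal projection of $E_{\mathtt{i}|_n\mathtt{j}}$ onto the line spanned by $\overline\vartheta_1(\mathtt{i})$ is a non-degenerate line segment; 3. $\lambda_1<\lambda_2$; 4. for every $\varrho>0$ there is $E_\varrho\subset E$ with $\nu_p(E_\varrho)\ge1-\varrho$ that satisfies the line condition for some $N_\varrho\in\mathbb{N}$. Then for $\nu_p$-a.e. $x\in E$, every tangent set of $E$ at $x$ is of the form $\mathcal{O}\big((\mathbb{R}\times C)\cap B(0,1)\big)$, where $C\subset\mathbb{R}$ is closed and porous and $\mathcal{O}$ is the rotation taking $(1,0)$ to $\overline\vartheta_1(\pi^{-1}(x))$. -/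

import Mathlib

open Set Filter Topology MeasureTheory

noncomputable section

/-- The Euclidean plane. -/
abbrev Plane : Type := EuclideanSpace ℝ (Fin 2)

/-- An affine iterated function system `f_a(x) = A_a x + b_a` on the plane (letters `a : Fin m`),
with invertible linear parts of Euclidean operator norm strictly less than one. -/
structure AffineIFS (m : ℕ) where
  /-- the linear parts -/
  A : Fin m → Plane →L[ℝ] Plane
  /-- the translation parts -/
  b : Fin m → Plane
  isUnit_A : ∀ a, IsUnit (A a)
  norm_A_lt_one : ∀ a, ‖A a‖ < 1

/-- The finite word formed by the first `n` letters of the infinite word `i`. The letters of `i` are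
indexed from `0`, so the `n`-th letter in the usual numbering is `i (n - 1)`. -/
def wordPrefix {m : ℕ} (i : ℕ → Fin m) (n : ℕ) : List (Fin m) :=
  List.ofFn fun k : Fin n => i k

namespace AffineIFS

variable {m : ℕ} (S : AffineIFS m)

/-- The map `f_a`. -/
def f (a : Fin m) (x : Plane) : Plane := S.A a x + S.b a

/-- `f_w = f_{w(1)} ∘ ⋯ ∘ f_{w(|w|)}` for a finite word `w`. -/
def fWord (w : List (Fin m)) (x : Plane) : Plane := w.foldr S.f x

/-- `A_w = A_{w(1)} ⋯ A_{w(|w|)}` for a finite word `w`. -/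
def AWord (w : List (Fin m)) : Plane →L[ℝ] Plane := (w.map S.A).prod

/-- `E` is the self-affine set of the system: the (unique) non-empty compact set which is the union
of its images under the maps of the system. -/
structure IsSelfAffineSet (E : Set Plane) : Prop where
  isCompact : IsCompact E
  nonempty : E.Nonempty
  eq_iUnion : E = ⋃ a, S.f a '' E

/-- The construction cylinder `E_w = f_w(E)`. -/
def cylinder (E : Set Plane) (w : List (Fin m)) : Set Plane := S.fWord w '' E

/-- The canonical projection `π(i) = ∑_{n ≥ 1} A_{i_1} ⋯ A_{i_{n-1}} b_{i_n}`. -/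
def proj (i : ℕ → Fin m) : Plane := ∑' n : ℕ, S.AWord (wordPrefix i n) (S.b (i n))

/-- The singular values of `A_w`: `S.α 0 w` is the larger one, `α₁(w)`, and `S.α 1 w` is the smaller
one, `α₂(w)`. -/
def α (k : Fin 2) (w : List (Fin m)) : ℝ := (S.AWord w).toLinearMap.singularValues k

/-- `v` is a possible value of the semiaxis direction `ϑ_k(w) = A_w η_k(w) / ‖A_w η_k(w)‖`, where
`η_k(w)` is a unit eigenvector of `A_wᵀ A_w` with eigenvalue `α_k(w)²` (index `0` for `ϑ₁`, `1` for
`ϑ₂`). If `α₁(w) > α₂(w)`, this determines `v` up to sign; otherwise `v` is any unit vector. -/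
def IsSemiaxis (k : Fin 2) (w : List (Fin m)) (v : Plane) : Prop :=
  ∃ η : Plane, ‖η‖ = 1 ∧
    (ContinuousLinearMap.adjoint (S.AWord w)) (S.AWord w η) = (S.α k w) ^ 2 • η ∧
    v = ‖S.AWord w η‖⁻¹ • S.AWord w η

/-- `u` is the limit `ϑ̄₁(i)` of the directions `ϑ₁(i|_n)` as `n → ∞`, for some choice of the free
signs. Where `α₁(i|_n) > α₂(i|_n)` for all large `n`, such a `u` is unique up to sign. -/
def IsLimitDirection (i : ℕ → Fin m) (u : Plane) : Prop :=
  ∃ v : ℕ → Plane, (∀ n, S.IsSemiaxis 0 (wordPrefix i n) (v n)) ∧ Tendsto v atTop (𝓝 u)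

/-- The Bernoulli measure `ν_p` on infinite words: the product of the probability vector `p`. -/
def bernoulli (p : PMF (Fin m)) : Measure (ℕ → Fin m) :=
  Measure.infinitePi fun _ : ℕ => p.toMeasure

/-- The Lyapunov exponent `λ_k` of `ν_p`: the constant to which `-(1/n) log α_k(i|_n)` converges for
`ν_p`-almost every `i` (index `0` for `λ₁` and `1` for `λ₂`). -/
def lyapunov (p : PMF (Fin m)) (k : Fin 2) : ℝ :=
  Classical.epsilon fun l : ℝ => ∀ᵐ i ∂bernoulli p,
    Tendsto (fun n : ℕ => -(1 / (n : ℝ)) * Real.log (S.α k (wordPrefix i n))) atTop (𝓝 l)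

/-- The strong separation condition: the distances between distinct sets `f_a(E)`, `f_c(E)` exceed
some `δ > 0`. -/
def StrongSeparation (E : Set Plane) : Prop :=
  ∃ δ : ℝ, 0 < δ ∧ ∀ a c : Fin m, a ≠ c →
    ∀ x ∈ S.f a '' E, ∀ y ∈ S.f c '' E, δ < dist x y

/-- `B` is a (non-degenerate) line segment. -/
def _root_.IsLineSegment (B : Set Plane) : Prop :=
  ∃ x y : Plane, x ≠ y ∧ B = segment ℝ x y

/-- The projection condition: for `ν_p`-almost every `i` there is `n₀` such that for all `n ≥ n₀` and
all finite words `j`, the orthogonal projection of `E_{i|_n j}` onto the line spanned by `ϑ̄₁(i)` is a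
line segment. -/
def ProjectionCondition (p : PMF (Fin m)) (E : Set Plane) : Prop :=
  ∀ᵐ i ∂bernoulli p, ∀ u : Plane, S.IsLimitDirection i u →
    ∃ n₀ : ℕ, ∀ n ≥ n₀, ∀ j : List (Fin m),
      IsLineSegment ((Submodule.span ℝ {u}).starProjection '' S.cylinder E (wordPrefix i n ++ j))

/-- The line through `x` in direction `v`. -/
def _root_.lineThrough (x v : Plane) : Set Plane := {y | ∃ s : ℝ, y = x + s • v}

/-- `F ⊆ E` satisfies the line condition for `N`: for all `π(i) ∈ F` and all large `n`, any line in
direction `ϑ₂(i|_{n-N})` that meets `E_{i|_n}` also meets `E_{i|_{n-N} j}` for some finite word `j`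
whose first letter `a` differs from the letter number `n - N + 1` of `i`. (The subtraction `n - N` is
only relevant for large `n`.) -/
def LineCondition (E F : Set Plane) (N : ℕ) : Prop :=
  ∀ i : ℕ → Fin m, S.proj i ∈ F → ∀ᶠ n : ℕ in atTop,
    ∃ v : Plane, S.IsSemiaxis 1 (wordPrefix i (n - N)) v ∧
      ∀ x : Plane, (lineThrough x v ∩ S.cylinder E (wordPrefix i n)).Nonempty →
        ∃ (a : Fin m) (j : List (Fin m)), a ≠ i (n - N) ∧
          (lineThrough x v ∩ S.cylinder E (wordPrefix i (n - N) ++ a :: j)).Nonempty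

end AffineIFS

/-- The scenery of `E` around `x` at scale `t`: the image of `E ∩ B(x, t)` under
`y ↦ (y - x) / t`. -/
def scenery (E : Set Plane) (x : Plane) (t : ℝ) : Set Plane :=
  (fun y => t⁻¹ • (y - x)) '' (E ∩ Metric.closedBall x t)

/-- `T` is a tangent set of `E` at `x`: a compact set that is the limit, in the Hausdorff metric, of
sceneries of `E` around `x` along a sequence of positive scales tending to zero. -/
def IsTangentSet (E : Set Plane) (x : Plane) (T : Set Plane) : Prop :=
  IsCompact T ∧ ∃ t : ℕ → ℝ, (∀ n, 0 < t n) ∧ Tendsto t atTop (𝓝 0) ∧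
    Tendsto (fun n => Metric.hausdorffEDist (scenery E x (t n)) T) atTop (𝓝 0)

/-- `A` is porous (uniformly lower porous): there is `0 < α ≤ 1` such that for all `x ∈ A` and
`0 < r < diam A` some closed ball of radius `α r` is contained in `B(x, r) \ A`. The diameter is taken
in `[0, ∞]`. -/
def IsPorous {X : Type*} [PseudoMetricSpace X] (A : Set X) : Prop :=
  ∃ α : ℝ, 0 < α ∧ α ≤ 1 ∧ ∀ x ∈ A, ∀ r : ℝ, 0 < r → ENNReal.ofReal r < Metric.ediam A →
    ∃ y : X, Metric.closedBall y (α * r) ⊆ Metric.closedBall x r \ A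

/-- For a unit vector `u`, the rotation of the plane about the origin that takes `(1, 0)` to `u`. -/
def rotationTo (u z : Plane) : Plane :=
  !₂[u 0 * z 0 - u 1 * z 1, u 1 * z 0 + u 0 * z 1]

/-- The set `(ℝ × C) ∩ B(0, 1)`. -/
def lineFibres (C : Set ℝ) : Set Plane := {z | z 1 ∈ C} ∩ Metric.closedBall 0 1

end

/-! Fix a typical word `i`, put `x = π(i)` and `w = i|_n`, and look at a scale `t` comparable to `δ
α₂(w)`, with `t < δ α₂(w)`. By strong separation, points of `E` outside `E_w` are farther than `t`
from `x` (`lt_dist_of_notMem_cylinder`), so the scenery at scale `t` is an affine image of a piece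
of `E`. Because `λ₁ < λ₂`, the ratio `α₂(w)/α₁(w)` is exponentially small (`exists_flattening`):
pulled back by `f_w`, the ball becomes an ever thinner strip, bounded in the long direction.

Porosity. In the limit the strip degenerates to a line, and the heights of a tangent set above the
direction `u = ϑ̄₁(i)` lie in an affine copy of a slice of `E` by that line (`exists_slice`). Such a
slice is porous (`isPorous_slice`): gaps between first-level pieces are carried into every cylinder,
since affine maps preserve length ratios along parallel lines. Porosity passes to subsets.

Fibres. Let `y ∈ E ∩ B(x, t)` lie in `E_{wj}`, with `|j|` fixed but so large that `E_{wj}` is thin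
compared with `t`. The projection of `E_{wj}` along `u` is an interval. If both its ends are farther
than `t` from the projection of `x`, the interval covers the whole window of radius `t`, so `E` has
points near the full chord through `y` (`eventually_fibre`).

That the ends are far is the probabilistic core. Up to `O(α₂/α₁)`, the ends correspond to extreme
points of `E_j` in the direction `e₁(w)`, which depends on the prefix only up to sign, while the
tail of `i` is independent of the prefix. Strips of width `ε` have measure at most a power of `ε`,
uniformly in their direction (`exists_strip_bound`), so Borel–Cantelli shows that the tail
eventually avoids the bad strips (`ae_eventually_avoid`). The strip bound needs `E` not to lie in a
line, which follows from separation together with the projection condition (`exists_inner_ne`).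

The exponents are selected by a choice operator, so their defining limits must be shown to exist;
this is done through a subadditive ergodic theorem for Bernoulli measures (`tendsto_avg`), applied
to `log ‖A_w‖` and `log |det A_w|`. -/

/-! ### Words and shifts -/

/-- The infinite word obtained by deleting the first `n` letters. -/
def wordShift {m : ℕ} (n : ℕ) (i : ℕ → Fin m) : ℕ → Fin m := fun k => i (k + n)

@[simp] theorem wordShift_zero {m : ℕ} (i : ℕ → Fin m) : wordShift 0 i = i := rfl

theorem wordShift_wordShift {m : ℕ} (n k : ℕ) (i : ℕ → Fin m) :
    wordShift n (wordShift k i) = wordShift (n + k) i := by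
  funext l; simp [wordShift, add_assoc]

@[simp] theorem wordPrefix_zero {m : ℕ} (i : ℕ → Fin m) : wordPrefix i 0 = [] := by
  simp [wordPrefix]

theorem wordPrefix_succ {m : ℕ} (i : ℕ → Fin m) (n : ℕ) :
    wordPrefix i (n + 1) = i 0 :: wordPrefix (wordShift 1 i) n := by
  simp [wordPrefix, wordShift, List.ofFn_succ]

@[simp] theorem length_wordPrefix {m : ℕ} (i : ℕ → Fin m) (n : ℕ) :
    (wordPrefix i n).length = n := by
  simp [wordPrefix]

theorem wordPrefix_add {m : ℕ} (i : ℕ → Fin m) (n k : ℕ) :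
    wordPrefix i (n + k) = wordPrefix i n ++ wordPrefix (wordShift n i) k := by
  induction n generalizing i with
  | zero => simp
  | succ n ih =>
    rw [show n + 1 + k = (n + k) + 1 by ring, wordPrefix_succ, wordPrefix_succ, ih,
      wordShift_wordShift]
    rfl

theorem wordPrefix_succ' {m : ℕ} (i : ℕ → Fin m) (n : ℕ) :
    wordPrefix i (n + 1) = wordPrefix i n ++ [i n] := by
  rw [wordPrefix_add, wordPrefix_succ, wordPrefix_zero]
  simp [wordShift]

namespace AffineIFS

variable {m : ℕ} (S : AffineIFS m)

@[simp] theorem AWord_nil : S.AWord [] = 1 := rfl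

@[simp] theorem AWord_cons (a : Fin m) (w : List (Fin m)) :
    S.AWord (a :: w) = S.A a * S.AWord w := by
  simp [AWord]

theorem AWord_append (w v : List (Fin m)) : S.AWord (w ++ v) = S.AWord w * S.AWord v := by
  simp [AWord]

@[simp] theorem fWord_nil (x : Plane) : S.fWord [] x = x := rfl

@[simp] theorem fWord_cons (a : Fin m) (w : List (Fin m)) (x : Plane) :
    S.fWord (a :: w) x = S.f a (S.fWord w x) := rfl

theorem fWord_append (w v : List (Fin m)) (x : Plane) :
    S.fWord (w ++ v) x = S.fWord w (S.fWord v x) := by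
  simp [fWord, List.foldr_append]

theorem f_sub (a : Fin m) (x y : Plane) : S.f a x - S.f a y = S.A a (x - y) := by
  simp [f]

theorem fWord_sub (w : List (Fin m)) (x y : Plane) :
    S.fWord w x - S.fWord w y = S.AWord w (x - y) := by
  induction w with
  | nil => simp
  | cons a w ih => rw [fWord_cons, fWord_cons, f_sub, ih, AWord_cons]; rfl

theorem continuous_fWord (w : List (Fin m)) : Continuous (S.fWord w) := by
  have : S.fWord w = fun x => S.AWord w x + S.fWord w 0 := by
    funext x
    have := S.fWord_sub w x 0
    rw [sub_zero] at this
    rw [← this]; abel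
  rw [this]
  fun_prop

theorem isUnit_AWord (w : List (Fin m)) : IsUnit (S.AWord w) := by
  induction w with
  | nil => simp
  | cons a w ih => rw [AWord_cons]; exact (S.isUnit_A a).mul ih

theorem AWord_injective (w : List (Fin m)) : Function.Injective (S.AWord w) := by
  obtain ⟨u, hu⟩ := S.isUnit_AWord w
  intro x y h
  have h2 : ∀ z, (u⁻¹).1 (S.AWord w z) = z := fun z => by
    rw [← hu]
    change ((u⁻¹).1 * u.1) z = z
    simp
  rw [← h2 x, h, h2]

theorem exists_contraction : ∃ r : ℝ, 0 < r ∧ r < 1 ∧ ∀ a, ‖S.A a‖ ≤ r := by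
  rcases isEmpty_or_nonempty (Fin m) with h | h
  · exact ⟨1 / 2, by norm_num, by norm_num, fun a => (h.false a).elim⟩
  · obtain ⟨a, ha⟩ := Finite.exists_max fun a => ‖S.A a‖
    exact ⟨max ‖S.A a‖ (1 / 2), by positivity, max_lt (S.norm_A_lt_one a) (by norm_num),
      fun b => (ha b).trans (le_max_left _ _)⟩

/-- There are finitely many invertible matrices. The constant bounds the loss of a singular value
when one letter is added, so consecutive levels have comparable scales. -/
theorem exists_expansion : ∃ τ : ℝ, 0 < τ ∧ τ < 1 ∧ ∀ a v, τ * ‖v‖ ≤ ‖S.A a v‖ := by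
  have h1 : ∀ a, ∃ c : ℝ, 0 < c ∧ ∀ v, c * ‖v‖ ≤ ‖S.A a v‖ := by
    intro a
    obtain ⟨u, hu⟩ := S.isUnit_A a
    refine ⟨(‖(u⁻¹).1‖ + 1)⁻¹, by positivity, fun v => ?_⟩
    have h2 : (u⁻¹).1 (S.A a v) = v := by
      rw [← hu]
      change ((u⁻¹).1 * u.1) v = v
      simp
    rw [inv_mul_le_iff₀ (by positivity)]
    calc ‖v‖ = ‖(u⁻¹).1 (S.A a v)‖ := by rw [h2]
      _ ≤ ‖(u⁻¹).1‖ * ‖S.A a v‖ := ContinuousLinearMap.le_opNorm _ _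
      _ ≤ _ := by nlinarith [norm_nonneg (S.A a v)]
  choose c hc hc2 using h1
  rcases isEmpty_or_nonempty (Fin m) with h | h
  · exact ⟨1 / 2, by norm_num, by norm_num, fun a => (h.false a).elim⟩
  · obtain ⟨a, ha⟩ := Finite.exists_min c
    refine ⟨min (c a) (1 / 2), lt_min (hc a) (by norm_num), ?_, fun b v => ?_⟩
    · exact (min_le_right _ _).trans_lt (by norm_num)
    · exact (mul_le_mul_of_nonneg_right ((min_le_left _ _).trans (ha b)) (norm_nonneg _)).trans
        (hc2 b v)

theorem norm_AWord_le {r : ℝ} (h0 : 0 ≤ r) (hr : ∀ a, ‖S.A a‖ ≤ r) (w : List (Fin m)) :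
    ‖S.AWord w‖ ≤ r ^ w.length := by
  induction w with
  | nil => simp
  | cons a w ih =>
    rw [AWord_cons, List.length_cons, pow_succ']
    exact (norm_mul_le _ _).trans (mul_le_mul (hr a) ih (norm_nonneg _) h0)

theorem le_norm_AWord_apply {τ : ℝ} (h0 : 0 ≤ τ) (hτ : ∀ a v, τ * ‖v‖ ≤ ‖S.A a v‖)
    (w : List (Fin m)) (v : Plane) : τ ^ w.length * ‖v‖ ≤ ‖S.AWord w v‖ := by
  induction w with
  | nil => simp
  | cons a w ih =>
    rw [AWord_cons, List.length_cons, pow_succ', mul_assoc]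
    exact (mul_le_mul_of_nonneg_left ih h0).trans (hτ a _)

theorem dist_fWord_le {r : ℝ} (h0 : 0 ≤ r) (hr : ∀ a, ‖S.A a‖ ≤ r) (w : List (Fin m))
    (x y : Plane) : ‖S.fWord w x - S.fWord w y‖ ≤ r ^ w.length * ‖x - y‖ := by
  rw [fWord_sub]
  exact (ContinuousLinearMap.le_opNorm _ _).trans
    (mul_le_mul_of_nonneg_right (S.norm_AWord_le h0 hr w) (norm_nonneg _))

/-! ### The canonical projection -/

/-- A geometric majorant independent of the word gives convergence, continuity and boundedness of
`π` at once. -/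
theorem exists_proj_bound : ∃ u : ℕ → ℝ, Summable u ∧
    ∀ (i : ℕ → Fin m) n, ‖S.AWord (wordPrefix i n) (S.b (i n))‖ ≤ u n := by
  obtain ⟨r, h0, h1, hr⟩ := S.exists_contraction
  obtain ⟨B, hB⟩ := (Set.finite_range fun a => ‖S.b a‖).bddAbove
  refine ⟨fun n => r ^ n * B, (summable_geometric_of_lt_one h0.le h1).mul_right B, fun i n => ?_⟩
  refine (ContinuousLinearMap.le_opNorm _ _).trans ?_
  refine mul_le_mul ?_ (hB ⟨i n, rfl⟩) (norm_nonneg _) (by positivity)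
  simpa using S.norm_AWord_le h0.le hr (wordPrefix i n)

theorem summable_proj (i : ℕ → Fin m) :
    Summable fun n => S.AWord (wordPrefix i n) (S.b (i n)) := by
  obtain ⟨u, hu, h⟩ := S.exists_proj_bound
  exact Summable.of_norm_bounded hu (h i)

theorem continuous_proj : Continuous S.proj := by
  obtain ⟨u, hu, h⟩ := S.exists_proj_bound
  refine continuous_tsum (fun n => ?_) hu (fun n i => h i n)
  have h1 : Continuous fun i : ℕ → Fin m => (fun k : Fin (n + 1) => i k) := by fun_prop
  -- Each term depends on `n + 1` letters only, hence factors through a discrete space.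
  have h2 : (fun i : ℕ → Fin m => S.AWord (wordPrefix i n) (S.b (i n))) =
      (fun g : Fin (n + 1) → Fin m =>
        S.AWord (List.ofFn fun k : Fin n => g k.castSucc) (S.b (g (Fin.last n)))) ∘
      fun i : ℕ → Fin m => (fun k : Fin (n + 1) => i k) := by
    funext i
    simp [wordPrefix]
  rw [h2]
  exact continuous_of_discreteTopology.comp h1

theorem proj_eq_f (i : ℕ → Fin m) : S.proj i = S.f (i 0) (S.proj (wordShift 1 i)) := by
  have h := (S.summable_proj i).tsum_eq_zero_add
  rw [proj, h, f, proj, ContinuousLinearMap.map_tsum _ (S.summable_proj _), add_comm]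
  simp [wordPrefix_succ, wordShift]

theorem proj_eq_fWord (i : ℕ → Fin m) (n : ℕ) :
    S.proj i = S.fWord (wordPrefix i n) (S.proj (wordShift n i)) := by
  induction n generalizing i with
  | zero => simp
  | succ n ih =>
    rw [proj_eq_f, ih, wordPrefix_succ, wordShift_wordShift]
    rfl

theorem tendsto_fWord (i : ℕ → Fin m) (x : Plane) :
    Tendsto (fun n => S.fWord (wordPrefix i n) x) atTop (𝓝 (S.proj i)) := by
  obtain ⟨r, h0, h1, hr⟩ := S.exists_contraction
  obtain ⟨u, hu, h⟩ := S.exists_proj_bound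
  have hb : ∀ j, ‖S.proj j‖ ≤ ∑' n, u n := fun j => tsum_of_norm_bounded hu.hasSum (h j)
  have hlim : Tendsto (fun n : ℕ => r ^ n * (‖x‖ + ∑' n, u n)) atTop (𝓝 0) := by
    simpa using (tendsto_pow_atTop_nhds_zero_of_lt_one h0.le h1).mul_const (‖x‖ + ∑' n, u n)
  rw [tendsto_iff_norm_sub_tendsto_zero]
  refine squeeze_zero (fun _ => norm_nonneg _) (fun n => ?_) hlim
  rw [S.proj_eq_fWord i n]
  refine (S.dist_fWord_le h0.le hr _ _ _).trans ?_
  rw [length_wordPrefix]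
  refine mul_le_mul_of_nonneg_left ?_ (by positivity)
  exact (norm_sub_le _ _).trans (by linarith [hb (wordShift n i)])

variable {S} {E : Set Plane}

/-! ### Addresses of the points of a self-affine set. -/

namespace IsSelfAffineSet

theorem f_mem (hE : S.IsSelfAffineSet E) (a : Fin m) {x : Plane} (hx : x ∈ E) : S.f a x ∈ E := by
  rw [hE.eq_iUnion]
  exact mem_iUnion.2 ⟨a, mem_image_of_mem _ hx⟩

theorem fWord_mem (hE : S.IsSelfAffineSet E) (w : List (Fin m)) {x : Plane} (hx : x ∈ E) :
    S.fWord w x ∈ E := by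
  induction w with
  | nil => exact hx
  | cons a w ih => exact hE.f_mem a ih

theorem exists_diam (hE : S.IsSelfAffineSet E) : ∃ D : ℝ, 0 < D ∧ ∀ x ∈ E, ∀ y ∈ E,
    ‖x - y‖ ≤ D := by
  refine ⟨Metric.diam E + 1, by positivity, fun x hx y hy => ?_⟩
  rw [← dist_eq_norm]
  exact (Metric.dist_le_diam_of_mem hE.isCompact.isBounded hx hy).trans (by linarith)

theorem proj_mem (hE : S.IsSelfAffineSet E) (i : ℕ → Fin m) : S.proj i ∈ E := by
  obtain ⟨x, hx⟩ := hE.nonempty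
  exact hE.isCompact.isClosed.mem_of_tendsto (S.tendsto_fWord i x)
    (Eventually.of_forall fun n => hE.fWord_mem _ hx)

/-- An address is obtained by choosing, again and again, a first-level piece containing the current
point and passing to its preimage. The point and the projection of its address then share cylinders
of diameter tending to zero. -/
theorem exists_proj (hE : S.IsSelfAffineSet E) {y : Plane} (hy : y ∈ E) :
    ∃ i, S.proj i = y := by
  have h1 : ∀ z : E, ∃ (a : Fin m) (z' : E), S.f a z' = z := by
    rintro ⟨z, hz⟩
    rw [hE.eq_iUnion] at hz
    obtain ⟨a, z', hz', rfl⟩ := mem_iUnion.1 hz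
    exact ⟨a, ⟨z', hz'⟩, rfl⟩
  choose a g hg using h1
  let s : ℕ → E := fun n => g^[n] ⟨y, hy⟩
  let i : ℕ → Fin m := fun n => a (s n)
  have hs : ∀ n, S.fWord (wordPrefix i n) (s n) = y := by
    intro n
    induction n with
    | zero => simp [s]
    | succ n ih =>
      rw [wordPrefix_succ', fWord_append, fWord_cons, fWord_nil]
      have : ((s (n + 1) : E) : Plane) = g (s n) := by
        simp only [s, Function.iterate_succ_apply']
      rw [this]
      change S.fWord _ (S.f (a (s n)) (g (s n))) = y
      rw [hg, ih]
  refine ⟨i, ?_⟩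
  obtain ⟨r, h0, h1, hr⟩ := S.exists_contraction
  obtain ⟨D, hD, hdiam⟩ := hE.exists_diam
  have hlim : Tendsto (fun n : ℕ => r ^ n * D) atTop (𝓝 0) := by
    simpa using (tendsto_pow_atTop_nhds_zero_of_lt_one h0.le h1).mul_const D
  have h2 : ∀ n, ‖S.proj i - y‖ ≤ r ^ n * D := by
    intro n
    rw [S.proj_eq_fWord i n, ← hs n]
    refine (S.dist_fWord_le h0.le hr _ _ _).trans ?_
    rw [length_wordPrefix]
    exact mul_le_mul_of_nonneg_left (hdiam _ (hE.proj_mem _) _ (s n).2) (by positivity)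
  have h3 := ge_of_tendsto' hlim h2
  exact sub_eq_zero.1 (norm_le_zero_iff.1 h3)

/-- A point of `E` outside the cylinder of `i|_n` branches off at some level below `n`. -/
theorem exists_branch (hE : S.IsSelfAffineSet E) (i : ℕ → Fin m) (n : ℕ) {y : Plane} (hy : y ∈ E)
    (hn : y ∉ S.cylinder E (wordPrefix i n)) :
    ∃ h < n, ∃ c, c ≠ i h ∧ ∃ z ∈ S.f c '' E, y = S.fWord (wordPrefix i h) z := by
  induction n with
  | zero => exact absurd ⟨y, hy, by simp⟩ hn
  | succ n ih =>
    by_cases h : y ∈ S.cylinder E (wordPrefix i n)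
    · obtain ⟨z, hz, rfl⟩ := h
      have hz' := hz
      rw [hE.eq_iUnion] at hz'
      obtain ⟨c, hc⟩ := mem_iUnion.1 hz'
      refine ⟨n, by omega, c, ?_, z, hc, rfl⟩
      rintro rfl
      obtain ⟨q, hq, rfl⟩ := hc
      refine hn ⟨q, hq, ?_⟩
      rw [wordPrefix_succ', fWord_append]
      rfl
    · obtain ⟨k, hk, H⟩ := ih h
      exact ⟨k, by omega, H⟩

theorem isCompact_cylinder (hE : S.IsSelfAffineSet E) (w : List (Fin m)) :
    IsCompact (S.cylinder E w) :=
  hE.isCompact.image (S.continuous_fWord w)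

theorem mem_cylinder_prefix (hE : S.IsSelfAffineSet E) (i : ℕ → Fin m) (n : ℕ) :
    S.proj i ∈ S.cylinder E (wordPrefix i n) :=
  ⟨_, hE.proj_mem _, (S.proj_eq_fWord i n).symm⟩

end IsSelfAffineSet

end AffineIFS

/-! ### Orthonormal pairs and singular value decompositions in the plane -/

/-- `e₁, e₂` is an orthonormal pair. -/
structure OrthoPair (e₁ e₂ : Plane) : Prop where
  norm_fst : ‖e₁‖ = 1
  norm_snd : ‖e₂‖ = 1
  inner_eq : inner ℝ e₁ e₂ = 0

namespace OrthoPair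

variable {e₁ e₂ : Plane}

theorem symm (h : OrthoPair e₁ e₂) : OrthoPair e₂ e₁ :=
  ⟨h.norm_snd, h.norm_fst, by rw [real_inner_comm]; exact h.inner_eq⟩

theorem eq_add (h : OrthoPair e₁ e₂) (v : Plane) :
    v = inner ℝ e₁ v • e₁ + inner ℝ e₂ v • e₂ := by
  have ho : Orthonormal ℝ ![e₁, e₂] := by
    constructor
    · intro i; fin_cases i
      · exact h.norm_fst
      · exact h.norm_snd
    · intro i j hij
      fin_cases i <;> fin_cases j <;> simp at hij ⊢
      · exact h.inner_eq
      · exact h.symm.inner_eq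
  let b := basisOfOrthonormalOfCardEqFinrank ho (by simp)
  have hb : ⇑b = ![e₁, e₂] := coe_basisOfOrthonormalOfCardEqFinrank ho (by simp)
  let c := b.toOrthonormalBasis (by rw [hb]; exact ho)
  have := c.sum_repr' v
  rw [Fin.sum_univ_two] at this
  have h0 : c 0 = e₁ := by simp [c, hb]
  have h1 : c 1 = e₂ := by simp [c, hb]
  rw [h0, h1] at this
  exact this.symm

theorem norm_sq (h : OrthoPair e₁ e₂) (v : Plane) :
    ‖v‖ ^ 2 = inner ℝ e₁ v ^ 2 + inner ℝ e₂ v ^ 2 := by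
  rw [← real_inner_self_eq_norm_sq v]
  conv_lhs => rw [h.eq_add v]
  rw [inner_add_left, real_inner_smul_left, real_inner_smul_left, ← h.eq_add v]
  ring

theorem norm_le (h : OrthoPair e₁ e₂) (v : Plane) :
    ‖v‖ ≤ |inner ℝ e₁ v| + |inner ℝ e₂ v| := by
  refine abs_le_of_sq_le_sq' ?_ (by positivity) |>.2
  rw [h.norm_sq, ← sq_abs (inner ℝ e₁ v), ← sq_abs (inner ℝ e₂ v)]
  nlinarith [abs_nonneg (inner ℝ e₁ v), abs_nonneg (inner ℝ e₂ v)]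

theorem inner_smul_add_smul_fst (h : OrthoPair e₁ e₂) (a b : ℝ) :
    inner ℝ e₁ (a • e₁ + b • e₂) = a := by
  rw [inner_add_right, real_inner_smul_right, real_inner_smul_right, h.inner_eq,
    real_inner_self_eq_norm_sq, h.norm_fst]
  ring

theorem inner_smul_add_smul_snd (h : OrthoPair e₁ e₂) (a b : ℝ) :
    inner ℝ e₂ (a • e₁ + b • e₂) = b := by
  rw [add_comm]
  exact h.symm.inner_smul_add_smul_fst b a

theorem abs_inner_fst_le (h : OrthoPair e₁ e₂) (v : Plane) : |inner ℝ e₁ v| ≤ ‖v‖ := by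
  simpa [h.norm_fst] using abs_real_inner_le_norm e₁ v

theorem abs_inner_snd_le (h : OrthoPair e₁ e₂) (v : Plane) : |inner ℝ e₂ v| ≤ ‖v‖ :=
  h.symm.abs_inner_fst_le v

theorem neg (h : OrthoPair e₁ e₂) : OrthoPair (-e₁) (-e₂) :=
  ⟨by simpa using h.norm_fst, by simpa using h.norm_snd, by simpa using h.inner_eq⟩

theorem inner_mul_add (h : OrthoPair e₁ e₂) (u v : Plane) :
    inner ℝ u v = inner ℝ e₁ u * inner ℝ e₁ v + inner ℝ e₂ u * inner ℝ e₂ v := by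
  conv_lhs => rw [h.eq_add v]
  rw [inner_add_right, real_inner_smul_right, real_inner_smul_right, real_inner_comm u e₁,
    real_inner_comm u e₂]
  ring

end OrthoPair

/-- The counterclockwise rotation by a right angle. -/
noncomputable def rotateQuarter (u : Plane) : Plane := !₂[-u 1, u 0]

theorem inner_plane (u v : Plane) : inner ℝ u v = u 0 * v 0 + u 1 * v 1 := by
  simp [PiLp.inner_apply, Fin.sum_univ_two, mul_comm]

theorem norm_sq_plane (u : Plane) : ‖u‖ ^ 2 = u 0 ^ 2 + u 1 ^ 2 := by
  rw [← real_inner_self_eq_norm_sq, inner_plane]; ring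

theorem OrthoPair.rotateQuarter {u : Plane} (hu : ‖u‖ = 1) : OrthoPair u (rotateQuarter u) := by
  refine ⟨hu, ?_, ?_⟩
  · have h := norm_sq_plane (_root_.rotateQuarter u)
    have h2 := norm_sq_plane u
    rw [hu] at h2
    simp [_root_.rotateQuarter] at h
    rw [add_comm, ← h2] at h
    exact (pow_eq_one_iff_of_nonneg (norm_nonneg _) two_ne_zero).1 (h.trans (one_pow 2))
  · rw [inner_plane]; simp [_root_.rotateQuarter]; ring

theorem rotationTo_eq (u z : Plane) : rotationTo u z = z 0 • u + z 1 • rotateQuarter u := by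
  ext k
  fin_cases k <;> simp [rotationTo, rotateQuarter] <;> ring

theorem norm_rotateQuarter_sub (u v : Plane) :
    ‖rotateQuarter u - rotateQuarter v‖ = ‖u - v‖ := by
  have h := norm_sq_plane (rotateQuarter u - rotateQuarter v)
  have h2 := norm_sq_plane (u - v)
  simp [rotateQuarter] at h h2
  refine (pow_left_inj₀ (norm_nonneg _) (norm_nonneg _) two_ne_zero).1 ?_
  rw [h2]
  simp only [rotateQuarter]
  rw [h]; ring

theorem OrthoPair.eq_rotateQuarter {e₁ e₂ : Plane} (h : OrthoPair e₁ e₂) :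
    e₂ = _root_.rotateQuarter e₁ ∨ e₂ = -_root_.rotateQuarter e₁ := by
  have hr := OrthoPair.rotateQuarter h.norm_fst
  have h1 := hr.eq_add e₂
  rw [h.inner_eq, zero_smul, zero_add] at h1
  have h2 := hr.norm_sq e₂
  rw [h.inner_eq, h.norm_snd] at h2
  have h3 : inner ℝ (_root_.rotateQuarter e₁) e₂ ^ 2 = 1 := by linarith
  rcases eq_or_eq_neg_of_sq_eq_sq _ (1 : ℝ) (by rw [h3, one_pow]) with h4 | h4
  · left; rw [h4, one_smul] at h1; exact h1
  · right; rw [h4, neg_one_smul] at h1; exact h1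

/-- A singular value decomposition of an invertible linear map of the plane. -/
structure IsSVD (B : Plane →L[ℝ] Plane) (a₁ a₂ : ℝ) (e₁ e₂ h₁ h₂ : Plane) : Prop where
  source : OrthoPair e₁ e₂
  target : OrthoPair h₁ h₂
  apply_fst : B e₁ = a₁ • h₁
  apply_snd : B e₂ = a₂ • h₂
  pos : 0 < a₂
  le : a₂ ≤ a₁

namespace IsSVD

variable {B : Plane →L[ℝ] Plane} {a₁ a₂ : ℝ} {e₁ e₂ h₁ h₂ : Plane}

theorem apply_eq (h : IsSVD B a₁ a₂ e₁ e₂ h₁ h₂) (v : Plane) :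
    B v = (a₁ * inner ℝ e₁ v) • h₁ + (a₂ * inner ℝ e₂ v) • h₂ := by
  conv_lhs => rw [h.source.eq_add v]
  rw [map_add, map_smul, map_smul, h.apply_fst, h.apply_snd, smul_smul, smul_smul, mul_comm,
    mul_comm a₂]

theorem inner_fst (h : IsSVD B a₁ a₂ e₁ e₂ h₁ h₂) (v : Plane) :
    inner ℝ h₁ (B v) = a₁ * inner ℝ e₁ v := by
  rw [h.apply_eq, h.target.inner_smul_add_smul_fst]

theorem inner_snd (h : IsSVD B a₁ a₂ e₁ e₂ h₁ h₂) (v : Plane) :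
    inner ℝ h₂ (B v) = a₂ * inner ℝ e₂ v := by
  rw [h.apply_eq, h.target.inner_smul_add_smul_snd]

theorem pos_fst (h : IsSVD B a₁ a₂ e₁ e₂ h₁ h₂) : 0 < a₁ := h.pos.trans_le h.le

theorem norm_apply_le (h : IsSVD B a₁ a₂ e₁ e₂ h₁ h₂) (v : Plane) : ‖B v‖ ≤ a₁ * ‖v‖ := by
  refine abs_le_of_sq_le_sq' ?_ (mul_nonneg h.pos_fst.le (norm_nonneg _)) |>.2
  rw [h.target.norm_sq, h.inner_fst, h.inner_snd, mul_pow, mul_pow, mul_pow, h.source.norm_sq v]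
  have : a₂ ^ 2 ≤ a₁ ^ 2 := pow_le_pow_left₀ h.pos.le h.le 2
  nlinarith [sq_nonneg (inner ℝ e₂ v)]

theorem le_norm_apply (h : IsSVD B a₁ a₂ e₁ e₂ h₁ h₂) (v : Plane) : a₂ * ‖v‖ ≤ ‖B v‖ := by
  refine abs_le_of_sq_le_sq' ?_ (norm_nonneg _) |>.2
  rw [h.target.norm_sq, h.inner_fst, h.inner_snd, mul_pow, mul_pow, mul_pow, h.source.norm_sq v]
  have : a₂ ^ 2 ≤ a₁ ^ 2 := pow_le_pow_left₀ h.pos.le h.le 2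
  nlinarith [sq_nonneg (inner ℝ e₁ v)]

theorem norm_eq (h : IsSVD B a₁ a₂ e₁ e₂ h₁ h₂) : ‖B‖ = a₁ := by
  refine le_antisymm (B.opNorm_le_bound h.pos_fst.le h.norm_apply_le) ?_
  have := B.le_opNorm e₁
  rwa [h.apply_fst, norm_smul, h.target.norm_fst, h.source.norm_fst, mul_one, mul_one,
    Real.norm_of_nonneg h.pos_fst.le] at this

theorem adjoint_apply_fst (h : IsSVD B a₁ a₂ e₁ e₂ h₁ h₂) :
    ContinuousLinearMap.adjoint B (B e₁) = a₁ ^ 2 • e₁ := by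
  refine ext_inner_right ℝ fun v => ?_
  rw [ContinuousLinearMap.adjoint_inner_left, h.apply_fst, real_inner_smul_left, h.inner_fst,
    real_inner_smul_left]
  ring

theorem neg (h : IsSVD B a₁ a₂ e₁ e₂ h₁ h₂) : IsSVD B a₁ a₂ (-e₁) (-e₂) (-h₁) (-h₂) :=
  ⟨h.source.neg, h.target.neg, by rw [map_neg, h.apply_fst, smul_neg],
    by rw [map_neg, h.apply_snd, smul_neg], h.pos, h.le⟩

/-- Together with multiplicativity of the determinant this gives control of the smaller singular
value: its logarithm is the difference of two subadditive quantities. -/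
theorem abs_det_eq (h : IsSVD B a₁ a₂ e₁ e₂ h₁ h₂) : |B.det| = a₁ * a₂ := by
  let b := (EuclideanSpace.basisFun (Fin 2) ℝ).toBasis
  have hdet : ∀ u v : Plane, b.det ![u, v] = u 0 * v 1 - u 1 * v 0 := by
    intro u v
    rw [Module.Basis.det_apply, Matrix.det_fin_two]
    simp [b, Module.Basis.toMatrix_apply, mul_comm]
  have hortho : ∀ {u v : Plane}, OrthoPair u v → |b.det ![u, v]| = 1 := by
    intro u v huv
    have h1 := norm_sq_plane u
    have h2 := norm_sq_plane v
    have h3 := huv.inner_eq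
    rw [huv.norm_fst] at h1
    rw [huv.norm_snd] at h2
    rw [inner_plane] at h3
    rw [hdet, ← sq_eq_sq₀ (abs_nonneg _) zero_le_one, sq_abs]
    -- Lagrange's identity: `det² + ⟪u, v⟫² = ‖u‖² ‖v‖²`.
    linear_combination (-(v 0 ^ 2 + v 1 ^ 2)) * h1 - h2 - (u 0 * v 0 + u 1 * v 1) * h3
  have h1 := b.det_comp B.toLinearMap ![e₁, e₂]
  have h2 : (B.toLinearMap ∘ ![e₁, e₂]) = ![a₁ • h₁, a₂ • h₂] := by
    funext k
    fin_cases k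
    · exact h.apply_fst
    · exact h.apply_snd
  have h3 : b.det ![a₁ • h₁, a₂ • h₂] = a₁ * a₂ * b.det ![h₁, h₂] := by
    rw [hdet, hdet]
    simp
    ring
  rw [h2, h3] at h1
  have h4 := congrArg abs h1
  rw [abs_mul, abs_mul, abs_mul, hortho h.target, hortho h.source, mul_one, mul_one,
    abs_of_pos h.pos_fst, abs_of_pos h.pos] at h4
  exact h4.symm

end IsSVD

/-- Every injective linear map of the plane has a singular value decomposition. -/
theorem exists_isSVD (B : Plane →L[ℝ] Plane) (hB : Function.Injective B) :
    ∃ e₁ e₂ h₁ h₂, IsSVD B (B.toLinearMap.singularValues 0) (B.toLinearMap.singularValues 1)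
      e₁ e₂ h₁ h₂ := by
  set T := B.toLinearMap with hT
  have hfr : Module.finrank ℝ Plane = 2 := by simp
  have hpos : ∀ k < 2, 0 < T.singularValues k := by
    have := T.injective_iff_forall_lt_finrank_singularValues_pos.1 hB
    rwa [hfr] at this
  let b := T.isSymmetric_adjoint_comp_self.eigenvectorBasis hfr
  have hb : ∀ k : Fin 2, T.adjoint (T (b k)) = T.singularValues k ^ 2 • b k := by
    intro k
    have := T.isSymmetric_adjoint_comp_self.apply_eigenvectorBasis hfr k
    rw [← T.sq_singularValues_fin hfr k] at this
    exact this
  have hin : ∀ j k : Fin 2, inner ℝ (B (b j)) (B (b k)) =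
      T.singularValues k ^ 2 * inner ℝ (b j) (b k) := by
    intro j k
    rw [← real_inner_smul_right, ← hb, LinearMap.adjoint_inner_right]
    rfl
  have hbn : ∀ k, ‖b k‖ = 1 := fun k => b.orthonormal.1 k
  have hnorm : ∀ k : Fin 2, ‖B (b k)‖ = T.singularValues k := by
    intro k
    have := hin k k
    rw [real_inner_self_eq_norm_sq, real_inner_self_eq_norm_sq, hbn, one_pow, mul_one] at this
    exact (pow_left_inj₀ (norm_nonneg _) (T.singularValues_nonneg _) two_ne_zero).1 this
  have hb01 : inner ℝ (b 0) (b 1) = 0 := b.orthonormal.2 (by decide)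
  have p0 := hpos 0 (by norm_num)
  have p1 := hpos 1 (by norm_num)
  have n0 : ‖B (b 0)‖ = T.singularValues 0 := hnorm 0
  have n1 : ‖B (b 1)‖ = T.singularValues 1 := hnorm 1
  refine ⟨b 0, b 1, (T.singularValues 0)⁻¹ • B (b 0), (T.singularValues 1)⁻¹ • B (b 1),
    ⟨hbn 0, hbn 1, hb01⟩, ⟨?_, ?_, ?_⟩, ?_, ?_, p1, ?_⟩
  · rw [norm_smul, n0, norm_inv, Real.norm_of_nonneg p0.le, inv_mul_cancel₀ p0.ne']
  · rw [norm_smul, n1, norm_inv, Real.norm_of_nonneg p1.le, inv_mul_cancel₀ p1.ne']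
  · rw [real_inner_smul_left, real_inner_smul_right, hin, hb01]; ring
  · rw [smul_smul, mul_inv_cancel₀ p0.ne', one_smul]
  · rw [smul_smul, mul_inv_cancel₀ p1.ne', one_smul]
  · exact T.singularValues_antitone zero_le_one

/-! ### Singular values of words. -/

namespace AffineIFS

variable {m : ℕ} (S : AffineIFS m)

theorem exists_isSVD (w : List (Fin m)) :
    ∃ e₁ e₂ h₁ h₂, IsSVD (S.AWord w) (S.α 0 w) (S.α 1 w) e₁ e₂ h₁ h₂ :=
  _root_.exists_isSVD _ (S.AWord_injective w)

theorem isSemiaxis_of_isSVD {w : List (Fin m)} {e₁ e₂ h₁ h₂ : Plane}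
    (h : IsSVD (S.AWord w) (S.α 0 w) (S.α 1 w) e₁ e₂ h₁ h₂) : S.IsSemiaxis 0 w h₁ := by
  refine ⟨e₁, h.source.norm_fst, h.adjoint_apply_fst, ?_⟩
  rw [h.apply_fst, norm_smul, h.target.norm_fst, Real.norm_of_nonneg h.pos_fst.le, mul_one,
    smul_smul, inv_mul_cancel₀ h.pos_fst.ne', one_smul]

theorem α_pos (k : Fin 2) (w : List (Fin m)) : 0 < S.α k w := by
  obtain ⟨_, _, _, _, h⟩ := S.exists_isSVD w
  fin_cases k
  · exact h.pos_fst
  · exact h.pos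

theorem α_one_le (w : List (Fin m)) : S.α 1 w ≤ S.α 0 w := by
  obtain ⟨_, _, _, _, h⟩ := S.exists_isSVD w
  exact h.le

theorem norm_AWord (w : List (Fin m)) : ‖S.AWord w‖ = S.α 0 w := by
  obtain ⟨_, _, _, _, h⟩ := S.exists_isSVD w
  exact h.norm_eq

theorem abs_det_AWord (w : List (Fin m)) : |(S.AWord w).det| = S.α 0 w * S.α 1 w := by
  obtain ⟨_, _, _, _, h⟩ := S.exists_isSVD w
  exact h.abs_det_eq

theorem α_one_mul_norm_le (w : List (Fin m)) (v : Plane) : S.α 1 w * ‖v‖ ≤ ‖S.AWord w v‖ := by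
  obtain ⟨_, _, _, _, h⟩ := S.exists_isSVD w
  exact h.le_norm_apply v

/-- The smaller singular value is the largest lower bound for the dilation. -/
theorem le_α_one {w : List (Fin m)} {c : ℝ} (hc : ∀ v, c * ‖v‖ ≤ ‖S.AWord w v‖) :
    c ≤ S.α 1 w := by
  obtain ⟨_, e₂, _, _, h⟩ := S.exists_isSVD w
  have := hc e₂
  rwa [h.source.norm_snd, h.apply_snd, norm_smul, h.target.norm_snd, mul_one, mul_one,
    Real.norm_of_nonneg h.pos.le] at this

theorem α_one_append_singleton_ge {τ : ℝ} (hτ : ∀ a v, τ * ‖v‖ ≤ ‖S.A a v‖)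
    (w : List (Fin m)) (a : Fin m) : τ * S.α 1 w ≤ S.α 1 (w ++ [a]) := by
  refine S.le_α_one fun v => ?_
  rw [AWord_append, AWord_cons, AWord_nil, mul_one]
  calc τ * S.α 1 w * ‖v‖ = S.α 1 w * (τ * ‖v‖) := by ring
    _ ≤ S.α 1 w * ‖S.A a v‖ := mul_le_mul_of_nonneg_left (hτ a v) (S.α_pos 1 w).le
    _ ≤ _ := S.α_one_mul_norm_le w _

/-- Monotonicity allows a gap created at an early branching level to be measured against the
thickness of a later cylinder. -/
theorem α_one_append_le (w v : List (Fin m)) : S.α 1 (w ++ v) ≤ S.α 1 w := by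
  obtain ⟨r, h0, h1, hr⟩ := S.exists_contraction
  refine S.le_α_one fun x => ?_
  obtain ⟨u, hu⟩ := S.isUnit_AWord v
  have h2 : S.AWord v ((u⁻¹).1 x) = x := by
    rw [← hu]
    change (u.1 * (u⁻¹).1) x = x
    simp
  have h3 := S.α_one_mul_norm_le (w ++ v) ((u⁻¹).1 x)
  rw [AWord_append] at h3
  change _ ≤ ‖S.AWord w (S.AWord v _)‖ at h3
  rw [h2] at h3
  refine le_trans (mul_le_mul_of_nonneg_left ?_ (S.α_pos 1 _).le) h3
  conv_lhs => rw [← h2]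
  refine (ContinuousLinearMap.le_opNorm _ _).trans ?_
  refine mul_le_of_le_one_left (norm_nonneg _) ?_
  exact (S.norm_AWord_le h0.le hr v).trans (pow_le_one₀ h0.le h1.le)

theorem α_one_nil : S.α 1 [] = 1 := by
  refine le_antisymm ?_ (S.le_α_one fun v => by simp)
  have h := S.α_one_mul_norm_le [] (EuclideanSpace.single 0 1)
  simpa using h

theorem α_one_le_pow {r : ℝ} (h0 : 0 ≤ r) (hr : ∀ a, ‖S.A a‖ ≤ r) (w : List (Fin m)) :
    S.α 1 w ≤ r ^ w.length :=
  (S.α_one_le w).trans (by rw [← S.norm_AWord]; exact S.norm_AWord_le h0 hr w)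

end AffineIFS

/-! ### Porosity of slices -/

theorem IsPorous.subset {X : Type*} [PseudoMetricSpace X] {A B : Set X} (hB : IsPorous B)
    (h : A ⊆ B) : IsPorous A := by
  obtain ⟨α, h0, h1, H⟩ := hB
  refine ⟨α, h0, h1, fun x hx r hr hd => ?_⟩
  obtain ⟨y, hy⟩ := H x (h hx) r hr (hd.trans_le (Metric.ediam_mono h))
  exact ⟨y, fun z hz => ⟨(hy hz).1, fun hA => (hy hz).2 (h hA)⟩⟩

/-- If a point of `P` has a small neighbouring part `Q` of `P` that is isolated by a gap, then there
is a hole next to it. -/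
theorem exists_hole {P Q : Set ℝ} {x r g : ℝ} (hQ : IsCompact Q) (hxQ : x ∈ Q)
    (hg : 0 < g) (hgr : g ≤ r / 2) (hdiam : ∀ s ∈ Q, ∀ s' ∈ Q, |s - s'| ≤ r)
    (hgap : ∀ s ∈ P, s ∉ Q → ∀ s' ∈ Q, g ≤ |s - s'|) :
    ∃ y, Metric.closedBall y (g / 4) ⊆ Metric.closedBall x r \ P := by
  obtain ⟨M, hM, hMmax⟩ := hQ.exists_isMaxOn ⟨x, hxQ⟩ continuousOn_id
  obtain ⟨L, hL, hLmin⟩ := hQ.exists_isMinOn ⟨x, hxQ⟩ continuousOn_id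
  have hmax : ∀ s ∈ Q, s ≤ M := fun s hs => hMmax hs
  have hmin : ∀ s ∈ Q, L ≤ s := fun s hs => hLmin hs
  have h1 := hmax x hxQ
  have h2 := hmin x hxQ
  have h3 := (abs_le.1 (hdiam M hM L hL)).2
  -- Since `Q` has length at most `r`, one of its ends lies within `r / 2` of `x`; the hole is
  -- placed in the gap just beyond that end.
  rcases le_total M (x + r / 2) with h | h
  · refine ⟨M + g / 2, fun z hz => ?_⟩
    rw [Metric.mem_closedBall, Real.dist_eq, abs_le] at hz
    refine ⟨?_, fun hzP => ?_⟩
    · rw [Metric.mem_closedBall, Real.dist_eq, abs_le]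
      constructor <;> linarith [hz.1, hz.2]
    · have hzQ : z ∉ Q := fun hzQ => by linarith [hmax z hzQ, hz.1]
      have := hgap z hzP hzQ M hM
      rw [abs_of_nonneg (by linarith [hz.1])] at this
      linarith [hz.2]
  · refine ⟨L - g / 2, fun z hz => ?_⟩
    rw [Metric.mem_closedBall, Real.dist_eq, abs_le] at hz
    refine ⟨?_, fun hzP => ?_⟩
    · rw [Metric.mem_closedBall, Real.dist_eq, abs_le]
      constructor <;> linarith [hz.1, hz.2]
    · have hzQ : z ∉ Q := fun hzQ => by linarith [hmin z hzQ, hz.2]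
      have := hgap z hzP hzQ L hL
      rw [abs_of_nonpos (by linarith [hz.2])] at this
      linarith [hz.1]

namespace AffineIFS.IsSelfAffineSet

variable {m : ℕ} {S : AffineIFS m} {E : Set Plane}

/-- Distinct cylinders that branch off at a common word are separated. -/
theorem exists_branch_separated (hE : S.IsSelfAffineSet E) {δ : ℝ}
    (hδ : ∀ a c : Fin m, a ≠ c → ∀ x ∈ S.f a '' E, ∀ y ∈ S.f c '' E, δ < dist x y)
    (i : ℕ → Fin m) (n : ℕ) {x y : Plane} (hx : x ∈ S.cylinder E (wordPrefix i n))
    (hy : y ∈ E) (hn : y ∉ S.cylinder E (wordPrefix i n)) :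
    ∃ h < n, ∃ z ∈ E, ∃ z' ∈ E, x = S.fWord (wordPrefix i h) z ∧
      y = S.fWord (wordPrefix i h) z' ∧ δ < ‖z - z'‖ := by
  obtain ⟨h, hh, c, hc, z', hz', rfl⟩ := hE.exists_branch i n hy hn
  obtain ⟨q, hq, rfl⟩ := hx
  obtain ⟨k, rfl⟩ : ∃ k, n = h + 1 + k := ⟨n - h - 1, by omega⟩
  have hz : S.f (i h) (S.fWord (wordPrefix (wordShift (h + 1) i) k) q) ∈ S.f (i h) '' E :=
    ⟨_, hE.fWord_mem _ hq, rfl⟩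
  have hsub : ∀ a, S.f a '' E ⊆ E := by
    rintro a _ ⟨p, hp, rfl⟩
    exact hE.f_mem a hp
  refine ⟨h, hh, _, hsub _ hz, z', hsub _ hz', ?_, rfl, ?_⟩
  · rw [wordPrefix_add, wordPrefix_succ', fWord_append, fWord_append]
    rfl
  · rw [← dist_eq_norm]
    exact hδ _ _ hc.symm _ hz _ hz'

/-- Points of `E` outside a cylinder are far from that cylinder, relative to its thickness. -/
theorem lt_dist_of_notMem_cylinder (hE : S.IsSelfAffineSet E) {δ : ℝ} (h0 : 0 < δ)
    (hδ : ∀ a c : Fin m, a ≠ c → ∀ x ∈ S.f a '' E, ∀ y ∈ S.f c '' E, δ < dist x y)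
    (i : ℕ → Fin m) (n : ℕ) {x y : Plane} (hx : x ∈ S.cylinder E (wordPrefix i n))
    (hy : y ∈ E) (hn : y ∉ S.cylinder E (wordPrefix i n)) :
    δ * S.α 1 (wordPrefix i n) < ‖x - y‖ := by
  obtain ⟨h, hh, z, -, z', -, rfl, rfl, hz⟩ := hE.exists_branch_separated hδ i n hx hy hn
  rw [fWord_sub]
  obtain ⟨k, rfl⟩ : ∃ k, n = h + k := ⟨n - h, by omega⟩
  have h1 := S.α_one_append_le (wordPrefix i h) (wordPrefix (wordShift h i) k)
  rw [← wordPrefix_add] at h1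
  have h2 := S.α_pos 1 (wordPrefix i h)
  calc _ ≤ δ * S.α 1 (wordPrefix i h) := mul_le_mul_of_nonneg_left h1 h0.le
    _ < ‖z - z'‖ * S.α 1 (wordPrefix i h) := mul_lt_mul_of_pos_right hz h2
    _ = S.α 1 (wordPrefix i h) * ‖z - z'‖ := mul_comm _ _
    _ ≤ _ := S.α_one_mul_norm_le _ _

/-- Under strong separation the intersections of `E` with lines are porous. -/
theorem isPorous_slice (hE : S.IsSelfAffineSet E) (hsep : S.StrongSeparation E) (p : Plane)
    {v : Plane} (hv : v ≠ 0) : IsPorous {s : ℝ | p + s • v ∈ E} := by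
  obtain ⟨δ, hδ0, hδ⟩ := hsep
  obtain ⟨D, hD, hdiam⟩ := hE.exists_diam
  obtain ⟨ρ, hρ0, hρ1, hρ⟩ := S.exists_contraction
  have hvn : 0 < ‖v‖ := norm_pos_iff.2 hv
  set g := min (δ / D) (1 / 2) with hg
  have hg0 : 0 < g := lt_min (by positivity) (by norm_num)
  refine ⟨g / 4, by positivity, ?_, ?_⟩
  · have : g ≤ 1 / 2 := min_le_right _ _
    linarith
  intro x hx r hr hd
  obtain ⟨j, hj⟩ := hE.exists_proj hx
  set P : List (Fin m) → Set ℝ := fun w => {s | p + s • v ∈ S.cylinder E w} with hP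
  -- The relevant level is the first one at which the slice of the cylinder around `x` has length at
  -- most `r`; one level earlier it still has two points more than `r` apart.
  have hsmall : ∃ n, ∀ s ∈ P (wordPrefix j n), ∀ s' ∈ P (wordPrefix j n), |s - s'| ≤ r := by
    have hlim : Tendsto (fun n : ℕ => ρ ^ n * D) atTop (𝓝 0) := by
      simpa using (tendsto_pow_atTop_nhds_zero_of_lt_one hρ0.le hρ1).mul_const D
    obtain ⟨n, hn⟩ := (hlim.eventually (gt_mem_nhds (mul_pos hr hvn))).exists
    refine ⟨n, ?_⟩
    rintro s ⟨z, hz, hzs⟩ s' ⟨z', hz', hzs'⟩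
    have h1 := S.dist_fWord_le hρ0.le hρ (wordPrefix j n) z z'
    rw [hzs, hzs', length_wordPrefix, add_sub_add_left_eq_sub, ← sub_smul, norm_smul,
      Real.norm_eq_abs] at h1
    have h2 : ρ ^ n * ‖z - z'‖ ≤ ρ ^ n * D :=
      mul_le_mul_of_nonneg_left (hdiam z hz z' hz') (by positivity)
    exact le_of_mul_le_mul_right (h1.trans (h2.trans hn.le)) hvn
  classical
  set n := Nat.find hsmall with hn
  have hnspec := Nat.find_spec hsmall
  -- At level `0` the slice is the whole set, whose diameter exceeds `r`.
  have hn0 : n ≠ 0 := by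
    intro h0
    rw [← hn, h0] at hnspec
    refine hd.not_ge (Metric.ediam_le fun s hs s' hs' => ?_)
    rw [edist_dist, Real.dist_eq]
    refine ENNReal.ofReal_le_ofReal (hnspec s ?_ s' ?_)
    · exact ⟨_, hs, by simp⟩
    · exact ⟨_, hs', by simp⟩
  have hpred := Nat.find_min hsmall (show n - 1 < n by omega)
  push Not at hpred
  obtain ⟨s₁, ⟨z₁, hz₁, hs₁⟩, s₂, ⟨z₂, hz₂, hs₂⟩, h12⟩ := hpred
  have hcont : Continuous fun s : ℝ => p + s • v := by fun_prop
  have hcomp : IsCompact (P (wordPrefix j n)) := by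
    refine Metric.isCompact_of_isClosed_isBounded
      ((hE.isCompact_cylinder _).isClosed.preimage hcont) ?_
    exact Metric.isBounded_iff.2 ⟨r, fun s hs s' hs' => by
      rw [Real.dist_eq]; exact hnspec s hs s' hs'⟩
  have hxP : x ∈ P (wordPrefix j n) := by
    change p + x • v ∈ S.cylinder E _
    rw [← hj]
    exact hE.mem_cylinder_prefix j n
  suffices hgap : ∀ s ∈ {s : ℝ | p + s • v ∈ E}, s ∉ P (wordPrefix j n) →
      ∀ s' ∈ P (wordPrefix j n), g * r ≤ |s - s'| by
    obtain ⟨y, hy⟩ := exists_hole hcomp hxP (by positivity)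
      (by nlinarith [min_le_right (δ / D) (1 / 2)]) hnspec hgap
    exact ⟨y, by rwa [show g / 4 * r = g * r / 4 by ring]⟩
  intro s hs hsn s' hs'
  obtain ⟨h, hh, z, hz, z', hz', e1, e2, hzz⟩ := hE.exists_branch_separated hδ j n hs' hs hsn
  have h1 : S.AWord (wordPrefix j h) (z - z') = (s' - s) • v := by
    rw [← fWord_sub, ← e1, ← e2, add_sub_add_left_eq_sub, sub_smul]
  obtain ⟨k, hk⟩ : ∃ k, n - 1 = h + k := ⟨n - 1 - h, by omega⟩
  rw [hk, wordPrefix_add, fWord_append] at hs₁ hs₂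
  set y₁ := S.fWord (wordPrefix (wordShift h j) k) z₁
  set y₂ := S.fWord (wordPrefix (wordShift h j) k) z₂
  have h2 : S.AWord (wordPrefix j h) (y₁ - y₂) = (s₁ - s₂) • v := by
    rw [← fWord_sub, hs₁, hs₂, add_sub_add_left_eq_sub, sub_smul]
  -- Both differences are sent to multiples of `v` by the same injective linear map, so the ratio of
  -- their lengths is unaffected by the distortion: it is at least `δ / D` before and after.
  have h3 : (s₁ - s₂) • (z - z') = (s' - s) • (y₁ - y₂) := by
    refine S.AWord_injective (wordPrefix j h) ?_
    rw [map_smul, map_smul, h1, h2, smul_smul, smul_smul, mul_comm]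
  have h4 := congrArg norm h3
  rw [norm_smul, norm_smul, Real.norm_eq_abs, Real.norm_eq_abs] at h4
  have h5 : ‖y₁ - y₂‖ ≤ D := hdiam _ (hE.fWord_mem _ hz₁) _ (hE.fWord_mem _ hz₂)
  have h6 : r * δ ≤ |s₁ - s₂| * ‖z - z'‖ := mul_le_mul h12.le hzz.le hδ0.le (abs_nonneg _)
  have h7 : |s' - s| * ‖y₁ - y₂‖ ≤ |s' - s| * D := mul_le_mul_of_nonneg_left h5 (abs_nonneg _)
  have h8 : δ / D * r ≤ |s' - s| := by
    rw [div_mul_eq_mul_div, div_le_iff₀ hD]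
    linarith
  rw [abs_sub_comm]
  exact (mul_le_mul_of_nonneg_right (min_le_left _ _) hr.le).trans h8

end AffineIFS.IsSelfAffineSet

/-! ### The Bernoulli measure -/

/-- The infinite word `a i(0) i(1) ⋯`. -/
def consWord {m : ℕ} (a : Fin m) (i : ℕ → Fin m) : ℕ → Fin m
  | 0 => a
  | n + 1 => i n

theorem wordShift_one_consWord {m : ℕ} (a : Fin m) (i : ℕ → Fin m) :
    wordShift 1 (consWord a i) = i := rfl

theorem wordPrefix_succ_consWord {m : ℕ} (a : Fin m) (i : ℕ → Fin m) (n : ℕ) :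
    wordPrefix (consWord a i) (n + 1) = a :: wordPrefix i n := by
  rw [wordPrefix_succ]; rfl

theorem wordShift_succ_consWord {m : ℕ} (a : Fin m) (i : ℕ → Fin m) (n : ℕ) :
    wordShift (n + 1) (consWord a i) = wordShift n i := rfl

theorem measurable_wordShift {m : ℕ} (n : ℕ) : Measurable (wordShift (m := m) n) :=
  measurable_pi_lambda _ fun k => measurable_pi_apply (k + n)

theorem measurable_comp_wordPrefix {m : ℕ} {β : Type*} [MeasurableSpace β] (F : List (Fin m) → β)
    (n : ℕ) : Measurable fun i : ℕ → Fin m => F (wordPrefix i n) := by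
  have h1 : Measurable fun i : ℕ → Fin m => (fun k : Fin n => i k) := by fun_prop
  exact (measurable_of_finite fun x : Fin n → Fin m => F (List.ofFn x)).comp h1

theorem measurable_consWord_prod {m : ℕ} :
    Measurable fun q : Fin m × (ℕ → Fin m) => consWord q.1 q.2 := by
  refine measurable_pi_lambda _ fun n => ?_
  cases n with
  | zero => exact measurable_fst
  | succ n => exact (measurable_pi_apply n).comp measurable_snd

theorem measurable_consWord {m : ℕ} (a : Fin m) : Measurable (consWord a) :=
  measurable_consWord_prod.comp (by fun_prop : Measurable fun i : ℕ → Fin m => (a, i))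

namespace AffineIFS

variable {m : ℕ} (p : PMF (Fin m))

instance : IsProbabilityMeasure (bernoulli p) := by
  unfold bernoulli; infer_instance

theorem measurePreserving_wordShift (n : ℕ) :
    MeasurePreserving (wordShift n) (bernoulli p) (bernoulli p) :=
  ⟨measurable_wordShift n, Measure.map_infinitePi_infinitePi_of_inj
    (P := fun _ : ℕ => p.toMeasure) (f := fun k => k + n) (add_left_injective n)⟩

/-- The letters are independent and identically distributed, so prepending an independent letter
preserves the law. It suffices to check boxes, where the coordinate `0` splits off. -/
theorem map_consWord_prod :
    (p.toMeasure.prod (bernoulli p)).map (fun q => consWord q.1 q.2) = bernoulli p := by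
  refine Measure.eq_infinitePi _ fun s t ht => ?_
  classical
  -- These are the `n` with `n + 1 ∈ s`; the range only serves to make a finite set.
  let s' : Finset ℕ := (Finset.range (s.sup id)).filter fun n => n + 1 ∈ s
  have hs' : ∀ n, n ∈ s' ↔ n + 1 ∈ s := by
    intro n
    simp only [s', Finset.mem_filter, Finset.mem_range, and_iff_right_iff_imp]
    intro h
    exact Nat.lt_of_succ_le (Finset.le_sup (f := id) h)
  let t0 : Set (Fin m) := if 0 ∈ s then t 0 else univ
  have hset : (fun q : Fin m × (ℕ → Fin m) => consWord q.1 q.2) ⁻¹' (Set.pi s t) =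
      t0 ×ˢ (Set.pi s' fun n => t (n + 1)) := by
    ext ⟨a, i⟩
    simp only [mem_preimage, Set.mem_pi, mem_prod, Finset.mem_coe]
    constructor
    · intro h
      refine ⟨?_, fun n hn => h (n + 1) ((hs' n).1 hn)⟩
      by_cases h0 : 0 ∈ s
      · rw [show t0 = t 0 from if_pos h0]; exact h 0 h0
      · simp [t0, h0]
    · rintro ⟨h0, h1⟩ n hn
      cases n with
      | zero => rw [show t0 = t 0 from if_pos hn] at h0; exact h0
      | succ n => exact h1 n ((hs' n).2 hn)
  rw [Measure.map_apply measurable_consWord_prod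
    (MeasurableSet.pi s.countable_toSet fun n _ => ht n), hset, Measure.prod_prod, bernoulli,
    Measure.infinitePi_pi _ fun n _ => ht (n + 1)]
  have h2 : ∏ n ∈ s', p.toMeasure (t (n + 1)) = ∏ n ∈ s.erase 0, p.toMeasure (t n) := by
    refine Finset.prod_bij (fun n _ => n + 1) ?_ ?_ ?_ ?_
    · intro n hn; simpa using (hs' n).1 hn
    · intro a _ b _ h; omega
    · intro b hb
      rw [Finset.mem_erase] at hb
      exact ⟨b - 1, (hs' _).2 (by rw [Nat.sub_add_cancel (by omega)]; exact hb.2), by omega⟩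
    · intro n hn; rfl
  rw [h2]
  by_cases h0 : 0 ∈ s
  · rw [← Finset.mul_prod_erase s _ h0]; simp [t0, h0]
  · simp [t0, h0]

/-- Conditioning on the first letter. -/
theorem bernoulli_real_eq_sum {A : Set (ℕ → Fin m)} (hA : MeasurableSet A) :
    (bernoulli p).real A = ∑ a, (p a).toReal * (bernoulli p).real (consWord a ⁻¹' A) := by
  have h1 : bernoulli p A = ∑ a, p a * bernoulli p (consWord a ⁻¹' A) := by
    conv_lhs => rw [← map_consWord_prod p]
    rw [Measure.map_apply measurable_consWord_prod hA,
      Measure.prod_apply (measurable_consWord_prod hA), lintegral_fintype]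
    refine Finset.sum_congr rfl fun a _ => ?_
    rw [PMF.toMeasure_apply_singleton _ _ (measurableSet_singleton a), mul_comm]
    rfl
  rw [measureReal_def, h1, ENNReal.toReal_sum]
  · simp [ENNReal.toReal_mul, measureReal_def]
  · intro a _
    exact ENNReal.mul_ne_top (p.apply_ne_top a) (measure_ne_top _ _)

theorem sum_toReal : ∑ a, (p a).toReal = 1 := by
  rw [← ENNReal.toReal_sum fun a _ => p.apply_ne_top a, ← tsum_fintype (L := .unconditional _),
    p.tsum_coe]
  rfl

/-- The tail of a word is independent of its prefix. -/
theorem bernoulli_real_prefix_le {b : ℝ} (n : ℕ) (B : List (Fin m) → Set (ℕ → Fin m))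
    (hB : ∀ w, MeasurableSet (B w)) (h : ∀ w, (bernoulli p).real (B w) ≤ b) :
    MeasurableSet {i | wordShift n i ∈ B (wordPrefix i n)} ∧
      (bernoulli p).real {i | wordShift n i ∈ B (wordPrefix i n)} ≤ b := by
  induction n generalizing B with
  | zero => simpa using ⟨hB [], h []⟩
  | succ n ih =>
    have hm : MeasurableSet {i : ℕ → Fin m | wordShift (n + 1) i ∈ B (wordPrefix i (n + 1))} := by
      have : {i : ℕ → Fin m | wordShift (n + 1) i ∈ B (wordPrefix i (n + 1))} =
          ⋃ a, {i | i 0 = a} ∩ wordShift 1 ⁻¹'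
            {i | wordShift n i ∈ B (a :: wordPrefix i n)} := by
        ext i
        simp only [wordPrefix_succ, mem_ofPred_eq, mem_iUnion, mem_inter_iff, mem_preimage,
          exists_eq_left', wordShift_wordShift]
      rw [this]
      refine MeasurableSet.iUnion fun a => MeasurableSet.inter ?_ ?_
      · exact measurableSet_eq_fun (measurable_pi_apply 0) measurable_const
      · exact measurable_wordShift 1 (ih (fun w => B (a :: w)) (fun w => hB _) fun w => h _).1
    refine ⟨hm, ?_⟩
    rw [bernoulli_real_eq_sum p hm]
    calc _ ≤ ∑ a, (p a).toReal * b := by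
          refine Finset.sum_le_sum fun a _ => mul_le_mul_of_nonneg_left ?_ ENNReal.toReal_nonneg
          have := (ih (fun w => B (a :: w)) (fun w => hB _) fun w => h _).2
          simpa only [preimage_ofPred_eq, wordPrefix_succ_consWord, wordShift_succ_consWord]
            using this
      _ = b := by rw [← Finset.sum_mul, sum_toReal, one_mul]

/-- The word `w` followed by the infinite word `i`. -/
def appendWord : List (Fin m) → (ℕ → Fin m) → ℕ → Fin m
  | [], i => i
  | a :: w, i => consWord a (appendWord w i)

theorem proj_appendWord (S : AffineIFS m) (w : List (Fin m)) (i : ℕ → Fin m) :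
    S.proj (appendWord w i) = S.fWord w (S.proj i) := by
  induction w with
  | nil => rfl
  | cons a w ih => rw [appendWord, proj_eq_f, wordShift_one_consWord, ih]; rfl

/-- The measure is an average of the conditional measures over the words of length `k`. -/
theorem bernoulli_real_le_of_append {b : ℝ} (k : ℕ) {A : Set (ℕ → Fin m)} (hA : MeasurableSet A)
    (h : ∀ w : List (Fin m), w.length = k → (bernoulli p).real (appendWord w ⁻¹' A) ≤ b) :
    (bernoulli p).real A ≤ b := by
  induction k generalizing A with
  | zero => exact h [] rfl
  | succ k ih =>
    rw [bernoulli_real_eq_sum p hA]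
    calc _ ≤ ∑ a, (p a).toReal * b := by
          refine Finset.sum_le_sum fun a _ => mul_le_mul_of_nonneg_left ?_ ENNReal.toReal_nonneg
          exact ih (measurable_consWord a hA) fun w hw => h (a :: w) (by simp [hw])
      _ = b := by rw [← Finset.sum_mul, sum_toReal, one_mul]

/-- A set that misses a cylinder loses a definite proportion of the measure. -/
theorem bernoulli_real_le_of_append_empty {b q : ℝ} (hb : 0 ≤ b) (hq0 : 0 ≤ q)
    (hq : ∀ a, q ≤ (p a).toReal) (w₀ : List (Fin m)) {A : Set (ℕ → Fin m)}
    (hA : MeasurableSet A) (h₀ : appendWord w₀ ⁻¹' A = ∅)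
    (h : ∀ w : List (Fin m), w.length = w₀.length →
      (bernoulli p).real (appendWord w ⁻¹' A) ≤ b) :
    (bernoulli p).real A ≤ (1 - q ^ w₀.length) * b := by
  induction w₀ generalizing A with
  | nil =>
    have : A = ∅ := h₀
    simp [this]
  | cons a w₀ ih =>
    rw [bernoulli_real_eq_sum p hA]
    -- Only the branch that starts like the missed cylinder gains anything, by the induction
    -- hypothesis.
    have h1 : ∀ c, (bernoulli p).real (consWord c ⁻¹' A) ≤
        b - if c = a then q ^ w₀.length * b else 0 := by
      intro c
      split_ifs with hc
      · subst hc
        have := ih (measurable_consWord c hA) h₀ fun w hw => h (c :: w) (by simp [hw])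
        linarith
      · rw [sub_zero]
        exact bernoulli_real_le_of_append p w₀.length (measurable_consWord c hA)
          fun w hw => h (c :: w) (by simp [hw])
    calc _ ≤ ∑ c, (p c).toReal * (b - if c = a then q ^ w₀.length * b else 0) :=
          Finset.sum_le_sum fun c _ => mul_le_mul_of_nonneg_left (h1 c) ENNReal.toReal_nonneg
      _ = b - (p a).toReal * (q ^ w₀.length * b) := by
          simp [mul_sub, Finset.sum_sub_distrib, ← Finset.sum_mul, sum_toReal]
      _ ≤ b - q * (q ^ w₀.length * b) := by
          have := mul_le_mul_of_nonneg_right (hq a) (by positivity : 0 ≤ q ^ w₀.length * b)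
          linarith
      _ = _ := by rw [List.length_cons, pow_succ]; ring

end AffineIFS

/-! ### The subadditive ergodic theorem for word functions under the Bernoulli measure -/

namespace AffineIFS

/-- A non-positive subadditive function on words, with bounded change under adding a letter in
front. -/
structure SubadditiveWord {m : ℕ} (g : List (Fin m) → ℝ) (K : ℝ) : Prop where
  nil : g [] = 0
  append : ∀ w v, g (w ++ v) ≤ g w + g v
  nonpos : ∀ w, g w ≤ 0
  le_cons : ∀ a w, g w - K ≤ g (a :: w)

namespace SubadditiveWord

variable {m : ℕ} {g : List (Fin m) → ℝ} {K : ℝ} (p : PMF (Fin m))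

theorem bound (h : SubadditiveWord g K) (w : List (Fin m)) : -(K * w.length) ≤ g w := by
  induction w with
  | nil => simp [h.nil]
  | cons a w ih =>
    have := h.le_cons a w
    push_cast [List.length_cons]
    linarith

theorem cons_le (h : SubadditiveWord g K) (a : Fin m) (w : List (Fin m)) : g (a :: w) ≤ g w := by
  have := h.append [a] w
  have h2 := h.nonpos [a]
  simp only [List.singleton_append] at this
  linarith

/-- The averages of `g` along the prefixes of an infinite word. -/
noncomputable def avg (g : List (Fin m) → ℝ) (n : ℕ) (i : ℕ → Fin m) : ℝ :=
  g (wordPrefix i n) / n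

/-- The lower limit of the averages. -/
noncomputable def lower (g : List (Fin m) → ℝ) (i : ℕ → Fin m) : ℝ :=
  liminf (fun n => avg g n i) atTop

theorem measurable_avg (n : ℕ) : Measurable (avg g n) :=
  (measurable_comp_wordPrefix g n).div_const _

theorem K_nonneg [Nonempty (Fin m)] (h : SubadditiveWord g K) : 0 ≤ K := by
  obtain ⟨a⟩ := ‹Nonempty (Fin m)›
  have h1 := h.le_cons a []
  have h2 := h.nonpos [a]
  rw [h.nil] at h1
  linarith

theorem avg_le (h : SubadditiveWord g K) (n : ℕ) (i : ℕ → Fin m) : avg g n i ≤ 0 :=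
  div_nonpos_of_nonpos_of_nonneg (h.nonpos _) (Nat.cast_nonneg n)

theorem le_avg (h : SubadditiveWord g K) (n : ℕ) (i : ℕ → Fin m) : -K ≤ avg g n i := by
  have : Nonempty (Fin m) := ⟨i 0⟩
  have hK := h.K_nonneg
  rcases Nat.eq_zero_or_pos n with rfl | hn
  · simp [avg, hK]
  · have hn' : (0 : ℝ) < n := Nat.cast_pos.2 hn
    rw [avg, le_div_iff₀ hn']
    have := h.bound (wordPrefix i n)
    rw [length_wordPrefix] at this
    linarith

theorem isBoundedUnder_ge (h : SubadditiveWord g K) (i : ℕ → Fin m) :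
    IsBoundedUnder (· ≥ ·) atTop fun n => avg g n i :=
  isBoundedUnder_of ⟨-K, fun n => h.le_avg n i⟩

theorem isBoundedUnder_le (h : SubadditiveWord g K) (i : ℕ → Fin m) :
    IsBoundedUnder (· ≤ ·) atTop fun n => avg g n i :=
  isBoundedUnder_of ⟨0, fun n => h.avg_le n i⟩

theorem measurable_lower : Measurable (lower g) :=
  Measurable.liminf fun n => measurable_avg n

theorem lower_le (h : SubadditiveWord g K) (i : ℕ → Fin m) : lower g i ≤ 0 :=
  liminf_le_of_frequently_le (Frequently.of_forall fun n => h.avg_le n i) (h.isBoundedUnder_ge i)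

theorem le_lower (h : SubadditiveWord g K) (i : ℕ → Fin m) : -K ≤ lower g i :=
  le_liminf_of_le (h.isBoundedUnder_le i).isCoboundedUnder_ge
    (Eventually.of_forall fun n => h.le_avg n i)

/-- Deleting the first letter changes `g` by at most `K`, hence the averages by `O(1/n)`. Shift
invariance makes the same target value usable after each deleted block in `le_cover`. -/
theorem lower_wordShift_one (h : SubadditiveWord g K) (i : ℕ → Fin m) :
    lower g (wordShift 1 i) = lower g i := by
  have : Nonempty (Fin m) := ⟨i 0⟩
  have hK := h.K_nonneg
  have h1 : Tendsto (fun n => avg g (n + 1) i - avg g n (wordShift 1 i)) atTop (𝓝 0) := by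
    have hlim : Tendsto (fun n : ℕ => K * (1 / ((n : ℝ) + 1))) atTop (𝓝 (K * 0)) :=
      tendsto_one_div_add_atTop_nhds_zero_nat.const_mul K
    refine squeeze_zero_norm (fun n => ?_) (by simpa only [mul_zero, add_zero] using hlim.add hlim)
    rw [Real.norm_eq_abs, abs_le]
    have hn : (0 : ℝ) < (n : ℝ) + 1 := by positivity
    have e1 := h.cons_le (i 0) (wordPrefix (wordShift 1 i) n)
    have e2 := h.le_cons (i 0) (wordPrefix (wordShift 1 i) n)
    have e3 : avg g (n + 1) i = g (i 0 :: wordPrefix (wordShift 1 i) n) * (1 / ((n : ℝ) + 1)) := by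
      rw [avg, wordPrefix_succ]; push_cast; ring
    set G := g (wordPrefix (wordShift 1 i) n) with hG
    have e4 : avg g n (wordShift 1 i) - G * (1 / ((n : ℝ) + 1)) =
        avg g n (wordShift 1 i) * (1 / ((n : ℝ) + 1)) := by
      rcases Nat.eq_zero_or_pos n with rfl | hpos
      · simp [avg, hG, h.nil]
      · have : (n : ℝ) ≠ 0 := Nat.cast_ne_zero.2 hpos.ne'
        rw [avg, ← hG]; field_simp; ring
    have e5 := h.avg_le n (wordShift 1 i)
    have e6 := h.le_avg n (wordShift 1 i)
    have e7 : (0 : ℝ) < 1 / ((n : ℝ) + 1) := by positivity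
    rw [e3]
    have m1 := mul_le_mul_of_nonneg_right e1 e7.le
    have m2 := mul_le_mul_of_nonneg_right e2 e7.le
    have m3 := mul_le_mul_of_nonneg_right e5 e7.le
    have m4 := mul_le_mul_of_nonneg_right e6 e7.le
    constructor <;> linarith
  have h2 : lower g i = liminf (fun n => avg g (n + 1) i) atTop :=
    (liminf_nat_add (fun n => avg g n i) 1).symm
  rw [h2]
  have h3 : ∀ u v : ℕ → ℝ, Tendsto (fun n => u n - v n) atTop (𝓝 0) →
      (∀ n, u n ∈ Icc (-K) 0) → (∀ n, v n ∈ Icc (-K) 0) →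
      liminf u atTop ≤ liminf v atTop := by
    intro u v huv hu hv
    refine le_of_forall_pos_le_add fun ε hε => ?_
    have bu : IsBoundedUnder (· ≥ ·) atTop u := isBoundedUnder_of ⟨-K, fun n => (hu n).1⟩
    have bv : IsBoundedUnder (· ≤ ·) atTop v := isBoundedUnder_of ⟨0, fun n => (hv n).2⟩
    rw [← sub_le_iff_le_add]
    refine le_liminf_of_le bv.isCoboundedUnder_ge ?_
    have e1 := eventually_lt_of_lt_liminf (show liminf u atTop - ε / 2 < liminf u atTop by linarith)
      bu
    filter_upwards [e1, huv.eventually (gt_mem_nhds (half_pos hε))] with n h1 h2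
    linarith
  refine le_antisymm (h3 _ _ ?_ ?_ ?_) (h3 _ _ h1 ?_ ?_)
  · simpa using h1.neg
  all_goals exact fun n => ⟨h.le_avg _ _, h.avg_le _ _⟩

theorem lower_wordShift (h : SubadditiveWord g K) (n : ℕ) (i : ℕ → Fin m) :
    lower g (wordShift n i) = lower g i := by
  induction n with
  | zero => rfl
  | succ n ih => rw [← ih, ← h.lower_wordShift_one (wordShift n i), wordShift_wordShift, add_comm]

/-- The expected value of `g` on the prefix of length `n`. -/
noncomputable def mean (p : PMF (Fin m)) (g : List (Fin m) → ℝ) (n : ℕ) : ℝ :=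
  ∫ i, g (wordPrefix i n) ∂bernoulli p

theorem integrable_prefix (h : SubadditiveWord g K) (n : ℕ) :
    Integrable (fun i => g (wordPrefix i n)) (bernoulli p) := by
  refine Integrable.of_bound (measurable_comp_wordPrefix g n).aestronglyMeasurable (K * n)
    (Eventually.of_forall fun i => ?_)
  rw [Real.norm_eq_abs, abs_le]
  have h1 := h.bound (wordPrefix i n)
  rw [length_wordPrefix] at h1
  exact ⟨h1, by linarith [h.nonpos (wordPrefix i n)]⟩

theorem integral_comp_wordShift (n : ℕ) {f : (ℕ → Fin m) → ℝ} (hf : Measurable f) :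
    ∫ i, f (wordShift n i) ∂bernoulli p = ∫ i, f i ∂bernoulli p := by
  conv_rhs => rw [← (measurePreserving_wordShift p n).map_eq]
  rw [integral_map (measurable_wordShift n).aemeasurable hf.aestronglyMeasurable]

/-- Stationarity turns subadditivity on words into subadditivity of the means, so Fekete's lemma
provides their limit. -/
theorem subadditive_mean (h : SubadditiveWord g K) : Subadditive (mean p g) := by
  intro n k
  have h1 : ∫ i, g (wordPrefix (wordShift n i) k) ∂bernoulli p = mean p g k :=
    integral_comp_wordShift p n (measurable_comp_wordPrefix g k)
  have h2 : Integrable (fun i => g (wordPrefix (wordShift n i) k)) (bernoulli p) :=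
    (measurePreserving_wordShift p n).integrable_comp_of_integrable (h.integrable_prefix p k)
  rw [← h1]
  conv_rhs => rw [mean]
  rw [← integral_add (h.integrable_prefix p n) h2]
  refine integral_mono (h.integrable_prefix p _) ((h.integrable_prefix p n).add h2) fun i => ?_
  simp only [wordPrefix_add]
  exact h.append _ _

theorem bddBelow_mean (h : SubadditiveWord g K) : BddBelow (range fun n => mean p g n / n) := by
  refine ⟨-K, ?_⟩
  rintro _ ⟨n, rfl⟩
  have h1 : mean p g n / n = ∫ i, avg g n i ∂bernoulli p := by
    rw [mean, ← integral_div]; rfl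
  simp only [h1]
  have h2 : Integrable (avg g n) (bernoulli p) := (h.integrable_prefix p n).div_const _
  calc -K = ∫ _, -K ∂bernoulli p := by simp
    _ ≤ _ := integral_mono (integrable_const _) h2 fun i => h.le_avg n i

/-- The times at which the averages of the first `M` prefixes all exceed the lower limit. -/
def bad (g : List (Fin m) → ℝ) (ε : ℝ) (M : ℕ) : Set (ℕ → Fin m) :=
  {i | ∀ n ∈ Finset.Icc 1 M, n * (lower g i + ε) < g (wordPrefix i n)}

theorem measurableSet_bad (ε : ℝ) (M : ℕ) : MeasurableSet (bad g ε M) := by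
  have : bad g ε M = ⋂ n ∈ Finset.Icc 1 M, {i | n * (lower g i + ε) < g (wordPrefix i n)} := by
    ext i; simp [bad]
  rw [this]
  refine Finset.measurableSet_biInter _ fun n _ => measurableSet_lt ?_ ?_
  · exact (measurable_lower.add_const ε).const_mul _
  · exact measurable_comp_wordPrefix g n

/-- Every word has some prefix with average below its lower limit plus `ε`, so the bad sets decrease
to the empty set as `M` grows. -/
theorem tendsto_bad (h : SubadditiveWord g K) {ε : ℝ} (hε : 0 < ε) :
    Tendsto (fun M => (bernoulli p).real (bad g ε M)) atTop (𝓝 0) := by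
  have h1 : ⋂ M, bad g ε M = ∅ := by
    ext i
    simp only [mem_iInter, mem_empty_iff_false, iff_false, not_forall]
    have h2 : ∃ᶠ n in atTop, avg g n i < lower g i + ε :=
      frequently_lt_of_liminf_lt (h.isBoundedUnder_le i).isCoboundedUnder_ge
        (by change lower g i < _; linarith)
    obtain ⟨n, hn, hn1⟩ := (h2.and_eventually (eventually_ge_atTop 1)).exists
    refine ⟨n, fun hi => ?_⟩
    have h3 := hi n (by simp [hn1])
    have hpos : (0 : ℝ) < n := Nat.cast_pos.2 hn1
    rw [avg, div_lt_iff₀ hpos] at hn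
    linarith
  have h2 : Tendsto (fun M => bernoulli p (bad g ε M)) atTop (𝓝 (bernoulli p (⋂ M, bad g ε M))) := by
    refine tendsto_measure_iInter_atTop (fun M => (measurableSet_bad ε M).nullMeasurableSet) ?_
      ⟨0, measure_ne_top _ _⟩
    intro M M' hM i hi n hn
    refine hi n ?_
    rw [Finset.mem_Icc] at hn ⊢
    exact ⟨hn.1, hn.2.trans hM⟩
  rw [h1, measure_empty] at h2
  exact (ENNReal.tendsto_toReal ENNReal.zero_ne_top).comp h2

/-- The number of bad times among the first `n`. -/
noncomputable def badCount (g : List (Fin m) → ℝ) (ε : ℝ) (M n : ℕ) (i : ℕ → Fin m) : ℝ :=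
  ∑ k ∈ Finset.range n, (bad g ε M).indicator (fun _ => (1 : ℝ)) (wordShift k i)

theorem badCount_nonneg (ε : ℝ) (M n : ℕ) (i : ℕ → Fin m) : 0 ≤ badCount g ε M n i :=
  Finset.sum_nonneg fun _ _ => indicator_nonneg (fun _ _ => zero_le_one) _

theorem badCount_add (ε : ℝ) (M n k : ℕ) (i : ℕ → Fin m) :
    badCount g ε M (n + k) i = badCount g ε M n i + badCount g ε M k (wordShift n i) := by
  rw [badCount, Finset.sum_range_add]
  simp only [badCount, wordShift_wordShift, add_comm]

theorem integral_badCount (ε : ℝ) (M n : ℕ) :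
    Integrable (badCount g ε M n) (bernoulli p) ∧
    ∫ i, badCount g ε M n i ∂bernoulli p = n * (bernoulli p).real (bad g ε M) := by
  have hm := measurableSet_bad (g := g) ε M
  have hmeas : Measurable ((bad g ε M).indicator fun _ => (1 : ℝ)) :=
    measurable_const.indicator hm
  have hint : Integrable ((bad g ε M).indicator fun _ => (1 : ℝ)) (bernoulli p) :=
    (integrable_const _).indicator hm
  have hint' : ∀ k, Integrable
      (fun i => (bad g ε M).indicator (fun _ => (1 : ℝ)) (wordShift k i)) (bernoulli p) :=
    fun k => (measurePreserving_wordShift p k).integrable_comp_of_integrable hint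
  refine ⟨integrable_finsetSum _ fun k _ => hint' k, ?_⟩
  unfold badCount
  rw [integral_finsetSum _ fun k _ => hint' k]
  simp [integral_comp_wordShift p _ hmeas, integral_indicator hm]

/-- The covering estimate behind the subadditive ergodic theorem. -/
theorem le_cover (h : SubadditiveWord g K) {ε : ℝ} (h0 : 0 ≤ ε) {M : ℕ}
    (n : ℕ) (i : ℕ → Fin m) :
    g (wordPrefix i n) ≤ n * (lower g i + ε) + (K + 1) * (badCount g ε M n i + M) := by
  have : Nonempty (Fin m) := ⟨i 0⟩
  have hK := h.K_nonneg
  induction n using Nat.strong_induction_on generalizing i with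
  | _ n ih =>
  have l1 := h.lower_le i
  have l2 := h.le_lower i
  have hcnt := badCount_nonneg (g := g) ε M n i
  rcases Nat.eq_zero_or_pos n with rfl | hn
  · have : 0 ≤ (K + 1) * (badCount g ε M 0 i + M) := by positivity
    simpa [h.nil] using this
  -- At a bad time one letter is dropped and its cost is charged to the count. At a good time a
  -- block of length at most `M` with small average is dropped at no cost.
  by_cases hi : i ∈ bad g ε M
  · obtain ⟨k, rfl⟩ : ∃ k, n = 1 + k := ⟨n - 1, by omega⟩
    have e1 := ih k (by omega) (wordShift 1 i)
    rw [h.lower_wordShift] at e1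
    have e2 : badCount g ε M 1 i = 1 := by simp [badCount, hi]
    rw [badCount_add, e2, wordPrefix_add]
    have e3 := h.append (wordPrefix i 1) (wordPrefix (wordShift 1 i) k)
    have e4 := h.nonpos (wordPrefix i 1)
    push_cast
    nlinarith
  · simp only [bad, mem_ofPred_eq, not_forall, not_lt] at hi
    obtain ⟨l, hl, hgl⟩ := hi
    rw [Finset.mem_Icc] at hl
    rcases le_or_gt l n with hln | hln
    · obtain ⟨k, rfl⟩ : ∃ k, n = l + k := ⟨n - l, by omega⟩
      have e1 := ih k (by omega) (wordShift l i)
      rw [h.lower_wordShift] at e1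
      have e2 := badCount_nonneg (g := g) ε M l i
      rw [badCount_add, wordPrefix_add]
      have e3 := h.append (wordPrefix i l) (wordPrefix (wordShift l i) k)
      push_cast
      nlinarith
    -- The good block overshoots the end: fewer than `M` letters remain, paid for by the term `(K +
    -- 1) * M`.
    · have e1 := h.nonpos (wordPrefix i n)
      have e2 : (n : ℝ) ≤ M := Nat.cast_le.2 (by omega)
      have e3 : -(n * (K + 1)) ≤ n * (lower g i + ε) := by
        have : (0 : ℝ) ≤ n := Nat.cast_nonneg n
        nlinarith
      nlinarith

theorem integrable_lower (h : SubadditiveWord g K) : Integrable (lower g) (bernoulli p) := by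
  refine Integrable.of_bound measurable_lower.aestronglyMeasurable K
    (Eventually.of_forall fun i => ?_)
  have : Nonempty (Fin m) := ⟨i 0⟩
  rw [Real.norm_eq_abs, abs_le]
  exact ⟨h.le_lower i, (h.lower_le i).trans h.K_nonneg⟩

/-- The covering estimate is integrated and divided by `n`; then `n → ∞`, `M → ∞` and `ε → 0`, in
this order. -/
theorem lim_le_integral_lower (h : SubadditiveWord g K) :
    (h.subadditive_mean p).lim ≤ ∫ i, lower g i ∂bernoulli p := by
  have key : ∀ ε : ℝ, 0 < ε → ε ≤ 1 → ∀ M : ℕ, (h.subadditive_mean p).lim ≤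
      (∫ i, lower g i ∂bernoulli p) + ε + (K + 1) * (bernoulli p).real (bad g ε M) := by
    intro ε h0 h1 M
    have hlim : Tendsto (fun n : ℕ => (∫ i, lower g i ∂bernoulli p) + ε +
        (K + 1) * (bernoulli p).real (bad g ε M) + (K + 1) * M / n) atTop
        (𝓝 ((∫ i, lower g i ∂bernoulli p) + ε +
        (K + 1) * (bernoulli p).real (bad g ε M) + 0)) :=
      tendsto_const_nhds.add (tendsto_const_div_atTop_nhds_zero_nat _)
    rw [add_zero] at hlim
    refine le_of_tendsto_of_tendsto ((h.subadditive_mean p).tendsto_lim (h.bddBelow_mean p)) hlim ?_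
    filter_upwards [eventually_gt_atTop 0] with n hn
    have hn' : (0 : ℝ) < n := Nat.cast_pos.2 hn
    obtain ⟨hb1, hb2⟩ := integral_badCount (g := g) p ε M n
    have hl := h.integrable_lower p
    have hA : Integrable (fun i => n * (lower g i + ε)) (bernoulli p) :=
      (hl.add (integrable_const ε)).const_mul _
    have hB : Integrable (fun i => (K + 1) * (badCount g ε M n i + M)) (bernoulli p) :=
      (hb1.add (integrable_const _)).const_mul _
    have e1 : mean p g n ≤
        ∫ i, (n * (lower g i + ε) + (K + 1) * (badCount g ε M n i + M)) ∂bernoulli p :=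
      integral_mono (h.integrable_prefix p n) (hA.add hB) fun i => h.le_cover h0.le n i
    rw [integral_add hA hB, integral_const_mul, integral_const_mul,
      integral_add hl (integrable_const _), integral_add hb1 (integrable_const _), hb2] at e1
    simp only [integral_const, probReal_univ, one_smul] at e1
    rw [div_le_iff₀ hn']
    refine e1.trans (le_of_eq ?_)
    field_simp
    ring
  refine le_of_forall_pos_le_add fun ε hε => ?_
  have h1 := (h.tendsto_bad p (lt_min hε one_pos)).const_mul (K + 1)
  have h2 := ge_of_tendsto' (h1.const_add ((∫ i, lower g i ∂bernoulli p) + min ε 1))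
    fun M => key (min ε 1) (lt_min hε one_pos) (min_le_right _ _) M
  rw [mul_zero, add_zero] at h2
  exact h2.trans (by linarith [min_le_left ε 1])

/-- Blocks of letters at disjoint positions are independent. -/
theorem indepFun_blocks (F : List (Fin m) → ℝ) (L : ℕ) {j k : ℕ} (hjk : j ≠ k) :
    ProbabilityTheory.IndepFun (fun i => F (wordPrefix (wordShift (j * L) i) L))
      (fun i => F (wordPrefix (wordShift (k * L) i) L)) (bernoulli p) := by
  have hind : ProbabilityTheory.iIndepFun (fun (n : ℕ) (i : ℕ → Fin m) => i n) (bernoulli p) :=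
    ProbabilityTheory.iIndepFun_infinitePi (P := fun _ : ℕ => p.toMeasure)
      (X := fun _ x => x) fun _ => measurable_id
  have hdisj : Disjoint (Finset.Ico (j * L) (j * L + L)) (Finset.Ico (k * L) (k * L + L)) := by
    rw [Finset.disjoint_left]
    intro x hx hx'
    rw [Finset.mem_Ico] at hx hx'
    rcases lt_or_gt_of_ne hjk with h | h
    · have : (j + 1) * L ≤ k * L := Nat.mul_le_mul_right L h
      rw [add_mul, one_mul] at this
      omega
    · have : (k + 1) * L ≤ j * L := Nat.mul_le_mul_right L h
      rw [add_mul, one_mul] at this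
      omega
  have h1 := hind.indepFun_finset _ _ hdisj fun n => measurable_pi_apply n
  let φ : ∀ s : ℕ, (Finset.Ico (s * L) (s * L + L) → Fin m) → ℝ := fun s x =>
    F (List.ofFn fun q : Fin L => x ⟨q + s * L, by rw [Finset.mem_Ico]; omega⟩)
  exact h1.comp (φ := φ j) (ψ := φ k) (measurable_of_finite _) (measurable_of_finite _)

/-- Cutting a prefix into blocks of length `L` bounds `g` by a sum of independent identically
distributed terms, to which the strong law applies. The incomplete last block contributes a
non-positive amount. -/
theorem eventually_avg_le (h : SubadditiveWord g K) {L : ℕ} (hL : L ≠ 0) :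
    ∀ᵐ i ∂bernoulli p, ∀ ε : ℝ, 0 < ε → ∀ᶠ n in atTop, avg g n i ≤ mean p g L / L + ε := by
  let X : ℕ → (ℕ → Fin m) → ℝ := fun j i => g (wordPrefix (wordShift (j * L) i) L)
  have hX0 : X 0 = fun i => g (wordPrefix i L) := by simp [X]
  have hident : ∀ j, ProbabilityTheory.IdentDistrib (X j) (X 0) (bernoulli p) (bernoulli p) := by
    intro j
    have hm := measurable_comp_wordPrefix g L
    refine ⟨(hm.comp (measurable_wordShift _)).aemeasurable,
      (hm.comp (measurable_wordShift _)).aemeasurable, ?_⟩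
    change Measure.map ((fun i => g (wordPrefix i L)) ∘ wordShift (j * L)) _ =
      Measure.map ((fun i => g (wordPrefix i L)) ∘ wordShift (0 * L)) _
    rw [← Measure.map_map hm (measurable_wordShift _), ← Measure.map_map hm (measurable_wordShift _),
      (measurePreserving_wordShift p _).map_eq, (measurePreserving_wordShift p _).map_eq]
  have hlaw := ProbabilityTheory.strong_law_ae_real X (by rw [hX0]; exact h.integrable_prefix p L)
    (fun j k hjk => indepFun_blocks p g L hjk) hident
  have hmean : ∫ i, X 0 i ∂bernoulli p = mean p g L := by rw [hX0]; rfl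
  rw [hmean] at hlaw
  filter_upwards [hlaw] with i hi ε hε
  have hLpos : (0 : ℝ) < L := Nat.cast_pos.2 (Nat.pos_of_ne_zero hL)
  have hblock : ∀ k, g (wordPrefix i (k * L)) ≤ ∑ j ∈ Finset.range k, X j i := by
    intro k
    induction k with
    | zero => simp [h.nil]
    | succ k ih =>
      rw [Finset.sum_range_succ, add_mul, one_mul, wordPrefix_add]
      exact (h.append _ _).trans (add_le_add_left ih _)
  have hdiv : Tendsto (fun n : ℕ => n / L) atTop atTop :=
    Nat.tendsto_div_const_atTop hL
  have hratio : Tendsto (fun n : ℕ => ((n / L : ℕ) : ℝ) / n) atTop (𝓝 (1 / L)) := by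
    have h1 := (tendsto_nat_floor_mul_div_atTop (R := ℝ) (a := 1 / (L : ℝ))
      (by positivity)).comp tendsto_natCast_atTop_atTop
    refine h1.congr fun n => ?_
    simp only [Function.comp]
    congr 2
    rw [one_div, inv_mul_eq_div, Nat.floor_div_natCast, Nat.floor_natCast]
  have hlim : Tendsto (fun n : ℕ => (∑ j ∈ Finset.range (n / L), X j i) / ((n / L : ℕ) : ℝ) *
      (((n / L : ℕ) : ℝ) / n)) atTop (𝓝 (mean p g L * (1 / L))) := (hi.comp hdiv).mul hratio
  rw [mul_one_div] at hlim
  filter_upwards [hlim.eventually (gt_mem_nhds (lt_add_of_pos_right _ hε)),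
    eventually_ge_atTop L] with n hn hnL
  refine le_trans ?_ hn.le
  have hkpos : (0 : ℝ) < ((n / L : ℕ) : ℝ) :=
    Nat.cast_pos.2 (Nat.div_pos hnL (Nat.pos_of_ne_zero hL))
  rw [div_mul_div_cancel₀ hkpos.ne', avg]
  refine div_le_div_of_nonneg_right ?_ (Nat.cast_nonneg n)
  refine le_trans ?_ (hblock (n / L))
  have e1 : n = n / L * L + n % L := (Nat.div_add_mod' n L).symm
  conv_lhs => rw [e1, wordPrefix_add]
  linarith [h.append (wordPrefix i (n / L * L)) (wordPrefix (wordShift (n / L * L) i) (n % L)),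
    h.nonpos (wordPrefix (wordShift (n / L * L) i) (n % L))]

/-- **Subadditive ergodic theorem** for Bernoulli measures: the averages of a subadditive function
converge almost everywhere to a constant. -/
theorem tendsto_avg (h : SubadditiveWord g K) :
    ∃ l : ℝ, ∀ᵐ i ∂bernoulli p, Tendsto (fun n => avg g n i) atTop (𝓝 l) := by
  set l := (h.subadditive_mean p).lim with hl
  refine ⟨l, ?_⟩
  have h1 : ∀ᵐ i ∂bernoulli p, ∀ L : ℕ, L ≠ 0 → ∀ ε : ℝ, 0 < ε →
      ∀ᶠ n in atTop, avg g n i ≤ mean p g L / L + ε := by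
    rw [ae_all_iff]
    intro L
    by_cases hL : L = 0
    · exact Eventually.of_forall fun i hL' => absurd hL hL'
    · filter_upwards [h.eventually_avg_le p hL] with i hi _ using hi
  have h2 : ∀ᵐ i ∂bernoulli p, ∀ ε : ℝ, 0 < ε → ∀ᶠ n in atTop, avg g n i ≤ l + ε := by
    filter_upwards [h1] with i hi ε hε
    have h3 := (h.subadditive_mean p).tendsto_lim (h.bddBelow_mean p)
    obtain ⟨L, hL1, hL2⟩ := ((h3.eventually (gt_mem_nhds (show l < l + ε / 2 by linarith))).and
      (eventually_ne_atTop 0)).exists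
    filter_upwards [hi L hL2 (ε / 2) (half_pos hε)] with n hn
    linarith
  have h3 : ∀ᵐ i ∂bernoulli p, lower g i ≤ l := by
    filter_upwards [h2] with i hi
    refine le_of_forall_pos_le_add fun ε hε => ?_
    exact liminf_le_of_frequently_le (hi ε hε).frequently (h.isBoundedUnder_ge i)
  -- The lower limit is at most `l` almost everywhere and has integral at least `l`, hence equals
  -- `l` almost everywhere.
  have h4 : ∀ᵐ i ∂bernoulli p, l - lower g i = 0 := by
    have h5 : 0 ≤ᵐ[bernoulli p] fun i => l - lower g i := by
      filter_upwards [h3] with i hi using sub_nonneg.2 hi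
    have hint : Integrable (fun i => l - lower g i) (bernoulli p) :=
      (integrable_const l).sub (h.integrable_lower p)
    refine (integral_eq_zero_iff_of_nonneg_ae h5 hint).1 (le_antisymm ?_ (integral_nonneg_of_ae h5))
    rw [integral_sub (integrable_const l) (h.integrable_lower p)]
    simpa using h.lim_le_integral_lower p
  filter_upwards [h2, h4] with i hi hi'
  refine tendsto_order.2 ⟨fun a ha => ?_, fun a ha => ?_⟩
  · refine eventually_lt_of_lt_liminf ?_ (h.isBoundedUnder_ge i)
    change a < lower g i
    linarith
  · filter_upwards [hi ((a - l) / 2) (by linarith)] with n hn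
    linarith

end SubadditiveWord

/-! ### Lyapunov exponents -/

variable {m : ℕ} (S : AffineIFS m)

theorem exists_subadditiveWord_norm :
    ∃ K, SubadditiveWord (fun w => Real.log ‖S.AWord w‖) K := by
  obtain ⟨r, hr0, hr1, hr⟩ := S.exists_contraction
  obtain ⟨τ, hτ0, hτ1, hτ⟩ := S.exists_expansion
  have hpos : ∀ w, 0 < ‖S.AWord w‖ := fun w => by rw [norm_AWord]; exact S.α_pos 0 w
  refine ⟨-Real.log τ, by simp, fun w v => ?_, fun w => ?_, fun a w => ?_⟩
  · rw [AWord_append, ← Real.log_mul (hpos w).ne' (hpos v).ne']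
    refine Real.log_le_log ?_ (norm_mul_le _ _)
    rw [← AWord_append]; exact hpos _
  · exact Real.log_nonpos (hpos w).le
      ((S.norm_AWord_le hr0.le hr w).trans (pow_le_one₀ hr0.le hr1.le))
  · rw [sub_neg_eq_add, add_comm, ← Real.log_mul hτ0.ne' (hpos w).ne']
    refine Real.log_le_log (mul_pos hτ0 (hpos w)) ?_
    rw [← le_div_iff₀' hτ0]
    refine ContinuousLinearMap.opNorm_le_bound _ (by positivity) fun v => ?_
    rw [div_mul_eq_mul_div, le_div_iff₀' hτ0]
    refine (hτ a _).trans ?_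
    rw [AWord_cons]
    exact ContinuousLinearMap.le_opNorm (S.A a * S.AWord w) v

theorem det_AWord_append (w v : List (Fin m)) :
    (S.AWord (w ++ v)).det = (S.AWord w).det * (S.AWord v).det := by
  rw [AWord_append]
  exact LinearMap.det_comp _ _

/-- This quantity is additive and equals `log α₁ + log α₂`; subtracting `log ‖A_w‖ = log α₁` leaves
the second exponent. -/
theorem exists_subadditiveWord_det :
    ∃ K, SubadditiveWord (fun w => Real.log |(S.AWord w).det|) K := by
  obtain ⟨r, hr0, hr1, hr⟩ := S.exists_contraction
  obtain ⟨τ, hτ0, hτ1, hτ⟩ := S.exists_expansion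
  have hpos : ∀ w, 0 < |(S.AWord w).det| := fun w => by
    rw [abs_det_AWord]; exact mul_pos (S.α_pos 0 w) (S.α_pos 1 w)
  have hle : ∀ w, S.α 0 w ≤ 1 := fun w => by
    rw [← norm_AWord]
    exact (S.norm_AWord_le hr0.le hr w).trans (pow_le_one₀ hr0.le hr1.le)
  have happ : ∀ w v, Real.log |(S.AWord (w ++ v)).det| =
      Real.log |(S.AWord w).det| + Real.log |(S.AWord v).det| := fun w v => by
    rw [det_AWord_append, abs_mul, Real.log_mul (hpos w).ne' (hpos v).ne']
  refine ⟨-Real.log (τ * τ), ?_, fun w v => (happ w v).le, fun w => ?_, fun a w => ?_⟩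
  · have := happ [] []
    simp only [List.append_nil] at this
    linarith
  · refine Real.log_nonpos (hpos w).le ?_
    rw [abs_det_AWord]
    exact mul_le_one₀ (hle w) (S.α_pos 1 w).le ((S.α_one_le w).trans (hle w))
  · have h1 := happ [a] w
    have h2 : τ ≤ S.α 1 [a] := S.le_α_one fun v => by simpa using hτ a v
    have h3 : Real.log (τ * τ) ≤ Real.log |(S.AWord [a]).det| := by
      refine Real.log_le_log (mul_pos hτ0 hτ0) ?_
      rw [abs_det_AWord]
      exact mul_le_mul (h2.trans (S.α_one_le _)) h2 hτ0.le (S.α_pos 0 _).le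
    rw [List.singleton_append] at h1
    linarith

/-- The Lyapunov exponents exist. -/
theorem tendsto_lyapunov (p : PMF (Fin m)) (k : Fin 2) : ∀ᵐ i ∂bernoulli p,
    Tendsto (fun n : ℕ => -(1 / (n : ℝ)) * Real.log (S.α k (wordPrefix i n))) atTop
      (𝓝 (S.lyapunov p k)) := by
  refine Classical.epsilon_spec (p := fun l : ℝ => ∀ᵐ i ∂bernoulli p,
    Tendsto (fun n : ℕ => -(1 / (n : ℝ)) * Real.log (S.α k (wordPrefix i n))) atTop (𝓝 l)) ?_
  obtain ⟨K, hK⟩ := S.exists_subadditiveWord_norm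
  obtain ⟨K', hK'⟩ := S.exists_subadditiveWord_det
  obtain ⟨l, hl⟩ := hK.tendsto_avg p
  obtain ⟨l', hl'⟩ := hK'.tendsto_avg p
  fin_cases k
  · refine ⟨-l, ?_⟩
    filter_upwards [hl] with i hi
    refine hi.neg.congr fun n => ?_
    rw [SubadditiveWord.avg, norm_AWord]
    change _ = -(1 / (n : ℝ)) * Real.log (S.α 0 _)
    ring
  · refine ⟨-(l' - l), ?_⟩
    filter_upwards [hl, hl'] with i hi hi'
    refine (hi'.sub hi).neg.congr fun n => ?_
    rw [SubadditiveWord.avg, SubadditiveWord.avg, norm_AWord, abs_det_AWord,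
      Real.log_mul (S.α_pos 0 _).ne' (S.α_pos 1 _).ne']
    change _ = -(1 / (n : ℝ)) * Real.log (S.α 1 _)
    ring

/-- If the Lyapunov exponents differ, the cylinders flatten exponentially fast. -/
theorem exists_flattening (p : PMF (Fin m)) (h : S.lyapunov p 0 < S.lyapunov p 1) :
    ∃ q : ℝ, 0 < q ∧ q < 1 ∧ ∀ᵐ i ∂bernoulli p, ∀ᶠ n in atTop,
      S.α 1 (wordPrefix i n) ≤ q ^ n * S.α 0 (wordPrefix i n) := by
  set c := (S.lyapunov p 1 - S.lyapunov p 0) / 2 with hc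
  have hc0 : 0 < c := by rw [hc]; linarith
  refine ⟨Real.exp (-c), Real.exp_pos _, by rw [Real.exp_lt_one_iff]; linarith, ?_⟩
  filter_upwards [S.tendsto_lyapunov p 0, S.tendsto_lyapunov p 1] with i h0 h1
  have h2 := (h1.sub h0).eventually (lt_mem_nhds (show c < S.lyapunov p 1 - S.lyapunov p 0 by
    rw [hc]; linarith))
  filter_upwards [h2, eventually_gt_atTop 0] with n hn hn0
  have hn' : (0 : ℝ) < n := Nat.cast_pos.2 hn0
  have p0 := S.α_pos 0 (wordPrefix i n)
  have p1 := S.α_pos 1 (wordPrefix i n)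
  rw [← Real.exp_nat_mul]
  conv_rhs => rw [← Real.exp_log p0]
  rw [← Real.exp_add, ← Real.log_le_iff_le_exp p1]
  have h3 : -(1 / (n : ℝ)) * Real.log (S.α 1 (wordPrefix i n)) -
      -(1 / (n : ℝ)) * Real.log (S.α 0 (wordPrefix i n)) =
      (Real.log (S.α 0 (wordPrefix i n)) - Real.log (S.α 1 (wordPrefix i n))) / n := by ring
  rw [h3, lt_div_iff₀ hn'] at hn
  linarith

end AffineIFS

/-! ### The limit direction -/

/-- Unit vectors whose successive angles are summable converge after a choice of signs. -/
theorem exists_signs_tendsto {q K : ℝ} (hq1 : q < 1) {h h' : ℕ → Plane} (N : ℕ)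
    (hh : ∀ n, OrthoPair (h n) (h' n))
    (hK : ∀ n ≥ N, |inner ℝ (h' n) (h (n + 1))| ≤ K * q ^ n) :
    ∃ (s : ℕ → ℝ) (u : Plane), (∀ n, s n = 1 ∨ s n = -1) ∧
      Tendsto (fun n => s n • h n) atTop (𝓝 u) := by
  -- The signs are chosen recursively so that consecutive signed vectors never form an obtuse angle.
  let s : ℕ → ℝ := fun n => Nat.rec 1 (fun n t => if 0 ≤ t * inner ℝ (h n) (h (n + 1)) then 1
    else -1) n
  have hs : ∀ n, s n = 1 ∨ s n = -1 := by
    intro n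
    cases n with
    | zero => exact Or.inl rfl
    | succ n =>
      change (if 0 ≤ s n * inner ℝ (h n) (h (n + 1)) then (1 : ℝ) else -1) = 1 ∨ _ = (-1 : ℝ)
      split_ifs with hc
      · exact Or.inl rfl
      · exact Or.inr (if_neg hc)
  have hpos : ∀ n, 0 ≤ s (n + 1) * s n * inner ℝ (h n) (h (n + 1)) := by
    intro n
    have : s (n + 1) = if 0 ≤ s n * inner ℝ (h n) (h (n + 1)) then (1 : ℝ) else -1 := rfl
    rw [this]
    split_ifs with hc <;> linarith
  have hsq : ∀ n, s n * s n = 1 := by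
    intro n
    rcases hs n with h | h <;> rw [h] <;> norm_num
  have hstep : ∀ n ≥ N, ‖s n • h n - s (n + 1) • h (n + 1)‖ ≤ 2 * (K * q ^ n) := by
    intro n hn
    have h1 := (hh n).norm_sq (h (n + 1))
    rw [(hh (n + 1)).norm_fst] at h1
    have h2 := hpos n
    have h3 : ‖s n • h n - s (n + 1) • h (n + 1)‖ ^ 2 =
        2 - 2 * (s (n + 1) * s n * inner ℝ (h n) (h (n + 1))) := by
      rw [norm_sub_sq_real, norm_smul, norm_smul, (hh n).norm_fst, (hh (n + 1)).norm_fst,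
        real_inner_smul_left, real_inner_smul_right, mul_one, mul_one, Real.norm_eq_abs,
        Real.norm_eq_abs, sq_abs, sq_abs, sq, sq, hsq n, hsq (n + 1)]
      ring
    have h4 := hK n hn
    set c := s (n + 1) * s n * inner ℝ (h n) (h (n + 1)) with hc
    have h5 : c ^ 2 = inner ℝ (h n) (h (n + 1)) ^ 2 := by
      rw [hc]
      calc _ = (s (n + 1) * s (n + 1)) * (s n * s n) * inner ℝ (h n) (h (n + 1)) ^ 2 := by ring
        _ = _ := by rw [hsq n, hsq (n + 1)]; ring
    -- Here `c` is the cosine of an angle that is not obtuse, so the squared distance `2 - 2c` is at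
    -- most `2(1 - c²)`, twice the squared sine.
    have h6 : c ≤ 1 := by nlinarith [sq_nonneg (inner ℝ (h' n) (h (n + 1)))]
    refine abs_le_of_sq_le_sq' ?_ (by linarith [abs_nonneg (inner ℝ (h' n) (h (n + 1)))]) |>.2
    rw [h3]
    have h7 : inner ℝ (h' n) (h (n + 1)) ^ 2 ≤ (K * q ^ n) ^ 2 := by
      rw [← sq_abs]
      exact pow_le_pow_left₀ (abs_nonneg _) h4 2
    nlinarith
  have hc : CauchySeq fun n => s (n + N) • h (n + N) := by
    refine cauchySeq_of_le_geometric q (2 * (K * q ^ N)) hq1 fun n => ?_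
    rw [dist_eq_norm, show n + 1 + N = n + N + 1 by ring]
    refine (hstep (n + N) (by omega)).trans (le_of_eq ?_)
    rw [pow_add]; ring
  obtain ⟨u, hu⟩ := cauchySeq_tendsto_of_complete hc
  exact ⟨s, u, hs, (tendsto_add_atTop_iff_nat (f := fun n => s n • h n) N).1 hu⟩

namespace AffineIFS

variable {m : ℕ} (S : AffineIFS m)

theorem α_zero_append_singleton_ge {τ : ℝ} (h0 : 0 < τ) (hτ : ∀ a v, τ * ‖v‖ ≤ ‖S.A a v‖)
    (w : List (Fin m)) (a : Fin m) : τ * S.α 0 w ≤ S.α 0 (w ++ [a]) := by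
  rw [← norm_AWord, ← norm_AWord, ← le_div_iff₀' h0]
  refine ContinuousLinearMap.opNorm_le_bound _ (by positivity) fun x => ?_
  obtain ⟨y, rfl⟩ : ∃ y, S.A a y = x := by
    obtain ⟨t, ht⟩ := S.isUnit_A a
    refine ⟨(t⁻¹).1 x, ?_⟩
    rw [← ht]
    change (t.1 * (t⁻¹).1) x = x
    simp
  have h1 := (S.AWord (w ++ [a])).le_opNorm y
  have h2 : S.AWord w (S.A a y) = S.AWord (w ++ [a]) y := by
    rw [AWord_append, AWord_cons, AWord_nil, mul_one]; rfl
  rw [h2]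
  refine h1.trans ?_
  rw [div_mul_eq_mul_div, le_div_iff₀ h0, mul_assoc, mul_comm _ τ]
  exact mul_le_mul_of_nonneg_left (hτ a y) (norm_nonneg _)

/-- Where the cylinders flatten exponentially fast, the limit direction exists. -/
theorem exists_limitDirection {e₁ e₂ h₁ h₂ : List (Fin m) → Plane}
    (hsvd : ∀ w, IsSVD (S.AWord w) (S.α 0 w) (S.α 1 w) (e₁ w) (e₂ w) (h₁ w) (h₂ w))
    {q : ℝ} (hq1 : q < 1) (i : ℕ → Fin m)
    (hi : ∀ᶠ n in atTop, S.α 1 (wordPrefix i n) ≤ q ^ n * S.α 0 (wordPrefix i n)) :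
    ∃ (s : ℕ → ℝ) (u : Plane), (∀ n, s n = 1 ∨ s n = -1) ∧ ‖u‖ = 1 ∧ S.IsLimitDirection i u ∧
      Tendsto (fun n => s n • h₁ (wordPrefix i n)) atTop (𝓝 u) := by
  obtain ⟨τ, hτ0, -, hτ⟩ := S.exists_expansion
  obtain ⟨N, hN⟩ := eventually_atTop.1 hi
  obtain ⟨s, u, hs, hu⟩ := exists_signs_tendsto (q := q) (K := τ⁻¹) hq1 N
    (h := fun n => h₁ (wordPrefix i n)) (h' := fun n => h₂ (wordPrefix i n))
    (fun n => (hsvd _).target) fun n hn => by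
      have H := hsvd (wordPrefix i n)
      have H' := hsvd (wordPrefix i (n + 1))
      -- Pairing this vector with `h₂` of the shorter word bounds `α₁(i|_{n+1})` times the sine of
      -- the angle by `α₂(i|_n)`. As `α₁` drops by at most the factor `τ`, the sine is at most `q ^
      -- n / τ`.
      have h1 : S.AWord (wordPrefix i n) (S.A (i n) (e₁ (wordPrefix i (n + 1)))) =
          S.α 0 (wordPrefix i (n + 1)) • h₁ (wordPrefix i (n + 1)) := by
        rw [← H'.apply_fst, wordPrefix_succ', AWord_append, AWord_cons, AWord_nil, mul_one]; rfl
      have h2 := H.inner_snd (S.A (i n) (e₁ (wordPrefix i (n + 1))))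
      rw [h1, real_inner_smul_right] at h2
      have h3 := H.source.abs_inner_snd_le (S.A (i n) (e₁ (wordPrefix i (n + 1))))
      have h4 : ‖S.A (i n) (e₁ (wordPrefix i (n + 1)))‖ ≤ 1 := by
        refine ((S.A (i n)).le_opNorm _).trans ?_
        rw [H'.source.norm_fst, mul_one]
        exact (S.norm_A_lt_one _).le
      have h5 := congrArg abs h2
      rw [abs_mul, abs_mul, abs_of_pos H'.pos_fst, abs_of_pos H.pos] at h5
      have h6 := S.α_zero_append_singleton_ge hτ0 hτ (wordPrefix i n) (i n)
      rw [← wordPrefix_succ'] at h6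
      have h7 := hN n hn
      have h8 := H.pos
      set X := |inner ℝ (h₂ (wordPrefix i n)) (h₁ (wordPrefix i (n + 1)))| with hX
      have hX0 : 0 ≤ X := abs_nonneg _
      have h9 : τ * S.α 0 (wordPrefix i n) * X ≤ q ^ n * S.α 0 (wordPrefix i n) := by
        calc _ ≤ S.α 0 (wordPrefix i (n + 1)) * X := mul_le_mul_of_nonneg_right h6 hX0
          _ ≤ S.α 1 (wordPrefix i n) * 1 := by
            rw [h5]; exact mul_le_mul_of_nonneg_left (h3.trans h4) h8.le
          _ ≤ _ := by rw [mul_one]; exact h7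
      have h10 : τ * X ≤ q ^ n := by
        refine le_of_mul_le_mul_right ?_ H.pos_fst
        linarith
      rw [inv_mul_eq_div, le_div_iff₀' hτ0]
      exact h10
  have hn : ∀ n, ‖s n • h₁ (wordPrefix i n)‖ = 1 := by
    intro n
    rw [norm_smul, (hsvd _).target.norm_fst, mul_one, Real.norm_eq_abs]
    rcases hs n with h | h <;> simp [h]
  refine ⟨s, u, hs, ?_, ⟨_, fun n => ?_, hu⟩, hu⟩
  · have := hu.norm
    simp only [hn] at this
    exact (tendsto_nhds_unique this tendsto_const_nhds)
  · rcases hs n with h | h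
    · rw [h, one_smul]; exact S.isSemiaxis_of_isSVD (hsvd _)
    · rw [h, neg_one_smul]; exact S.isSemiaxis_of_isSVD (hsvd _).neg

end AffineIFS

/-! ### Projections and widths -/

/-- The coordinates along `u` of a set whose projection to the line of `u` is a segment. -/
theorem IsLineSegment.exists_Icc {u : Plane} (hu : ‖u‖ = 1) {B : Set Plane}
    (h : IsLineSegment ((Submodule.span ℝ {u}).starProjection '' B)) :
    ∃ a b : ℝ, a < b ∧ (fun z => inner ℝ u z) '' B = Icc a b := by
  obtain ⟨x, y, hxy, hB⟩ := h
  have hP : ∀ z, (Submodule.span ℝ {u}).starProjection z = inner ℝ u z • u := by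
    intro z
    rw [Submodule.starProjection_singleton, hu]
    simp
  have hu2 : inner ℝ u u = (1 : ℝ) := by rw [real_inner_self_eq_norm_sq, hu]; norm_num
  have h1 : (fun z => inner ℝ u z) '' B =
      (innerSL ℝ u).toLinearMap '' ((Submodule.span ℝ {u}).starProjection '' B) := by
    rw [image_image]
    refine image_congr fun z _ => ?_
    rw [hP]
    change _ = inner ℝ u (inner ℝ u z • u)
    rw [real_inner_smul_right, hu2, mul_one]
  have h2 : ∀ z ∈ segment ℝ x y, z = inner ℝ u z • u := by
    rw [← hB]
    rintro _ ⟨z, -, rfl⟩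
    rw [hP, real_inner_smul_right, hu2, mul_one]
  have h3 : inner ℝ u x ≠ inner ℝ u y := by
    intro h
    apply hxy
    rw [h2 x (left_mem_segment ℝ x y), h2 y (right_mem_segment ℝ x y), h]
  have h4 := image_segment ℝ (innerSL ℝ u).toLinearMap.toAffineMap x y
  refine ⟨min (inner ℝ u x) (inner ℝ u y), max (inner ℝ u x) (inner ℝ u y), min_lt_max.2 h3, ?_⟩
  rw [h1, hB]
  refine h4.trans ?_
  rw [segment_eq_uIcc]
  rfl

namespace AffineIFS.IsSelfAffineSet

variable {m : ℕ} {S : AffineIFS m} {E : Set Plane}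

/-- A strongly separated self-affine set with a cylinder projecting onto a segment is not contained
in a line. -/
theorem exists_inner_ne (hE : S.IsSelfAffineSet E) (hm : 2 ≤ m) (hsep : S.StrongSeparation E)
    {u : Plane} (hu : ‖u‖ = 1) {w : List (Fin m)}
    (hw : IsLineSegment ((Submodule.span ℝ {u}).starProjection '' S.cylinder E w))
    {η : Plane} (hη : ‖η‖ = 1) : ∃ z ∈ E, ∃ z' ∈ E, 0 < inner ℝ η (z - z') := by
  by_contra hcon
  push Not at hcon
  have hzero : ∀ z ∈ E, ∀ z' ∈ E, inner ℝ η (z - z') = 0 := by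
    intro z hz z' hz'
    refine le_antisymm (hcon z hz z' hz') ?_
    have := hcon z' hz' z hz
    rw [← neg_sub, inner_neg_right] at this
    linarith
  obtain ⟨a, b, hab, hIcc⟩ := hw.exists_Icc hu
  -- If `E` lay in a line, `G` would be affine and non-constant along it, hence injective on `E`.
  -- Then the disjoint first-level pieces would split the interval `G '' E` into two disjoint
  -- non-empty closed sets.
  set G : Plane → ℝ := fun z => inner ℝ u (S.fWord w z) with hG
  have hGE : G '' E = Icc a b := by rw [← hIcc, cylinder, image_image]
  have hGc : Continuous G := by
    have := S.continuous_fWord w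
    fun_prop
  have ho := OrthoPair.rotateQuarter hη
  have hGsub : ∀ z ∈ E, ∀ z' ∈ E, G z - G z' =
      inner ℝ (rotateQuarter η) (z - z') * inner ℝ u (S.AWord w (rotateQuarter η)) := by
    intro z hz z' hz'
    have h1 := ho.eq_add (z - z')
    rw [hzero z hz z' hz', zero_smul, zero_add] at h1
    rw [hG]
    simp only
    rw [← inner_sub_right, fWord_sub]
    conv_lhs => rw [h1]
    rw [map_smul, real_inner_smul_right]
  have hinj : ∀ z ∈ E, ∀ z' ∈ E, G z = G z' → z = z' := by
    have hκ : inner ℝ u (S.AWord w (rotateQuarter η)) ≠ 0 := by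
      intro h0
      obtain ⟨z, hz, hza⟩ : a ∈ G '' E := by rw [hGE]; exact left_mem_Icc.2 hab.le
      obtain ⟨z', hz', hzb⟩ : b ∈ G '' E := by rw [hGE]; exact right_mem_Icc.2 hab.le
      have := hGsub z hz z' hz'
      rw [hza, hzb, h0, mul_zero] at this
      linarith
    intro z hz z' hz' h
    have h1 := hGsub z hz z' hz'
    rw [h, sub_self] at h1
    have h2 := (mul_eq_zero.1 h1.symm).resolve_right hκ
    have h3 := ho.eq_add (z - z')
    rw [hzero z hz z' hz', h2, zero_smul, zero_smul, zero_add] at h3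
    exact sub_eq_zero.1 h3
  obtain ⟨δ, hδ0, hδ⟩ := hsep
  let c₀ : Fin m := ⟨0, by omega⟩
  let c₁ : Fin m := ⟨1, by omega⟩
  have hne : c₁ ≠ c₀ := by simp [c₀, c₁]
  have hf : ∀ c, IsCompact (S.f c '' E) := fun c => by
    have := hE.isCompact_cylinder [c]
    exact this
  have hsub : ∀ c, S.f c '' E ⊆ E := by
    rintro c _ ⟨z, hz, rfl⟩
    exact hE.f_mem c hz
  set U := G '' (S.f c₀ '' E)
  set V := G '' (⋃ c ∈ {c | c ≠ c₀}, S.f c '' E)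
  have hU : IsClosed U := ((hf c₀).image hGc).isClosed
  have hV : IsClosed V :=
    ((Set.toFinite {c | c ≠ c₀}).isCompact_biUnion fun c _ => hf c).image hGc |>.isClosed
  obtain ⟨x₀, hx₀⟩ := hE.nonempty
  have hpre := isPreconnected_closed_iff.1 (isPreconnected_Icc (a := a) (b := b)) U V hU hV ?_ ?_ ?_
  · obtain ⟨t, -, ⟨z, hz, hzt⟩, ⟨z', hz', hzt'⟩⟩ := hpre
    simp only [mem_iUnion] at hz'
    obtain ⟨c, hc, hz'⟩ := hz'
    have h1 := hinj z (hsub _ hz) z' (hsub _ hz') (hzt.trans hzt'.symm)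
    have h2 := hδ c c₀ hc z' hz' z hz
    rw [h1, dist_self] at h2
    linarith
  · rw [← hGE]
    rintro _ ⟨z, hz, rfl⟩
    have hz' := hz
    rw [hE.eq_iUnion] at hz'
    obtain ⟨c, hc⟩ := mem_iUnion.1 hz'
    by_cases hcc : c = c₀
    · left; subst hcc; exact ⟨z, hc, rfl⟩
    · right; exact ⟨z, mem_biUnion hcc hc, rfl⟩
  · refine ⟨G (S.f c₀ x₀), ?_, ⟨_, ⟨x₀, hx₀, rfl⟩, rfl⟩⟩
    rw [← hGE]; exact ⟨_, hE.f_mem _ hx₀, rfl⟩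
  · refine ⟨G (S.f c₁ x₀), ?_, ⟨_, mem_biUnion hne ⟨x₀, hx₀, rfl⟩, rfl⟩⟩
    rw [← hGE]; exact ⟨_, hE.f_mem _ hx₀, rfl⟩

end AffineIFS.IsSelfAffineSet

/-- A set that is not contained in a line has width bounded from below in all directions. -/
theorem exists_width {E : Set Plane}
    (h : ∀ η : Plane, ‖η‖ = 1 → ∃ z ∈ E, ∃ z' ∈ E, 0 < inner ℝ η (z - z')) :
    ∃ κ : ℝ, 0 < κ ∧ ∀ η : Plane, ‖η‖ = 1 → ∃ z ∈ E, ∃ z' ∈ E, κ < inner ℝ η (z - z') := by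
  let U : ℕ → Set Plane := fun n =>
    {η | ∃ z ∈ E, ∃ z' ∈ E, 1 / ((n : ℝ) + 1) < inner ℝ η (z - z')}
  have hU : ∀ n, IsOpen (U n) := by
    intro n
    have : U n = ⋃ z ∈ E, ⋃ z' ∈ E, {η | 1 / ((n : ℝ) + 1) < inner ℝ η (z - z')} := by
      ext η; simp [U]
    rw [this]
    refine isOpen_biUnion fun z _ => isOpen_biUnion fun z' _ => ?_
    exact isOpen_lt continuous_const (by fun_prop)
  have hmono : Monotone U := by
    rintro n k hnk η ⟨z, hz, z', hz', hlt⟩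
    refine ⟨z, hz, z', hz', lt_of_le_of_lt ?_ hlt⟩
    exact one_div_le_one_div_of_le (by positivity) (by exact_mod_cast Nat.succ_le_succ hnk)
  -- Increasing open sets cover the compact circle, so one of them is everything.
  obtain ⟨n, hn⟩ := (isCompact_sphere (0 : Plane) 1).elim_directed_cover U hU
    (fun η hη => by
      obtain ⟨z, hz, z', hz', hpos⟩ := h η (by simpa using hη)
      obtain ⟨n, hn⟩ := exists_nat_one_div_lt hpos
      exact mem_iUnion.2 ⟨n, z, hz, z', hz', hn⟩)
    hmono.directed_le
  exact ⟨1 / ((n : ℝ) + 1), by positivity, fun η hη => hn (by simpa using hη)⟩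

/-! ### The measure of thin strips -/

namespace AffineIFS

variable {m : ℕ} {S : AffineIFS m} {E : Set Plane}

/-- Pulling a strip back by `f_w` replaces its normal `η` by `A_wᵀ η`; this bounds the resulting
growth of the normalised width. -/
theorem le_norm_adjoint_AWord {τ : ℝ} (h0 : 0 ≤ τ) (hτ : ∀ a v, τ * ‖v‖ ≤ ‖S.A a v‖)
    (w : List (Fin m)) {η : Plane} (hη : ‖η‖ = 1) :
    τ ^ w.length ≤ ‖ContinuousLinearMap.adjoint (S.AWord w) η‖ := by
  obtain ⟨t, ht⟩ := S.isUnit_AWord w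
  obtain ⟨y, hy⟩ : ∃ y, S.AWord w y = η := by
    refine ⟨(t⁻¹).1 η, ?_⟩
    rw [← ht]
    change (t.1 * (t⁻¹).1) η = η
    simp
  have h1 := S.le_norm_AWord_apply h0 hτ w y
  have h2 : inner ℝ (ContinuousLinearMap.adjoint (S.AWord w) η) y = 1 := by
    rw [ContinuousLinearMap.adjoint_inner_left, hy, real_inner_self_eq_norm_sq, hη, one_pow]
  have h3 := real_inner_le_norm (ContinuousLinearMap.adjoint (S.AWord w) η) y
  rw [h2] at h3
  rw [hy, hη] at h1
  have h4 : 0 < ‖y‖ := by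
    refine norm_pos_iff.2 ?_
    rintro rfl
    rw [inner_zero_right] at h2
    exact zero_ne_one h2
  exact le_of_mul_le_mul_right (h1.trans h3) h4

theorem inner_fWord (w : List (Fin m)) (η y : Plane) : inner ℝ η (S.fWord w y) =
    inner ℝ (ContinuousLinearMap.adjoint (S.AWord w) η) y + inner ℝ η (S.fWord w 0) := by
  have h := S.fWord_sub w y 0
  rw [sub_zero] at h
  rw [ContinuousLinearMap.adjoint_inner_left, ← h, inner_sub_right]
  ring

theorem measurableSet_strip (η : Plane) (s ε : ℝ) :
    MeasurableSet {i | |inner ℝ η (S.proj i) - s| ≤ ε} := by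
  have := S.continuous_proj
  exact (isClosed_le (by fun_prop) continuous_const).measurableSet

/-- The self-affine measure of a strip decays like a power of its width, uniformly in the
direction. -/
theorem IsSelfAffineSet.exists_strip_bound (hE : S.IsSelfAffineSet E) (p : PMF (Fin m))
    (hp : ∀ a, 0 < p a) {κ : ℝ} (hκ : 0 < κ)
    (hwidth : ∀ η : Plane, ‖η‖ = 1 → ∃ z ∈ E, ∃ z' ∈ E, κ < inner ℝ η (z - z')) :
    ∃ ε τ ρ : ℝ, 0 < ε ∧ 0 < τ ∧ τ < 1 ∧ 0 < ρ ∧ ρ < 1 ∧ ∀ (l : ℕ) (η : Plane) (s : ℝ), ‖η‖ = 1 →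
      (bernoulli p).real {i | |inner ℝ η (S.proj i) - s| ≤ ε * τ ^ l} ≤ ρ ^ l := by
  obtain ⟨D, hD, hdiam⟩ := hE.exists_diam
  obtain ⟨r, hr0, hr1, hr⟩ := S.exists_contraction
  obtain ⟨τ, hτ0, hτ1, hτ⟩ := S.exists_expansion
  obtain ⟨x₀, hx₀⟩ := hE.nonempty
  obtain ⟨i₀, -⟩ := hE.exists_proj hx₀
  have : Nonempty (Fin m) := ⟨i₀ 0⟩
  obtain ⟨a₀, ha₀⟩ := Finite.exists_min fun a => (p a).toReal
  set q := (p a₀).toReal with hq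
  have hq0 : 0 < q := ENNReal.toReal_pos (hp a₀).ne' (p.apply_ne_top a₀)
  have hlim : Tendsto (fun n : ℕ => r ^ n * D) atTop (𝓝 0) := by
    simpa using (tendsto_pow_atTop_nhds_zero_of_lt_one hr0.le hr1).mul_const D
  -- Cylinders of level `k` are so small, compared with the width of `E`, that every strip of
  -- half-width `κ / 8` misses one of them.
  obtain ⟨k, hk, hk1⟩ := ((hlim.eventually (gt_mem_nhds (show 0 < κ / 8 by positivity))).and
    (eventually_gt_atTop 0)).exists
  have hτk0 : 0 < τ ^ k := pow_pos hτ0 k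
  have hτk1 : τ ^ k < 1 := pow_lt_one₀ hτ0.le hτ1 hk1.ne'
  -- The entry `1 / 2` only keeps the decay rate positive.
  refine ⟨κ / 8, τ ^ k, max (1 - q ^ k) (1 / 2), by positivity, hτk0, hτk1, by positivity,
    max_lt (by linarith [pow_pos hq0 k]) (by norm_num), fun l => ?_⟩
  set ρ := max (1 - q ^ k) (1 / 2) with hρ
  have hρ0 : 0 < ρ := by positivity
  induction l with
  | zero => intro η s _; simp
  | succ l ih =>
    intro η s hη
    have hA := measurableSet_strip (S := S) η s (κ / 8 * (τ ^ k) ^ (l + 1))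
    set A := {i | |inner ℝ η (S.proj i) - s| ≤ κ / 8 * (τ ^ k) ^ (l + 1)} with hAdef
    obtain ⟨z, hz, hzs⟩ : ∃ z ∈ E, κ / 2 ≤ |inner ℝ η z - s| := by
      by_contra hcon
      push Not at hcon
      obtain ⟨z, hz, z', hz', hlt⟩ := hwidth η hη
      have h1 := (abs_lt.1 (hcon z hz)).2
      have h2 := (abs_lt.1 (hcon z' hz')).1
      rw [inner_sub_right] at hlt
      linarith
    obtain ⟨j, rfl⟩ := hE.exists_proj hz
    have hle : κ / 8 * (τ ^ k) ^ (l + 1) ≤ κ / 8 :=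
      mul_le_of_le_one_right (by positivity) (pow_le_one₀ hτk0.le hτk1.le)
    have hempty : appendWord (wordPrefix j k) ⁻¹' A = ∅ := by
      ext i
      simp only [mem_preimage, hAdef, mem_ofPred_eq, mem_empty_iff_false, iff_false, not_le,
        proj_appendWord]
      rw [S.proj_eq_fWord j k] at hzs
      have h1 := S.dist_fWord_le hr0.le hr (wordPrefix j k) (S.proj i) (S.proj (wordShift k j))
      rw [length_wordPrefix] at h1
      have h2 := mul_le_mul_of_nonneg_left (hdiam _ (hE.proj_mem i) _ (hE.proj_mem (wordShift k j)))
        (pow_nonneg hr0.le k)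
      have h3 := abs_real_inner_le_norm η (S.fWord (wordPrefix j k) (S.proj i) -
        S.fWord (wordPrefix j k) (S.proj (wordShift k j)))
      rw [hη, one_mul, inner_sub_right] at h3
      rw [← abs_neg] at h3
      have h4 := abs_sub_abs_le_abs_sub
        (inner ℝ η (S.fWord (wordPrefix j k) (S.proj (wordShift k j))) - s)
        (inner ℝ η (S.fWord (wordPrefix j k) (S.proj i)) - s)
      rw [show inner ℝ η (S.fWord (wordPrefix j k) (S.proj (wordShift k j))) - s -
        (inner ℝ η (S.fWord (wordPrefix j k) (S.proj i)) - s) =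
        -(inner ℝ η (S.fWord (wordPrefix j k) (S.proj i)) -
        inner ℝ η (S.fWord (wordPrefix j k) (S.proj (wordShift k j)))) by ring] at h4
      linarith
    -- Within any cylinder of level `k` the strip pulls back to one wider by a factor of at most
    -- `τ⁻ᵏ`, which the induction hypothesis controls.
    have hall : ∀ w : List (Fin m), w.length = (wordPrefix j k).length →
        (bernoulli p).real (appendWord w ⁻¹' A) ≤ ρ ^ l := by
      intro w hw
      rw [length_wordPrefix] at hw
      set θ := ContinuousLinearMap.adjoint (S.AWord w) η with hθ
      have hθn : τ ^ k ≤ ‖θ‖ := by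
        rw [← hw]; exact le_norm_adjoint_AWord hτ0.le hτ w hη
      have hθ0 : 0 < ‖θ‖ := hτk0.trans_le hθn
      refine le_trans (measureReal_mono ?_) (ih (‖θ‖⁻¹ • θ)
        (‖θ‖⁻¹ * (s - inner ℝ η (S.fWord w 0))) ?_)
      · intro i hi
        simp only [mem_preimage, hAdef, mem_ofPred_eq, proj_appendWord] at hi
        rw [inner_fWord, ← hθ] at hi
        rw [mem_ofPred_eq, real_inner_smul_left, ← mul_sub, abs_mul, abs_of_pos (inv_pos.2 hθ0),
          inv_mul_le_iff₀ hθ0]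
        calc _ = |inner ℝ θ (S.proj i) + inner ℝ η (S.fWord w 0) - s| := by ring_nf
          _ ≤ κ / 8 * (τ ^ k) ^ (l + 1) := hi
          _ = τ ^ k * (κ / 8 * (τ ^ k) ^ l) := by ring
          _ ≤ _ := mul_le_mul_of_nonneg_right hθn (by positivity)
      · rw [norm_smul, norm_inv, norm_norm, inv_mul_cancel₀ hθ0.ne']
    have := bernoulli_real_le_of_append_empty p (pow_nonneg hρ0.le l) hq0.le ha₀ (wordPrefix j k)
      hA hempty hall
    rw [length_wordPrefix] at this
    refine this.trans ?_
    rw [pow_succ' ρ]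
    exact mul_le_mul_of_nonneg_right (le_max_left _ _) (by positivity)

/-- Almost surely the tail of a word eventually avoids exponentially thin strips determined by the
prefixes. -/
theorem IsSelfAffineSet.ae_eventually_avoid (hE : S.IsSelfAffineSet E) (p : PMF (Fin m))
    (hp : ∀ a, 0 < p a) {κ : ℝ} (hκ : 0 < κ)
    (hwidth : ∀ η : Plane, ‖η‖ = 1 → ∃ z ∈ E, ∃ z' ∈ E, κ < inner ℝ η (z - z'))
    {q : ℝ} (hq0 : 0 < q) (hq1 : q < 1) (K : ℝ) (ζ : List (Fin m) → Plane)
    (hζ : ∀ w, ‖ζ w‖ = 1) (s : List (Fin m) → ℝ) :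
    ∀ᵐ i ∂bernoulli p, ∀ᶠ n in atTop,
      K * q ^ n < |inner ℝ (ζ (wordPrefix i n)) (S.proj (wordShift n i)) - s (wordPrefix i n)| := by
  obtain ⟨ε, τ, ρ, hε, hτ0, hτ1, hρ0, hρ1, hstrip⟩ := hE.exists_strip_bound p hp hκ hwidth
  set q' := Real.sqrt q with hq'
  have hq'0 : 0 < q' := Real.sqrt_pos.2 hq0
  have hq'1 : q' < 1 := by rw [hq', Real.sqrt_lt' one_pos]; simpa using hq1
  have hqq : q = q' * q' := (Real.mul_self_sqrt hq0.le).symm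
  obtain ⟨M, hM, hM0⟩ := (((tendsto_pow_atTop_nhds_zero_of_lt_one hq'0.le hq'1).eventually
    (gt_mem_nhds hτ0)).and (eventually_gt_atTop 0)).exists
  have hN : ∀ᶠ n in atTop, K * q' ^ n < ε := by
    have : Tendsto (fun n : ℕ => K * q' ^ n) atTop (𝓝 0) := by
      simpa using (tendsto_pow_atTop_nhds_zero_of_lt_one hq'0.le hq'1).const_mul K
    exact this.eventually (gt_mem_nhds hε)
  set B : ℕ → Set (ℕ → Fin m) := fun n =>
    {i | |inner ℝ (ζ (wordPrefix i n)) (S.proj (wordShift n i)) - s (wordPrefix i n)| ≤ K * q ^ n}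
    with hB
  have hbound : ∀ᶠ n in atTop, (bernoulli p).real (B n) ≤ ρ ^ (n / M) := by
    filter_upwards [hN] with n hn
    -- One factor `q' ^ n` absorbs the constant `K`; the other is compared with a power of `τ`.
    have h1 : K * q ^ n ≤ ε * τ ^ (n / M) := by
      calc K * q ^ n = K * q' ^ n * q' ^ n := by rw [hqq, mul_pow]; ring
        _ ≤ ε * q' ^ n := mul_le_mul_of_nonneg_right hn.le (by positivity)
        _ ≤ ε * q' ^ (M * (n / M)) := mul_le_mul_of_nonneg_left
            (pow_le_pow_of_le_one hq'0.le hq'1.le (Nat.mul_div_le n M)) hε.le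
        _ ≤ ε * τ ^ (n / M) := by
            rw [pow_mul]
            exact mul_le_mul_of_nonneg_left (pow_le_pow_left₀ (by positivity) hM.le _) hε.le
    -- Given the prefix, the strip is fixed and the tail still has law `ν_p`.
    refine (bernoulli_real_prefix_le p n
      (fun w => {i | |inner ℝ (ζ w) (S.proj i) - s w| ≤ K * q ^ n})
      (fun w => measurableSet_strip _ _ _) fun w => ?_).2
    refine le_trans (measureReal_mono fun i hi => ?_) (hstrip (n / M) (ζ w) (s w) (hζ w))
    exact le_trans hi h1
  have hsum : Summable fun n : ℕ => ρ ^ (n / M) := by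
    set t := ρ ^ ((M : ℝ)⁻¹) with ht
    have ht0 : 0 < t := Real.rpow_pos_of_pos hρ0 _
    have ht1 : t < 1 := Real.rpow_lt_one hρ0.le hρ1 (by positivity)
    have htM : t ^ M = ρ := Real.rpow_inv_natCast_pow hρ0.le hM0.ne'
    refine Summable.of_nonneg_of_le (fun n => by positivity) (fun n => ?_)
      ((summable_geometric_of_lt_one ht0.le ht1).mul_left (t ^ M)⁻¹)
    rw [← div_eq_inv_mul, le_div_iff₀ (by positivity)]
    conv_lhs => rw [← htM]
    rw [← pow_mul, ← pow_add]
    refine pow_le_pow_of_le_one ht0.le ht1.le ?_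
    have := Nat.div_add_mod n M
    have := Nat.mod_lt n hM0
    omega
  have hsum' : Summable fun n => (bernoulli p).real (B n) := by
    refine Summable.of_norm_bounded_eventually_nat hsum ?_
    filter_upwards [hbound] with n hn
    rwa [Real.norm_of_nonneg measureReal_nonneg]
  have hfin : ∑' n, bernoulli p (B n) ≠ ⊤ := by
    have h1 : ∀ n, bernoulli p (B n) = ENNReal.ofReal ((bernoulli p).real (B n)) := fun n =>
      (ofReal_measureReal).symm
    simp only [h1]
    exact hsum'.tsum_ofReal_ne_top
  filter_upwards [ae_eventually_notMem hfin] with i hi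
  filter_upwards [hi] with n hn
  exact not_le.1 hn

end AffineIFS

/-! ### Generic words and the fibre structure -/

theorem IsSVD.smul {B : Plane →L[ℝ] Plane} {a₁ a₂ : ℝ} {e₁ e₂ h₁ h₂ : Plane}
    (h : IsSVD B a₁ a₂ e₁ e₂ h₁ h₂) {s : ℝ} (hs : s = 1 ∨ s = -1) :
    IsSVD B a₁ a₂ (s • e₁) (s • e₂) (s • h₁) (s • h₂) := by
  rcases hs with rfl | rfl
  · simpa using h
  · simpa using h.neg

/-- If a point is close, in the direction of `B u`, to the extreme point of a set in that direction,
then it is close to the extreme point in the direction of the first right singular vector. -/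
theorem IsSVD.abs_inner_le_of_extreme {B : Plane →L[ℝ] Plane} {a₁ a₂ : ℝ} {e₁ e₂ h₁ h₂ : Plane}
    (h : IsSVD B a₁ a₂ e₁ e₂ h₁ h₂) {u : Plane} (hu : ‖u‖ = 1) (huh : 1 / 2 ≤ inner ℝ h₁ u)
    {e z z₀ : Plane} {D δ : ℝ} (hez : ‖e - z₀‖ ≤ D) (hzz : ‖z - z₀‖ ≤ D)
    (hz : inner ℝ e₁ z ≤ inner ℝ e₁ z₀) (hz₀ : inner ℝ u (B z₀) ≤ inner ℝ u (B z))
    (hclose : |inner ℝ u (B (e - z₀))| ≤ δ * a₂) :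
    a₁ * |inner ℝ e₁ (e - z)| ≤ (2 * δ + 4 * D) * a₂ := by
  -- The functional `⟪u, B ·⟫` is a multiple, at least `a₁ / 2`, of `⟪e₁, ·⟫`, up to an error of at
  -- most `a₂ D`. Hence `2(δ + D)` from the closeness and `2D` from comparing the two extreme
  -- points.
  have hexp : ∀ d, inner ℝ u (B d) =
      inner ℝ h₁ u * (a₁ * inner ℝ e₁ d) + inner ℝ h₂ u * (a₂ * inner ℝ e₂ d) := by
    intro d
    rw [h.target.inner_mul_add, h.inner_fst, h.inner_snd]
  have hsmall : ∀ d, ‖d‖ ≤ D → |inner ℝ h₂ u * (a₂ * inner ℝ e₂ d)| ≤ a₂ * D := by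
    intro d hd
    have h1 := h.target.abs_inner_snd_le u
    have h2 := h.source.abs_inner_snd_le d
    rw [hu] at h1
    rw [abs_mul, abs_mul, abs_of_pos h.pos]
    calc _ ≤ 1 * (a₂ * |inner ℝ e₂ d|) :=
          mul_le_mul_of_nonneg_right h1 (mul_nonneg h.pos.le (abs_nonneg _))
      _ ≤ _ := by rw [one_mul]; exact mul_le_mul_of_nonneg_left (h2.trans hd) h.pos.le
  have hA : a₁ * |inner ℝ e₁ (e - z₀)| ≤ 2 * (δ + D) * a₂ := by
    rw [hexp] at hclose
    have h1 := hsmall _ hez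
    have h2 : |inner ℝ h₁ u * (a₁ * inner ℝ e₁ (e - z₀))| ≤ (δ + D) * a₂ := by
      rw [abs_le] at *
      constructor <;> linarith
    rw [abs_mul, abs_mul, abs_of_pos h.pos_fst, abs_of_pos (by linarith : 0 < inner ℝ h₁ u)] at h2
    have h3 : 0 ≤ a₁ * |inner ℝ e₁ (e - z₀)| := mul_nonneg h.pos_fst.le (abs_nonneg _)
    nlinarith
  have hB : a₁ * |inner ℝ e₁ (z - z₀)| ≤ 2 * D * a₂ := by
    have h1 := hsmall _ hzz
    have h2 : 0 ≤ inner ℝ u (B (z - z₀)) := by rw [map_sub, inner_sub_right]; linarith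
    rw [hexp] at h2
    have h3 : inner ℝ e₁ (z - z₀) ≤ 0 := by rw [inner_sub_right]; linarith
    rw [abs_of_nonpos h3]
    rw [abs_le] at h1
    have h4 : 0 ≤ a₁ * -inner ℝ e₁ (z - z₀) := mul_nonneg h.pos_fst.le (by linarith)
    nlinarith
  have hC : |inner ℝ e₁ (e - z)| ≤ |inner ℝ e₁ (e - z₀)| + |inner ℝ e₁ (z - z₀)| := by
    rw [show e - z = (e - z₀) - (z - z₀) by abel, inner_sub_right]
    exact abs_sub _ _
  have := mul_le_mul_of_nonneg_left hC h.pos_fst.le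
  linarith

namespace AffineIFS

variable {m : ℕ} {S : AffineIFS m} {E : Set Plane}

/-- The properties of almost every infinite word that determine the tangent sets at its
projection. -/
structure IsGenericWord (S : AffineIFS m) (E : Set Plane) (q K : ℝ) (i : ℕ → Fin m) (u : Plane)
    (e₁ e₂ h₁ h₂ : ℕ → Plane) : Prop where
  norm_eq : ‖u‖ = 1
  svd : ∀ n, IsSVD (S.AWord (wordPrefix i n)) (S.α 0 (wordPrefix i n)) (S.α 1 (wordPrefix i n))
    (e₁ n) (e₂ n) (h₁ n) (h₂ n)
  tendsto : Tendsto h₁ atTop (𝓝 u)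
  flat : ∀ᶠ n in atTop, S.α 1 (wordPrefix i n) ≤ q ^ n * S.α 0 (wordPrefix i n)
  projection : ∀ᶠ n in atTop, ∀ j : List (Fin m),
    IsLineSegment ((Submodule.span ℝ {u}).starProjection '' S.cylinder E (wordPrefix i n ++ j))
  avoid : ∀ (j : List (Fin m)) (σ : ℝ), σ = 1 ∨ σ = -1 → ∀ᶠ n in atTop, ∃ z ∈ S.cylinder E j,
    (∀ z' ∈ S.cylinder E j, inner ℝ (σ • e₁ n) z ≤ inner ℝ (σ • e₁ n) z') ∧
    K * q ^ n < |inner ℝ (σ • e₁ n) (S.proj (wordShift n i) - z)|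

/-- Almost every word is generic. -/
theorem IsSelfAffineSet.ae_exists_isGenericWord (hE : S.IsSelfAffineSet E) (hm : 2 ≤ m)
    (p : PMF (Fin m)) (hp : ∀ a, 0 < p a) (hsep : S.StrongSeparation E)
    (hproj : S.ProjectionCondition p E) (hlyap : S.lyapunov p 0 < S.lyapunov p 1) :
    ∃ q : ℝ, 0 < q ∧ q < 1 ∧ ∀ K : ℝ, ∀ᵐ i ∂bernoulli p, ∃ u, S.IsLimitDirection i u ∧
      ∃ e₁ e₂ h₁ h₂, S.IsGenericWord E q K i u e₁ e₂ h₁ h₂ := by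
  obtain ⟨q, hq0, hq1, hflat⟩ := S.exists_flattening p hlyap
  refine ⟨q, hq0, hq1, fun K => ?_⟩
  choose e₁ e₂ h₁ h₂ hsvd using S.exists_isSVD
  obtain ⟨κ, hκ, hwidth⟩ : ∃ κ : ℝ, 0 < κ ∧
      ∀ η : Plane, ‖η‖ = 1 → ∃ z ∈ E, ∃ z' ∈ E, κ < inner ℝ η (z - z') := by
    -- A single good word already shows that `E` is not contained in a line.
    obtain ⟨i, hi1, hi2⟩ := (hflat.and hproj).exists
    obtain ⟨s, u, hs, hu, hlim, -⟩ := S.exists_limitDirection hsvd hq1 i hi1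
    obtain ⟨n₀, hn₀⟩ := hi2 u hlim
    exact exists_width fun η hη => hE.exists_inner_ne hm hsep hu (hn₀ n₀ le_rfl []) hη
  have hmin : ∀ (η : Plane) (j : List (Fin m)), ∃ z ∈ S.cylinder E j,
      ∀ z' ∈ S.cylinder E j, inner ℝ η z ≤ inner ℝ η z' := by
    intro η j
    obtain ⟨z, hz, hzmin⟩ := (hE.isCompact_cylinder j).exists_isMinOn (hE.nonempty.image _)
      (f := fun z => inner ℝ η z) (by fun_prop)
    exact ⟨z, hz, fun z' hz' => hzmin hz'⟩
  choose zmin hzmem hzmin using hmin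
  have havoid : ∀ σ : ℝ, σ = 1 ∨ σ = -1 → ∀ j : List (Fin m), ∀ᵐ i ∂bernoulli p, ∀ᶠ n in atTop,
      K * q ^ n < |inner ℝ (σ • e₁ (wordPrefix i n))
        (S.proj (wordShift n i) - zmin (σ • e₁ (wordPrefix i n)) j)| := by
    intro σ hσ j
    have hunit : ∀ w, ‖σ • e₁ w‖ = 1 := fun w => ((hsvd w).smul hσ).source.norm_fst
    filter_upwards [hE.ae_eventually_avoid p hp hκ hwidth hq0 hq1 K (fun w => σ • e₁ w) hunit
      fun w => inner ℝ (σ • e₁ w) (zmin (σ • e₁ w) j)] with i hi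
    filter_upwards [hi] with n hn
    rwa [inner_sub_right]
  have h1 := ae_all_iff.2 (havoid 1 (Or.inl rfl))
  have h2 := ae_all_iff.2 (havoid (-1) (Or.inr rfl))
  filter_upwards [hflat, hproj, h1, h2] with i hi hpi hi1 hi2
  obtain ⟨s, u, hs, hu, hlim, htend⟩ := S.exists_limitDirection hsvd hq1 i hi
  obtain ⟨n₀, hn₀⟩ := hpi u hlim
  refine ⟨u, hlim, fun n => s n • e₁ (wordPrefix i n), fun n => s n • e₂ (wordPrefix i n),
    fun n => s n • h₁ (wordPrefix i n), fun n => s n • h₂ (wordPrefix i n),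
    hu, fun n => (hsvd _).smul (hs n), htend, hi, ?_, fun j σ hσ => ?_⟩
  · filter_upwards [eventually_ge_atTop n₀] with n hn using hn₀ n hn
  · filter_upwards [hi1 j, hi2 j] with n hn1 hn2
    rw [smul_smul]
    -- The signs that make `h₁` converge may interchange the two ends of a cylinder, which is
    -- harmless because both ends are avoided.
    have : σ * s n = 1 ∨ σ * s n = -1 := by
      rcases hσ with rfl | rfl <;> rcases hs n with h | h <;> rw [h] <;> norm_num
    rcases this with h | h <;> rw [h]
    · exact ⟨_, hzmem _ j, hzmin _ j, hn1⟩
    · exact ⟨_, hzmem _ j, hzmin _ j, hn2⟩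

theorem cylinder_append (w j : List (Fin m)) :
    S.cylinder E (w ++ j) = S.fWord w '' S.cylinder E j := by
  rw [cylinder, cylinder, image_image]
  exact image_congr fun z _ => S.fWord_append w j z

namespace IsGenericWord

variable {q K : ℝ} {i : ℕ → Fin m} {u : Plane} {e₁ e₂ h₁ h₂ : ℕ → Plane}

/-- The ends of the projections of the cylinders are eventually far from the projection of the
point. -/
theorem eventually_far (hE : S.IsSelfAffineSet E) (h : S.IsGenericWord E q K i u e₁ e₂ h₁ h₂)
    {D δ : ℝ} (hdiam : ∀ x ∈ E, ∀ y ∈ E, ‖x - y‖ ≤ D) (hK : K = 2 * δ + 4 * D) (hK0 : 0 < K)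
    (j : List (Fin m)) {σ : ℝ} (hσ : σ = 1 ∨ σ = -1) : ∀ᶠ n in atTop,
      ∀ z₀ ∈ S.cylinder E j, (∀ z ∈ S.cylinder E j,
        inner ℝ (σ • u) (S.AWord (wordPrefix i n) z₀) ≤
          inner ℝ (σ • u) (S.AWord (wordPrefix i n) z)) →
      δ * S.α 1 (wordPrefix i n) < |inner ℝ u (S.AWord (wordPrefix i n)
        (S.proj (wordShift n i) - z₀))| := by
  have hsub : S.cylinder E j ⊆ E := by
    rintro _ ⟨z, hz, rfl⟩
    exact hE.fWord_mem j hz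
  have hinner : ∀ᶠ n in atTop, 1 / 2 < inner ℝ (h₁ n) u := by
    have h1 : Tendsto (fun n => inner ℝ (h₁ n) u) atTop (𝓝 (inner ℝ u u)) :=
      h.tendsto.inner tendsto_const_nhds
    rw [real_inner_self_eq_norm_sq, h.norm_eq, one_pow] at h1
    exact h1.eventually (lt_mem_nhds (by norm_num))
  filter_upwards [hinner, h.flat, h.avoid j σ hσ] with n hn hflat hav z₀ hz₀ hmin
  obtain ⟨z, hz, hzmin, hlt⟩ := hav
  by_contra hcon
  push Not at hcon
  have hsvd := (h.svd n).smul hσ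
  have hσσ : σ * σ = 1 := by rcases hσ with rfl | rfl <;> norm_num
  have habs : |σ| = 1 := by rcases hσ with rfl | rfl <;> norm_num
  -- Closeness to the end along `u` gives closeness along `e₁` at scale `K α₂/α₁ ≤ K q ^ n`,
  -- contradicting `avoid`.
  have hmain := hsvd.abs_inner_le_of_extreme (u := σ • u) (e := S.proj (wordShift n i)) (z := z)
    (z₀ := z₀) (D := D) (δ := δ)
    (by rw [norm_smul, h.norm_eq, Real.norm_eq_abs, habs, one_mul])
    (by rw [real_inner_smul_left, real_inner_smul_right, ← mul_assoc, hσσ, one_mul]; exact hn.le)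
    (hdiam _ (hE.proj_mem _) _ (hsub hz₀)) (hdiam _ (hsub hz) _ (hsub hz₀)) (hzmin z₀ hz₀)
    (hmin z hz) (by rw [real_inner_smul_left, abs_mul, habs, one_mul]; exact hcon)
  rw [← hK] at hmain
  have h1 := mul_lt_mul_of_pos_left hlt (h.svd n).pos_fst
  have h2 := mul_le_mul_of_nonneg_left hflat hK0.le
  linarith

/-- At the scale of the thickness of a cylinder, `E` is approximately a union of lines in the limit
direction. -/
theorem eventually_fibre (hE : S.IsSelfAffineSet E) (h : S.IsGenericWord E q K i u e₁ e₂ h₁ h₂)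
    {D δ τ : ℝ} (hD : 0 < D) (hdiam : ∀ x ∈ E, ∀ y ∈ E, ‖x - y‖ ≤ D) (hK : K = 2 * δ + 4 * D)
    (hδ0 : 0 < δ) (hτ0 : 0 < τ)
    (hδ : ∀ a c : Fin m, a ≠ c → ∀ x ∈ S.f a '' E, ∀ y ∈ S.f c '' E, δ < dist x y)
    {ε : ℝ} (hε : 0 < ε) : ∀ᶠ n in atTop, ∀ t : ℝ, δ * τ * S.α 1 (wordPrefix i n) ≤ t →
      t < δ * S.α 1 (wordPrefix i n) → ∀ y ∈ E, ‖y - S.proj i‖ ≤ t → ∀ s : ℝ, |s| ≤ 1 →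
      ∃ y' ∈ E, inner ℝ u (y' - S.proj i) = s * t ∧
        |inner ℝ (rotateQuarter u) (y' - y)| ≤ ε * t := by
  obtain ⟨r, hr0, hr1, hr⟩ := S.exists_contraction
  have hlim : Tendsto (fun n : ℕ => r ^ n * D) atTop (𝓝 0) := by
    simpa using (tendsto_pow_atTop_nhds_zero_of_lt_one hr0.le hr1).mul_const D
  -- With this `k`, each cylinder `E_{wj}` has extent at most `ε t / 4` in the direction `h₂ n`.
  obtain ⟨k, hk⟩ := (hlim.eventually (gt_mem_nhds
    (show 0 < ε / 4 * (δ * τ) by positivity))).exists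
  -- The bound `1 / 2` lets the unknown height difference be absorbed at the end; `ε / 8` handles
  -- the horizontal displacement of up to `2 t`.
  have hclose : ∀ᶠ n in atTop, ‖u - h₁ n‖ < min (1 / 2) (ε / 8) := by
    have h1 : Tendsto (fun n => ‖u - h₁ n‖) atTop (𝓝 0) := by
      simpa using (h.tendsto.const_sub u).norm
    exact h1.eventually (gt_mem_nhds (by positivity))
  have hK0 : 0 < K := by rw [hK]; positivity
  have hfin : {j : List (Fin m) | j.length = k}.Finite := List.finite_length_eq _ _
  have hfar1 := (Filter.eventually_all_finite hfin).2 fun j _ =>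
    eventually_far hE h hdiam hK hK0 j (Or.inl rfl : (1 : ℝ) = 1 ∨ (1 : ℝ) = -1)
  have hfar2 := (Filter.eventually_all_finite hfin).2 fun j _ =>
    eventually_far hE h hdiam hK hK0 j (Or.inr rfl : (-1 : ℝ) = 1 ∨ (-1 : ℝ) = -1)
  filter_upwards [hclose, hfar1, hfar2, h.projection] with n hcl hf1 hf2 hpr t ht1 ht2 y hy hyt s hs
  set w := wordPrefix i n with hw
  set e := S.proj (wordShift n i) with he
  have hα := S.α_pos 1 w
  have ht0 : 0 < t := lt_of_lt_of_le (by positivity) ht1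
  have hx : S.proj i = S.fWord w e := S.proj_eq_fWord i n
  have hyc : y ∈ S.cylinder E w := by
    by_contra hcon
    have := hE.lt_dist_of_notMem_cylinder hδ0 hδ i n (hE.mem_cylinder_prefix i n) hy hcon
    rw [norm_sub_rev] at this
    linarith
  obtain ⟨z, hz, rfl⟩ := hyc
  obtain ⟨l, rfl⟩ := hE.exists_proj hz
  set j := wordPrefix l k with hj
  have hjk : j.length = k := length_wordPrefix l k
  have hzj : S.proj l ∈ S.cylinder E j := hE.mem_cylinder_prefix l k
  obtain ⟨a, b, hab, hIcc⟩ := (hpr j).exists_Icc h.norm_eq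
  rw [cylinder_append, image_image] at hIcc
  have hmem : ∀ z' ∈ S.cylinder E j, inner ℝ u (S.fWord w z') ∈ Icc a b := fun z' hz' => by
    rw [← hIcc]; exact ⟨z', hz', rfl⟩
  obtain ⟨za, hza, hzaa⟩ : a ∈ (fun z' => inner ℝ u (S.fWord w z')) '' S.cylinder E j := by
    rw [hIcc]; exact left_mem_Icc.2 hab.le
  obtain ⟨zb, hzb, hzbb⟩ : b ∈ (fun z' => inner ℝ u (S.fWord w z')) '' S.cylinder E j := by
    rw [hIcc]; exact right_mem_Icc.2 hab.le
  simp only at hzaa hzbb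
  have hdiff : ∀ z₁ z₂, inner ℝ u (S.AWord w (z₁ - z₂)) =
      inner ℝ u (S.fWord w z₁) - inner ℝ u (S.fWord w z₂) := fun z₁ z₂ => by
    rw [← fWord_sub, inner_sub_right]
  have ha := hf1 j hjk za hza fun z' hz' => by
    rw [one_smul]
    have h1 := hdiff za z'
    rw [map_sub, inner_sub_right] at h1
    linarith [(hmem z' hz').1]
  have hb := hf2 j hjk zb hzb fun z' hz' => by
    rw [neg_one_smul, inner_neg_left, inner_neg_left]
    have h1 := hdiff zb z'
    rw [map_sub, inner_sub_right] at h1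
    linarith [(hmem z' hz').2]
  rw [hdiff, ← hx, hzaa] at ha
  rw [hdiff, ← hx, hzbb] at hb
  have hyu : |inner ℝ u (S.fWord w (S.proj l)) - inner ℝ u (S.proj i)| ≤ t := by
    rw [← inner_sub_right]
    refine (abs_real_inner_le_norm _ _).trans ?_
    rw [h.norm_eq, one_mul]
    exact hyt
  have hyab := hmem _ hzj
  rw [abs_le] at hyu
  -- The interval `[a, b]` contains the projection of `y`, which is within `t` of that of `x`. Both
  -- ends are farther than `t` from the latter, so they lie on opposite sides and the whole window
  -- is covered.
  have ha' : a < inner ℝ u (S.proj i) - t := by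
    rcases lt_abs.1 ha with h1 | h1
    · linarith
    · linarith [hyab.1]
  have hb' : inner ℝ u (S.proj i) + t < b := by
    rcases lt_abs.1 hb with h1 | h1
    · linarith [hyab.2]
    · linarith
  have hst := abs_le.1 hs
  obtain ⟨z', hz', hzz'⟩ : inner ℝ u (S.proj i) + s * t ∈
      (fun z' => inner ℝ u (S.fWord w z')) '' S.cylinder E j := by
    rw [hIcc]
    constructor <;> nlinarith [hst.1, hst.2]
  simp only at hzz'
  have hz'E : z' ∈ E := by
    obtain ⟨z'', hz'', rfl⟩ := hz'
    exact hE.fWord_mem j hz''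
  refine ⟨S.fWord w z', hE.fWord_mem w hz'E, by rw [inner_sub_right, hzz']; ring, ?_⟩
  set d := S.fWord w z' - S.fWord w (S.proj l) with hd
  have hJ := OrthoPair.rotateQuarter h.norm_eq
  have hud : |inner ℝ u d| ≤ 2 * t := by
    rw [hd, inner_sub_right, hzz', abs_le]
    constructor <;> nlinarith [hst.1, hst.2]
  have hzdist : ‖z' - S.proj l‖ ≤ r ^ k * D := by
    obtain ⟨z'', hz'', rfl⟩ := hz'
    rw [S.proj_eq_fWord l k]
    refine (S.dist_fWord_le hr0.le hr _ _ _).trans ?_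
    rw [hjk]
    exact mul_le_mul_of_nonneg_left (hdiam _ hz'' _ (hE.proj_mem _)) (by positivity)
  have hh2 : |inner ℝ (h₂ n) d| ≤ ε / 4 * t := by
    rw [hd, fWord_sub, (h.svd n).inner_snd, abs_mul, abs_of_pos (h.svd n).pos]
    have h1 := ((h.svd n).source.abs_inner_snd_le (z' - S.proj l)).trans (hzdist.trans hk.le)
    calc _ ≤ S.α 1 w * (ε / 4 * (δ * τ)) := mul_le_mul_of_nonneg_left h1 hα.le
      _ = ε / 4 * (δ * τ * S.α 1 w) := by ring
      _ ≤ _ := mul_le_mul_of_nonneg_left ht1 (by positivity)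
  have hJh : |inner ℝ (rotateQuarter (h₁ n)) d| ≤ ε / 4 * t := by
    rcases (h.svd n).target.eq_rotateQuarter with h1 | h1
    · rwa [h1] at hh2
    · rwa [h1, inner_neg_left, abs_neg] at hh2
  have hJd : |inner ℝ (rotateQuarter u) d| ≤ ε / 4 * t + ‖u - h₁ n‖ * ‖d‖ := by
    have h1 := abs_real_inner_le_norm (rotateQuarter u - rotateQuarter (h₁ n)) d
    rw [norm_rotateQuarter_sub, inner_sub_left] at h1
    have h2 := abs_sub_abs_le_abs_sub (inner ℝ (rotateQuarter u) d)
      (inner ℝ (rotateQuarter (h₁ n)) d)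
    linarith
  have hdn := hJ.norm_le d
  have hX := abs_nonneg (inner ℝ (rotateQuarter u) d)
  have c1 : ‖u - h₁ n‖ ≤ 1 / 2 := hcl.le.trans (min_le_left _ _)
  have c2 : ‖u - h₁ n‖ ≤ ε / 8 := hcl.le.trans (min_le_right _ _)
  have c3 : ‖u - h₁ n‖ * ‖d‖ ≤ ε / 8 * (2 * t) + 1 / 2 * |inner ℝ (rotateQuarter u) d| := by
    calc _ ≤ ‖u - h₁ n‖ * (2 * t + |inner ℝ (rotateQuarter u) d|) :=
          mul_le_mul_of_nonneg_left (by linarith) (norm_nonneg _)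
      _ = ‖u - h₁ n‖ * (2 * t) + ‖u - h₁ n‖ * |inner ℝ (rotateQuarter u) d| := by ring
      _ ≤ _ := add_le_add (mul_le_mul_of_nonneg_right c2 (by positivity))
          (mul_le_mul_of_nonneg_right c1 hX)
  linarith

end IsGenericWord

end AffineIFS

/-! ### Tangent sets -/

/-- Points of a tangent set are limits of points of the sceneries. -/
theorem exists_seq_of_mem_tangentSet {E T : Set Plane} {x z : Plane} {t : ℕ → ℝ}
    (hE : IsCompact E) (hx : x ∈ E) (ht : ∀ n, 0 < t n)
    (hT : Tendsto (fun n => Metric.hausdorffEDist (scenery E x (t n)) T) atTop (𝓝 0))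
    (hz : z ∈ T) : ∃ y : ℕ → Plane, (∀ n, y n ∈ E ∧ ‖y n - x‖ ≤ t n) ∧
      Tendsto (fun n => (t n)⁻¹ • (y n - x)) atTop (𝓝 z) := by
  have h1 : ∀ n, ∃ y ∈ E ∩ Metric.closedBall x (t n), ∀ y' ∈ E ∩ Metric.closedBall x (t n),
      ‖(t n)⁻¹ • (y - x) - z‖ ≤ ‖(t n)⁻¹ • (y' - x) - z‖ := by
    intro n
    obtain ⟨y, hy, hmin⟩ := (hE.inter_right Metric.isClosed_closedBall).exists_isMinOn
      (⟨x, hx, Metric.mem_closedBall_self (ht n).le⟩ : (E ∩ Metric.closedBall x (t n)).Nonempty)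
      (f := fun y => ‖(t n)⁻¹ • (y - x) - z‖) (by fun_prop)
    exact ⟨y, hy, fun y' hy' => hmin hy'⟩
  choose y hy hmin using h1
  refine ⟨y, fun n => ⟨(hy n).1, by rw [← dist_eq_norm]; exact (hy n).2⟩, ?_⟩
  rw [Metric.tendsto_atTop']
  intro ε hε
  obtain ⟨N, hN⟩ := eventually_atTop.1 (hT.eventually (gt_mem_nhds (ENNReal.ofReal_pos.2 hε)))
  refine ⟨N, fun n hn => ?_⟩
  have h2 := hN n hn.le
  rw [Metric.hausdorffEDist_comm] at h2
  obtain ⟨_, ⟨y', hy', rfl⟩, hlt⟩ := Metric.exists_edist_lt_of_hausdorffEDist_lt hz h2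
  rw [edist_comm, edist_dist, ENNReal.ofReal_lt_ofReal_iff hε, dist_eq_norm] at hlt
  rw [dist_eq_norm]
  exact (hmin n y' hy').trans_lt hlt

/-- Limits of points of the sceneries belong to the tangent set. -/
theorem mem_tangentSet_of_frequently {E T : Set Plane} {x z : Plane} {t : ℕ → ℝ}
    (hTc : IsClosed T)
    (hT : Tendsto (fun n => Metric.hausdorffEDist (scenery E x (t n)) T) atTop (𝓝 0))
    (hz : ∀ ε : ℝ, 0 < ε → ∃ᶠ n in atTop, ∃ y ∈ E, ‖y - x‖ ≤ t n ∧ ‖(t n)⁻¹ • (y - x) - z‖ < ε) :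
    z ∈ T := by
  rw [← hTc.closure_eq, Metric.mem_closure_iff]
  intro ε hε
  have h1 := hT.eventually (gt_mem_nhds (ENNReal.ofReal_pos.2 (half_pos hε)))
  obtain ⟨n, ⟨y, hy, hyt, hyz⟩, hn⟩ := ((hz (ε / 2) (half_pos hε)).and_eventually h1).exists
  have hmem : (t n)⁻¹ • (y - x) ∈ scenery E x (t n) :=
    ⟨y, ⟨hy, by rwa [Metric.mem_closedBall, dist_eq_norm]⟩, rfl⟩
  obtain ⟨b, hb, hlt⟩ := Metric.exists_edist_lt_of_hausdorffEDist_lt hmem hn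
  rw [edist_dist, ENNReal.ofReal_lt_ofReal_iff (half_pos hε), dist_eq_norm] at hlt
  refine ⟨b, hb, ?_⟩
  rw [dist_eq_norm]
  have h2 := norm_sub_le ((t n)⁻¹ • (y - x) - b) ((t n)⁻¹ • (y - x) - z)
  rw [show (t n)⁻¹ • (y - x) - b - ((t n)⁻¹ • (y - x) - z) = z - b by abel] at h2
  linarith

theorem norm_le_one_of_scenery {x y : Plane} {t : ℝ} (ht : 0 < t) (hy : ‖y - x‖ ≤ t) :
    ‖t⁻¹ • (y - x)‖ ≤ 1 := by
  rw [norm_smul, norm_inv, Real.norm_of_nonneg ht.le, inv_mul_le_iff₀ ht, mul_one]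
  exact hy

/-- A closed subset of the unit disc that contains, with each of its points, the open chord in
direction `u` consists of full chords. -/
theorem eq_rotationTo_lineFibres {u : Plane} (hu : ‖u‖ = 1) {T : Set Plane} (hT : IsClosed T)
    (hball : ∀ z ∈ T, ‖z‖ ≤ 1)
    (hfib : ∀ z ∈ T, ∀ s : ℝ, s ^ 2 + inner ℝ (rotateQuarter u) z ^ 2 < 1 →
      s • u + inner ℝ (rotateQuarter u) z • rotateQuarter u ∈ T) :
    T = rotationTo u '' lineFibres ((fun z => inner ℝ (rotateQuarter u) z) '' T) := by
  have ho := OrthoPair.rotateQuarter hu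
  apply Subset.antisymm
  · intro z hz
    refine ⟨!₂[inner ℝ u z, inner ℝ (rotateQuarter u) z], ⟨⟨z, hz, by simp⟩, ?_⟩, ?_⟩
    · rw [mem_closedBall_zero_iff]
      refine le_trans (le_of_eq ?_) (hball z hz)
      refine (pow_left_inj₀ (norm_nonneg _) (norm_nonneg _) two_ne_zero).1 ?_
      rw [norm_sq_plane, ho.norm_sq]
      simp
    · rw [rotationTo_eq]
      simpa using (ho.eq_add z).symm
  · rintro _ ⟨w, ⟨⟨z, hz, hzw⟩, hw⟩, rfl⟩
    rw [mem_closedBall_zero_iff] at hw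
    have hw2 : w 0 ^ 2 + w 1 ^ 2 ≤ 1 := by
      rw [← norm_sq_plane]; exact pow_le_one₀ (norm_nonneg _) hw
    simp only at hzw
    rw [rotationTo_eq]
    have hfib' := hfib z hz
    rw [hzw] at hfib'
    have hz2 := ho.norm_sq z
    rw [hzw] at hz2
    have hz1 : ‖z‖ ^ 2 ≤ 1 := pow_le_one₀ (norm_nonneg _) (hball z hz)
    -- If `w 0 ≠ 0`, shrinking the first coordinate moves the point into the open disc, and
    -- closedness recovers it. If `w 0 = 0` and `w 1 = ±1`, then `‖z‖ ≤ 1` forces `z` to be the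
    -- point itself.
    by_cases h0 : w 0 = 0
    · rcases lt_or_ge (w 1 ^ 2) 1 with h1 | h1
      · exact hfib' _ (by rw [h0]; linarith)
      · have h3 : inner ℝ u z = 0 := by
          have : inner ℝ u z ^ 2 ≤ 0 := by linarith
          exact pow_eq_zero_iff two_ne_zero |>.1 (le_antisymm this (sq_nonneg _))
        rw [h0, ← hzw, ← h3, ← ho.eq_add z]
        exact hz
    · have hlim : Tendsto (fun n : ℕ => ((1 - 1 / ((n : ℝ) + 1)) * w 0) • u +
          w 1 • rotateQuarter u) atTop (𝓝 (w 0 • u + w 1 • rotateQuarter u)) := by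
        have h1 : Tendsto (fun n : ℕ => (1 - 1 / ((n : ℝ) + 1)) * w 0) atTop (𝓝 ((1 - 0) * w 0)) :=
          (tendsto_one_div_add_atTop_nhds_zero_nat.const_sub 1).mul_const _
        rw [sub_zero, one_mul] at h1
        exact (h1.smul_const u).add_const _
      refine hT.mem_of_tendsto hlim (Eventually.of_forall fun n => hfib' _ ?_)
      have hn : (0 : ℝ) < 1 / ((n : ℝ) + 1) := by positivity
      have hn1 : 1 / ((n : ℝ) + 1) ≤ 1 := by
        rw [div_le_one (by positivity)]; linarith [(Nat.cast_nonneg n : (0 : ℝ) ≤ n)]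
      have hpos : 0 < w 0 ^ 2 := by positivity
      have : (1 - 1 / ((n : ℝ) + 1)) ^ 2 < 1 := by nlinarith
      rw [mul_pow]
      nlinarith

/-! ### Tangent sets at the projection of a generic word. -/

namespace AffineIFS.IsGenericWord

variable {m : ℕ} {S : AffineIFS m} {E : Set Plane} {q K : ℝ} {i : ℕ → Fin m} {u : Plane}
  {e₁ e₂ h₁ h₂ : ℕ → Plane}

/-- Every small scale is comparable to the thickness of a cylinder. -/
theorem exists_scale {δ τ : ℝ} (hδ0 : 0 < δ) (hτ : ∀ a v, τ * ‖v‖ ≤ ‖S.A a v‖) {t : ℝ}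
    (ht0 : 0 < t) (ht : t < δ) :
    ∃ n, δ * τ * S.α 1 (wordPrefix i n) ≤ t ∧ t < δ * S.α 1 (wordPrefix i n) := by
  obtain ⟨r, hr0, hr1, hr⟩ := S.exists_contraction
  -- The level sought is the last one before `δ α₂` first drops to `t`; the next letter costs at
  -- most the factor `τ`.
  have hex : ∃ n, δ * S.α 1 (wordPrefix i n) ≤ t := by
    have hlim : Tendsto (fun n : ℕ => δ * r ^ n) atTop (𝓝 0) := by
      simpa using (tendsto_pow_atTop_nhds_zero_of_lt_one hr0.le hr1).const_mul δ
    obtain ⟨n, hn⟩ := (hlim.eventually (gt_mem_nhds ht0)).exists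
    refine ⟨n, le_trans (mul_le_mul_of_nonneg_left ?_ hδ0.le) hn.le⟩
    simpa using S.α_one_le_pow hr0.le hr (wordPrefix i n)
  classical
  have hspec := Nat.find_spec hex
  have hn0 : Nat.find hex ≠ 0 := by
    intro h0
    rw [h0, wordPrefix_zero, S.α_one_nil, mul_one] at hspec
    linarith
  obtain ⟨n, hn⟩ := Nat.exists_eq_succ_of_ne_zero hn0
  have hlt := Nat.find_min hex (show n < Nat.find hex by omega)
  rw [hn, Nat.succ_eq_add_one, wordPrefix_succ'] at hspec
  refine ⟨n, le_trans ?_ hspec, not_le.1 hlt⟩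
  rw [mul_assoc]
  exact mul_le_mul_of_nonneg_left (S.α_one_append_singleton_ge hτ _ _) hδ0.le

/-- The levels tend to infinity because `α₂` is positive at each fixed level and decreases along the
prefixes. -/
theorem exists_scales {δ τ : ℝ} (hδ0 : 0 < δ) (hτ0 : 0 < τ)
    (hτ : ∀ a v, τ * ‖v‖ ≤ ‖S.A a v‖) (i : ℕ → Fin m) {t : ℕ → ℝ} (ht0 : ∀ k, 0 < t k)
    (ht : Tendsto t atTop (𝓝 0)) : ∃ n : ℕ → ℕ, Tendsto n atTop atTop ∧ ∀ᶠ k in atTop,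
      δ * τ * S.α 1 (wordPrefix i (n k)) ≤ t k ∧ t k < δ * S.α 1 (wordPrefix i (n k)) := by
  have h1 : ∀ k, ∃ n, t k < δ → δ * τ * S.α 1 (wordPrefix i n) ≤ t k ∧
      t k < δ * S.α 1 (wordPrefix i n) := by
    intro k
    by_cases hk : t k < δ
    · obtain ⟨n, hn⟩ := exists_scale (i := i) hδ0 hτ (ht0 k) hk
      exact ⟨n, fun _ => hn⟩
    · exact ⟨0, fun h => absurd h hk⟩
  choose n hn using h1
  have hsmall := ht.eventually (gt_mem_nhds hδ0)
  refine ⟨n, tendsto_atTop.2 fun N => ?_, hsmall.mono fun k hk => hn k hk⟩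
  filter_upwards [hsmall, ht.eventually (gt_mem_nhds (show 0 < δ * τ * S.α 1 (wordPrefix i N) from
    mul_pos (mul_pos hδ0 hτ0) (S.α_pos 1 _)))] with k hk hkN
  by_contra hcon
  push Not at hcon
  obtain ⟨l, rfl⟩ : ∃ l, N = n k + l := ⟨N - n k, by omega⟩
  rw [wordPrefix_add] at hkN
  have h2 := mul_le_mul_of_nonneg_left (S.α_one_append_le (wordPrefix i (n k))
    (wordPrefix (wordShift (n k) i) l)) (mul_pos hδ0 hτ0).le
  linarith [(hn k hk).1]

/-- The open chords through the points of a tangent set belong to it. -/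
theorem chord_subset (hE : S.IsSelfAffineSet E) (h : S.IsGenericWord E q K i u e₁ e₂ h₁ h₂)
    {D δ : ℝ} (hD : 0 < D) (hdiam : ∀ x ∈ E, ∀ y ∈ E, ‖x - y‖ ≤ D) (hK : K = 2 * δ + 4 * D)
    (hδ0 : 0 < δ) (hδ : ∀ a c : Fin m, a ≠ c → ∀ x ∈ S.f a '' E, ∀ y ∈ S.f c '' E, δ < dist x y)
    {T : Set Plane} (hTc : IsClosed T) {t : ℕ → ℝ} (ht0 : ∀ k, 0 < t k)
    (ht : Tendsto t atTop (𝓝 0))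
    (hT : Tendsto (fun n => Metric.hausdorffEDist (scenery E (S.proj i) (t n)) T) atTop (𝓝 0))
    {z : Plane} (hz : z ∈ T) {s : ℝ} (hs : s ^ 2 + inner ℝ (rotateQuarter u) z ^ 2 < 1) :
    s • u + inner ℝ (rotateQuarter u) z • rotateQuarter u ∈ T := by
  obtain ⟨τ, hτ0, -, hτ⟩ := S.exists_expansion
  obtain ⟨n, hn, hscale⟩ := exists_scales hδ0 hτ0 hτ i ht0 ht
  have ho := OrthoPair.rotateQuarter h.norm_eq
  set c := inner ℝ (rotateQuarter u) z with hc
  set v := s • u + c • rotateQuarter u with hv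
  have hvu : inner ℝ u v = s := ho.inner_smul_add_smul_fst s c
  have hvJ : inner ℝ (rotateQuarter u) v = c := ho.inner_smul_add_smul_snd s c
  have hv1 : ‖v‖ < 1 := by
    have := ho.norm_sq v
    rw [hvu, hvJ] at this
    nlinarith [norm_nonneg v]
  have hs1 : |s| ≤ 1 := by
    rw [← sq_le_one_iff_abs_le_one]
    nlinarith [sq_nonneg c]
  obtain ⟨y, hy, hyz⟩ := exists_seq_of_mem_tangentSet hE.isCompact (hE.proj_mem i) ht0 hT hz
  refine mem_tangentSet_of_frequently hTc hT fun ε hε => Eventually.frequently ?_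
  -- One half is for the height of `y'` relative to `y k`, the other for the convergence of the
  -- heights of `y k`. The bound `1 - ‖v‖` keeps `y'` in the ball of radius `t k`.
  have hε' : 0 < min ε (1 - ‖v‖) / 2 := by
    have : 0 < min ε (1 - ‖v‖) := lt_min hε (by linarith)
    linarith
  have hJz : Tendsto (fun k => inner ℝ (rotateQuarter u) ((t k)⁻¹ • (y k - S.proj i))) atTop
      (𝓝 c) := tendsto_const_nhds.inner hyz
  filter_upwards [hn.eventually (h.eventually_fibre hE hD hdiam hK hδ0 hτ0 hδ hε'), hscale,
    (tendsto_iff_norm_sub_tendsto_zero.1 hJz).eventually (gt_mem_nhds hε')] with k hk hsc hkJ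
  obtain ⟨y', hy', hy'u, hy'J⟩ := hk (t k) hsc.1 hsc.2 (y k) (hy k).1 (hy k).2 s hs1
  have htk := ht0 k
  have hu1 : inner ℝ u ((t k)⁻¹ • (y' - S.proj i) - v) = 0 := by
    rw [inner_sub_right, hvu, real_inner_smul_right, hy'u]
    field_simp
    ring
  have hJ1 : inner ℝ (rotateQuarter u) ((t k)⁻¹ • (y' - S.proj i) - v) =
      (t k)⁻¹ * inner ℝ (rotateQuarter u) (y' - y k) +
      (inner ℝ (rotateQuarter u) ((t k)⁻¹ • (y k - S.proj i)) - c) := by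
    rw [inner_sub_right, hvJ, real_inner_smul_right, real_inner_smul_right,
      show y' - S.proj i = (y' - y k) + (y k - S.proj i) by abel, inner_add_right]
    ring
  have hJ2 : |(t k)⁻¹ * inner ℝ (rotateQuarter u) (y' - y k)| ≤ min ε (1 - ‖v‖) / 2 := by
    rw [abs_mul, abs_of_pos (inv_pos.2 htk), inv_mul_le_iff₀ htk, mul_comm]
    exact hy'J
  have hnorm : ‖(t k)⁻¹ • (y' - S.proj i) - v‖ < min ε (1 - ‖v‖) := by
    have h1 := ho.norm_le ((t k)⁻¹ • (y' - S.proj i) - v)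
    rw [hu1, abs_zero, zero_add, hJ1] at h1
    have h2 := abs_add_le ((t k)⁻¹ * inner ℝ (rotateQuarter u) (y' - y k))
      (inner ℝ (rotateQuarter u) ((t k)⁻¹ • (y k - S.proj i)) - c)
    rw [Real.norm_eq_abs] at hkJ
    linarith
  refine ⟨y', hy', ?_, hnorm.trans_le (min_le_left _ _)⟩
  have h3 : ‖(t k)⁻¹ • (y' - S.proj i)‖ ≤ 1 := by
    have h4 := norm_sub_norm_le ((t k)⁻¹ • (y' - S.proj i)) v
    linarith [min_le_right ε (1 - ‖v‖)]
  rwa [norm_smul, norm_inv, Real.norm_of_nonneg htk.le, inv_mul_le_iff₀ htk, mul_one] at h3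

/-- The heights of a tangent set lie in an affine copy of a slice of `E`. -/
theorem exists_slice (hE : S.IsSelfAffineSet E) (h : S.IsGenericWord E q K i u e₁ e₂ h₁ h₂)
    (hq0 : 0 < q) (hq1 : q < 1) {δ : ℝ}
    (hδ0 : 0 < δ) (hδ : ∀ a c : Fin m, a ≠ c → ∀ x ∈ S.f a '' E, ∀ y ∈ S.f c '' E, δ < dist x y)
    {T : Set Plane} {t : ℕ → ℝ} (ht0 : ∀ k, 0 < t k) (ht : Tendsto t atTop (𝓝 0))
    (hT : Tendsto (fun n => Metric.hausdorffEDist (scenery E (S.proj i) (t n)) T) atTop (𝓝 0)) :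
    ∃ e v : Plane, v ≠ 0 ∧ ∀ z ∈ T, e + inner ℝ (rotateQuarter u) z • v ∈ E := by
  obtain ⟨τ, hτ0, -, hτ⟩ := S.exists_expansion
  obtain ⟨n, hn, hscale⟩ := exists_scales hδ0 hτ0 hτ i ht0 ht
  -- An ultrafilter makes all bounded quantities converge simultaneously, replacing repeated passage
  -- to subsequences. The limits `e`, `η₁`, `η₂`, `θ`, `κ` do not depend on `z`, so a single line
  -- serves all of `T`.
  obtain ⟨l, hl⟩ := Ultrafilter.exists_le (atTop : Filter ℕ)
  have hlim : ∀ {X : Type} [TopologicalSpace X] {A : Set X} (_ : IsCompact A) (f : ℕ → X),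
      (∀ᶠ k in atTop, f k ∈ A) → ∃ a ∈ A, Tendsto f l (𝓝 a) := by
    intro X _ A hA f hf
    exact hA.ultrafilter_le_nhds (l.map f) (le_principal_iff.2 (hl hf))
  have hsphere : IsCompact (Metric.sphere (0 : Plane) 1) := isCompact_sphere 0 1
  obtain ⟨e, he, hetend⟩ := hlim hE.isCompact (fun k => S.proj (wordShift (n k) i))
    (Eventually.of_forall fun k => hE.proj_mem _)
  obtain ⟨η₁, hη₁, hη₁tend⟩ := hlim hsphere (fun k => e₁ (n k))
    (Eventually.of_forall fun k => by simpa using (h.svd (n k)).source.norm_fst)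
  obtain ⟨η₂, hη₂, hη₂tend⟩ := hlim hsphere (fun k => e₂ (n k))
    (Eventually.of_forall fun k => by simpa using (h.svd (n k)).source.norm_snd)
  obtain ⟨θ, hθ, hθtend⟩ := hlim hsphere (fun k => h₂ (n k))
    (Eventually.of_forall fun k => by simpa using (h.svd (n k)).target.norm_snd)
  obtain ⟨κ, hκ, hκtend⟩ := hlim (isCompact_Icc (a := 1 / δ) (b := 1 / (δ * τ)))
    (fun k => S.α 1 (wordPrefix i (n k)) / t k) (by
      filter_upwards [hscale] with k hk
      constructor
      · rw [div_le_div_iff₀ hδ0 (ht0 k)]; linarith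
      · rw [div_le_div_iff₀ (ht0 k) (by positivity)]; linarith)
  have hκ0 : 0 < κ := lt_of_lt_of_le (by positivity) hκ.1
  have hη : OrthoPair η₁ η₂ := by
    refine ⟨by simpa using hη₁, by simpa using hη₂, ?_⟩
    refine tendsto_nhds_unique (hη₁tend.inner hη₂tend) ?_
    exact tendsto_const_nhds.congr fun k => (h.svd (n k)).source.inner_eq.symm
  have hθu : OrthoPair u θ := by
    refine ⟨h.norm_eq, by simpa using hθ, ?_⟩
    refine tendsto_nhds_unique (((h.tendsto.comp hn).mono_left hl).inner hθtend) ?_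
    exact tendsto_const_nhds.congr fun k => (h.svd (n k)).target.inner_eq.symm
  have hmem : ∀ z ∈ T, e + (inner ℝ θ z / κ) • η₂ ∈ E := by
    intro z hz
    obtain ⟨y, hy, hyz⟩ := exists_seq_of_mem_tangentSet hE.isCompact (hE.proj_mem i) ht0 hT hz
    have hcyl : ∀ k, ∃ w, t k < δ * S.α 1 (wordPrefix i (n k)) →
        w ∈ E ∧ S.fWord (wordPrefix i (n k)) w = y k := by
      intro k
      by_cases hk : t k < δ * S.α 1 (wordPrefix i (n k))
      · have hyc : y k ∈ S.cylinder E (wordPrefix i (n k)) := by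
          by_contra hcon
          have := hE.lt_dist_of_notMem_cylinder hδ0 hδ i (n k) (hE.mem_cylinder_prefix i (n k))
            (hy k).1 hcon
          rw [norm_sub_rev] at this
          linarith [(hy k).2]
        obtain ⟨w, hw, hwy⟩ := hyc
        exact ⟨w, fun _ => ⟨hw, hwy⟩⟩
      · exact ⟨0, fun hk' => absurd hk' hk⟩
    choose w hw using hcyl
    obtain ⟨ω, hω, hωtend⟩ := hlim hE.isCompact w (hscale.mono fun k hk => (hw k hk.2).1)
    have hdiff : ∀ᶠ k in atTop, y k - S.proj i =
        S.AWord (wordPrefix i (n k)) (w k - S.proj (wordShift (n k) i)) := by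
      filter_upwards [hscale] with k hk
      rw [← fWord_sub, (hw k hk.2).2, ← S.proj_eq_fWord]
    have hd := hωtend.sub hetend
    -- The pulled-back strip has thickness at most `t / α₁ ≤ δ q ^ n`, so in the limit all points
    -- lie on the line through `e` in direction `η₂`.
    have h1 : inner ℝ η₁ (ω - e) = 0 := by
      have ha : Tendsto (fun k => inner ℝ (e₁ (n k)) (w k - S.proj (wordShift (n k) i))) l
          (𝓝 (inner ℝ η₁ (ω - e))) := hη₁tend.inner hd
      refine tendsto_nhds_unique ha (Tendsto.mono_left ?_ hl)
      have hb : Tendsto (fun k => δ * q ^ n k) atTop (𝓝 0) := by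
        simpa using ((tendsto_pow_atTop_nhds_zero_of_lt_one hq0.le hq1).comp hn).const_mul δ
      refine squeeze_zero_norm' ?_ hb
      filter_upwards [hscale, hdiff, hn.eventually h.flat] with k hk hkd hkf
      have hs := h.svd (n k)
      have e3 := hs.inner_fst (w k - S.proj (wordShift (n k) i))
      rw [← hkd] at e3
      have e4 := (hs.target.abs_inner_fst_le (y k - S.proj i)).trans (hy k).2
      rw [e3, abs_mul, abs_of_pos hs.pos_fst] at e4
      rw [Real.norm_eq_abs]
      refine le_of_mul_le_mul_left ?_ hs.pos_fst
      have e5 := mul_le_mul_of_nonneg_left hkf hδ0.le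
      linarith [hk.2]
    have h2 : inner ℝ θ z = κ * inner ℝ η₂ (ω - e) := by
      have ha : Tendsto (fun k => inner ℝ (h₂ (n k)) ((t k)⁻¹ • (y k - S.proj i))) l
          (𝓝 (inner ℝ θ z)) := hθtend.inner (hyz.mono_left hl)
      have hb : Tendsto (fun k => S.α 1 (wordPrefix i (n k)) / t k *
          inner ℝ (e₂ (n k)) (w k - S.proj (wordShift (n k) i))) l
          (𝓝 (κ * inner ℝ η₂ (ω - e))) := hκtend.mul (hη₂tend.inner hd)
      refine tendsto_nhds_unique ha (hb.congr' (hl ?_))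
      filter_upwards [hdiff] with k hkd
      rw [real_inner_smul_right, hkd, (h.svd (n k)).inner_snd]
      ring
    have h3 := hη.eq_add (ω - e)
    rw [h1, zero_smul, zero_add] at h3
    rw [h2, mul_div_cancel_left₀ _ hκ0.ne', ← h3, add_sub_cancel]
    exact hω
  have hη₂0 : η₂ ≠ 0 := by
    rintro rfl
    simp at hη₂
  -- The limit `θ` of the second axes is the normal of `u` only up to sign; the sign is put into the
  -- direction of the slice.
  rcases hθu.eq_rotateQuarter with h1 | h1
  · refine ⟨e, κ⁻¹ • η₂, smul_ne_zero (inv_ne_zero hκ0.ne') hη₂0, fun z hz => ?_⟩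
    have h2 := hmem z hz
    rwa [h1, div_eq_mul_inv, mul_smul] at h2
  · refine ⟨e, (-κ⁻¹) • η₂, smul_ne_zero (neg_ne_zero.2 (inv_ne_zero hκ0.ne')) hη₂0,
      fun z hz => ?_⟩
    have h2 := hmem z hz
    rwa [h1, inner_neg_left, neg_div, div_eq_mul_inv, ← mul_neg, mul_smul] at h2

end AffineIFS.IsGenericWord

theorem proposition4p1 {m : ℕ} (hm : 2 ≤ m) (S : AffineIFS m) (E : Set Plane)
    (hE : S.IsSelfAffineSet E) (p : PMF (Fin m)) (hp : ∀ a, 0 < p a)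
    (hsep : S.StrongSeparation E)
    (hproj : S.ProjectionCondition p E)
    (hlyap : S.lyapunov p 0 < S.lyapunov p 1)
    (hline : ∀ ρ : ℝ, 0 < ρ → ∃ F ⊆ E,
      1 - ENNReal.ofReal ρ ≤ AffineIFS.bernoulli p (S.proj ⁻¹' F) ∧
      ∃ N : ℕ, S.LineCondition E F N) :
    ∀ᵐ i ∂AffineIFS.bernoulli p, ∃ u : Plane, ‖u‖ = 1 ∧ S.IsLimitDirection i u ∧
      ∀ T : Set Plane, IsTangentSet E (S.proj i) T →
        ∃ C : Set ℝ, IsClosed C ∧ IsPorous C ∧ T = rotationTo u '' lineFibres C := by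
  obtain ⟨δ, hδ0, hδ⟩ := id hsep
  obtain ⟨D, hD, hdiam⟩ := hE.exists_diam
  obtain ⟨q, hq0, hq1, hgen⟩ := hE.ae_exists_isGenericWord hm p hp hsep hproj hlyap
  -- This is the constant produced by `IsSVD.abs_inner_le_of_extreme`.
  filter_upwards [hgen (2 * δ + 4 * D)] with i hi
  obtain ⟨u, hlim, e₁, e₂, h₁, h₂, h⟩ := hi
  refine ⟨u, h.norm_eq, hlim, ?_⟩
  rintro T ⟨hTc, t, ht0, ht, hT⟩
  -- The set `C` consists of the heights of `T` orthogonal to `u`.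
  refine ⟨(fun z => inner ℝ (rotateQuarter u) z) '' T, ?_, ?_, ?_⟩
  · exact (hTc.image (by fun_prop)).isClosed
  · obtain ⟨e, v, hv, hev⟩ := h.exists_slice hE hq0 hq1 hδ0 hδ ht0 ht hT
    refine (hE.isPorous_slice hsep e hv).subset ?_
    rintro _ ⟨z, hz, rfl⟩
    exact hev z hz
  · refine eq_rotationTo_lineFibres h.norm_eq hTc.isClosed (fun z hz => ?_) fun z hz s hs =>
      h.chord_subset hE hD hdiam rfl hδ0 hδ hTc.isClosed ht0 ht hT hz hs
    obtain ⟨y, hy, hyz⟩ := exists_seq_of_mem_tangentSet hE.isCompact (hE.proj_mem i) ht0 hT hz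
    exact le_of_tendsto' hyz.norm fun k => norm_le_one_of_scenery (ht0 k) (hy k).2
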